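/- **Setting.** Signature $(+,-,-,-)$. The Closed Einstein Universe has coordinates $(t,r,\theta,\varphi)$, $r>0$, $0<\theta<\pi$, and, with $\kappa>0$, the metric $$ds^2=dt^2-\frac{dr^2+r^2d\theta^2+r^2\sin^2\theta\,d\varphi^2}{(1+\kappa^2r^2/4)^2},\qquad S=\frac{\kappa^2r^2\sin^2\theta}{(1+\kappa^2r^2/4)^2}.$$ Let $\beta_0=1/T_0>0$, let $\beta=\beta_0(\partial_t+\kappa\omega_0\partial_\varphi)$ with $|\omega_0|<1$, and let $u=\beta/\sqrt{\beta^2}$, $\Delta^{\mu\nu}=g^{\mu\nu}-u^\mu u^\nu$, $A^\mu=u^\nu\nabla_\nu u^\mu$, $\omega_\mu=\frac12E_{\mu\nu\rho\sigma}u^\nu\nabla^\rho u^\sigma$, $l^\mu=E^{\mu\nu\rho\sigma}u_\nu A_\rho\omega_\sigma$, where $E_{\mu\nu\rho\sigma}=\sqrt{-g}\,\epsilon_{\mu\nu\rho\sigma}$ and the indices of $E$ are raised with the metric. The vacuum-subtracted thermal stress-energy tensor of the real conformally coupled massless scalar field is the following. *At rest* ($\omega_0=0$): $\langle T_{\mu\nu}\rangle=\rho\,u_\mu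 u_\nu-\frac{\rho}{3}\Delta_{\mu\nu}$ with $\rho=\frac{\kappa^4}{16\pi^2}\sum_{n\ge1}\frac{2+\cosh(n\kappa\beta_0)}{\sinh^4(n\kappa\beta_0/2)}$. *Rotating* ($\omega_0\neq0$): $\langle T^{\mu\nu}\rangle=\rho u^\mu u^\nu-p\Delta^{\mu\nu}+W\omega^\mu\omega^\nu+\mathcal A A^\mu A^\nu+G(u^\mu l^\nu+u^\nu l^\mu)$, where each $X\in\{\rho,p,\mathcal A,W,G\}$ is $$X=c_X\sum_{n\ge1}\Phi_X(n\kappa\beta_0),\qquad \Phi_X(x)=\frac{N_X(x)}{[1-S-\cosh x+S\cosh(\omega_0x)]^3}.$$ The factors are $$c_\rho=\tfrac{\kappa^4}{12\pi^2(1-S\omega_0^2)},\quad c_p=\tfrac{\kappa^4}{24\pi^2(1-S\omega_0^2)},\quad (c_{\mathcal A},c_W,c_G)=\tfrac{\kappa^2(1-S\omega_0^2)}{6\pi^2(1-S)}\,(\omega_0^{-4},\omega_0^{-2},\omega_0^{-3}),$$ and, with $C=\cosh x$, $c=\cosh\omega_0x$, $s=\sinh x$, $\sigma=\sinh\omega_0x$,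 - $N_\rho=2(1+S^2\omega_0^2)+(-2+S+S^2\omega_0^2)C+(1+S\omega_0^2-2S^2\omega_0^2)c-(1+S+S\omega_0^2+S^2\omega_0^2)Cc-(3+S\omega_0^2)s^2-S(1+3S\omega_0^2)\sigma^2+12S\omega_0s\sigma$, - $N_p=1+7S+S(7+S)\omega_0^2-(1+3S\omega_0^2)\cosh2x+2(1+S(\omega_0^2-2))c-2C[S(-1-(S-2)\omega_0^2)+(1+S)(1+S\omega_0^2)c]-S(3+S\omega_0^2)\cosh2\omega_0x+24S\omega_0s\sigma$, - $N_{\mathcal A}=-2(1+\omega_0^2)+\omega_0^2\cosh2x+C(-1+\omega_0^2+(1+\omega_0^2)c)-(\omega_0^2-1)c+\cosh2\omega_0x-6\omega_0s\sigma$, - $N_W=1-3S+(S-3)S\omega_0^2+S\omega_0^2\cosh2x-(1+S(-2+S\omega_0^2))c+S\cosh2\omega_0x+C(-1-(S-2)S\omega_0^2+(1+S^2\omega_0^2)c)-6S\omega_0s\sigma$, - $N_G=(1+S)\omega_0-(1-S)\omega_0C+(1-S)\omega_0c-(1+S)\omega_0Cc-2\omega_0s^2-2S\omega_0\sigma^2+3(1+S\omega_0^2)s\sigma$.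 **Distillate.** Regard a function of $\kappa$ (at fixed $r,\theta,\beta_0,\omega_0$) as a function of the complex variable $z=\kappa^2$ in the plane cut along the negative real axis, $\mathrm{Re}\,\kappa>0$, minus the zeros of the denominators. Its analytic distillate $\mathrm{dist}_{\kappa^2=0}$ is defined when the domain is a union of parts cut out by sectors at $z=0$ in each of which the function has an asymptotic expansion in real powers of $z$ for $z\to0$; it is the sum, near $z=0$, of the power series made of the terms $a_nz^n$, $n=0,1,2,\dots$, whose coefficients are common to all these parts, and this series is required to have a positive radius of convergence. **Claim 1 (at rest).** The series for $\rho$ converges, $\mathrm{dist}_{\kappa^2=0}\,\rho=\frac{\pi^2}{30\beta_0^4}-\frac{\kappa^4}{480\pi^2}$, and for all components $$\mathrm{dist}_{\kappa^2=0}\langle T_{\mu\nu}\rangle=\Big[\frac{\pi^2}{90\beta_0^4}-\frac{\kappa^4}{1440\pi^2}\Big](-g_{\mu\nu}+4u_\mu u_\nu).$$ The integral term $\int_0^\infty\big(\frac{2+\cosh x}{\sinh^4(x/2)}-\frac{48}{x^4}\big)dx$ converges and vanishes. **Claim 2 (rotating, $0<|\omega_0|<1$).** The five series converge, and $$\mathrm{dist}\,\rho=\tfrac{\pi^2}{30(1-S\omega_0^2)^2\beta_0^4}+\tfrac{(1-S)\omega_0^2\kappa^2}{36(1-S\omega_0^2)^3\beta_0^2}-\tfrac{3S^2\omega_0^8-4S(5S-8)\omega_0^6+10(S^2-5S+1)\omega_0^4+4(8S-5)\omega_0^2+3}{1440\pi^2(1-S\omega_0^2)^4}\kappa^4,$$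 $$\mathrm{dist}\,p=\tfrac{\pi^2}{90(1-S\omega_0^2)^2\beta_0^4}+\tfrac{(1-S)\omega_0^2\kappa^2}{36(1-S\omega_0^2)^3\beta_0^2}-\tfrac{S^2\omega_0^8+4(16-5S)S\omega_0^6+10(1-11S+S^2)\omega_0^4+4(16S-5)\omega_0^2+1}{1440\pi^2(1-S\omega_0^2)^4}\kappa^4,$$ $$\mathrm{dist}\,\mathcal A=\tfrac{\kappa^2(1-S\omega_0^2)}{6\pi^2(1-S)\omega_0^4}\cdot\tfrac{\omega_0^2(1-\omega_0^2)^2}{4(1-S\omega_0^2)^3},$$ $$\mathrm{dist}\,W=\tfrac{\kappa^2(1-S\omega_0^2)}{6\pi^2(1-S)\omega_0^2}\Big[-\tfrac{\pi^2(1-S)\omega_0^2}{3(1-S\omega_0^2)^2\kappa^2\beta_0^2}-\tfrac{\omega_0^2(2S^2\omega_0^4-5S\omega_0^4-S^2\omega_0^2+8S\omega_0^2-\omega_0^2-5S+2)}{12(1-S\omega_0^2)^3}\Big],$$ $$\mathrm{dist}\,G=\tfrac{\kappa^2(1-S\omega_0^2)}{6\pi^2(1-S)\omega_0^3}\Big[\tfrac{\pi^2\omega_0(1-\omega_0^2)}{3(1-S\omega_0^2)^2\kappa^2\beta_0^2}+\tfrac{\omega_0(\omega_0^4-1)}{60(1-S\omega_0^2)^2}\Big].$$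 **Claim 3 (integral terms).** Put $$I_X=\int_0^\infty\big(\Phi_X(x)-\Pi_X(x)\big)dx$$ with $\Pi_\rho=\frac{36}{(1-S\omega_0^2)x^4}+\frac{2\omega_0^2(1-S)}{(1-S\omega_0^2)^2x^2}$, $\Pi_p=\frac{24}{(1-S\omega_0^2)x^4}+\frac{4\omega_0^2(1-S)}{(1-S\omega_0^2)^2x^2}$, $\Pi_{\mathcal A}=0$, $\Pi_W=-\frac{2(1-S)\omega_0^2}{(1-S\omega_0^2)^2x^2}$, $\Pi_G=\frac{2\omega_0(1-\omega_0^2)}{(1-S\omega_0^2)^2x^2}$. These integrals converge for complex $|S|<1$. In every sector $|\arg\kappa^2|<\pi-\delta$, $\delta>0$, as $\kappa\to0$, the difference $X-\mathrm{dist}\,X-J_X$ with $J_X=c_XI_X/(\kappa\beta_0)$ is $O(|\kappa^2|^N)$ for every $N$. The integral term $J_X$ is odd in $\kappa$, and $\mathrm{dist}_{\kappa^2=0}J_X=0$. **Claim 4.** In both cases the distillate of the stress-energy tensor is differentiable, traceless and covariantly conserved, $\nabla_\mu\,\mathrm{dist}\langle T^{\mu\nu}\rangle=0$, for every $\kappa>0$.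 For $\omega_0=0$ it is the tensor in Claim 1; for $\omega_0\ne0$ it is the decomposition above with the five scalar functions replaced by their distillates, at all points of the chart with $S<1$ (where the tetrad is non-degenerate). -/

import Mathlib

open Real Set Filter Topology MeasureTheory Asymptotics

namespace CEU

/-! ### Analytic distillation -/

/-- The open sector with vertex `z₀` of all `z ≠ z₀` with `a < arg (z - z₀) < b`. -/
def sector (z₀ : ℂ) (a b : ℝ) : Set ℂ :=
  {z | z ≠ z₀ ∧ a < Complex.arg (z - z₀) ∧ Complex.arg (z - z₀) < b}

/-- `f` has on `D`, for `z → z₀`, the transseries expansion `∑ α, c α (z - z₀) ^ α` over the group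
of transmonomials `(z - z₀) ^ α`, `α` real: below every order only finitely many exponents occur,
and the corresponding partial sum approximates `f` to that order. -/
def HasTransseries (D : Set ℂ) (z₀ : ℂ) (f : ℂ → ℂ) (c : ℝ → ℂ) : Prop :=
  ∀ N : ℕ, ∃ F : Finset ℝ, (∀ α : ℝ, α ∈ F ↔ c α ≠ 0 ∧ α < N) ∧
    (fun z => f z - ∑ α ∈ F, c α * (z - z₀) ^ (α : ℂ)) =O[𝓝[D] z₀] fun z => ‖z - z₀‖ ^ N

/-- `h` is the analytic distillate at `z₀` of the function `f` on the domain `D`: the domain is the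
union of its parts in a family `Λ` of sectors, `f` has a transseries expansion in each part, and near
`z₀` the function `h` is the sum of the convergent power series made of those coefficients of the
powers `(z - z₀) ^ n`, `n = 0, 1, 2, …`, which are common to all parts. -/
def IsDistillate (D : Set ℂ) (z₀ : ℂ) (f h : ℂ → ℂ) : Prop :=
  z₀ ∈ closure (D \ {z₀}) ∧
  ∃ (Λ : Set (ℝ × ℝ)) (c : ℝ × ℝ → ℝ → ℂ) (a : ℕ → ℂ),
    D \ {z₀} ⊆ ⋃ s ∈ Λ, sector z₀ s.1 s.2 ∧
    (∀ s ∈ Λ, z₀ ∈ closure (D ∩ sector z₀ s.1 s.2) ∧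
      HasTransseries (D ∩ sector z₀ s.1 s.2) z₀ f (c s)) ∧
    (∀ (n : ℕ) (v : ℂ), (∀ s ∈ Λ, c s n = v) → a n = v) ∧
    (∀ n : ℕ, (¬ ∃ v : ℂ, ∀ s ∈ Λ, c s n = v) → a n = 0) ∧
    ∃ ε > 0, ∀ z ∈ Metric.ball z₀ ε, HasSum (fun n : ℕ => a n * (z - z₀) ^ n) (h z)

/-! ### Tensor calculus in a coordinate chart -/

/-- Partial derivative along the `i`-th coordinate. -/
noncomputable def pd (i : Fin 4) (f : (Fin 4 → ℝ) → ℝ) (x : Fin 4 → ℝ) : ℝ :=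
  lineDeriv ℝ f x (Pi.single i 1)

/-- Christoffel symbols `Γ^l_{m n}` of the metric `g`. -/
noncomputable def christoffel (g : (Fin 4 → ℝ) → Matrix (Fin 4) (Fin 4) ℝ) (x : Fin 4 → ℝ)
    (l m n : Fin 4) : ℝ :=
  1 / 2 * ∑ s, (g x)⁻¹ l s *
    (pd m (fun y => g y s n) x + pd n (fun y => g y s m) x - pd s (fun y => g y m n) x)

/-- `∇_m V^n` for a vector field `V`. -/
noncomputable def covDeriv (g : (Fin 4 → ℝ) → Matrix (Fin 4) (Fin 4) ℝ)
    (V : (Fin 4 → ℝ) → Fin 4 → ℝ) (x : Fin 4 → ℝ) (m n : Fin 4) : ℝ :=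
  pd m (fun y => V y n) x + ∑ a, christoffel g x n m a * V x a

/-- `∇_m T^{m n}` for a contravariant tensor field `T` of rank two. -/
noncomputable def covDiv (g : (Fin 4 → ℝ) → Matrix (Fin 4) (Fin 4) ℝ)
    (T : (Fin 4 → ℝ) → Fin 4 → Fin 4 → ℝ) (x : Fin 4 → ℝ) (n : Fin 4) : ℝ :=
  ∑ m, (pd m (fun y => T y m n) x +
    ∑ a, (christoffel g x m m a * T x a n + christoffel g x n m a * T x m a))

/-- The trace `g_{m n} T^{m n}`. -/
noncomputable def tensorTrace (g : (Fin 4 → ℝ) → Matrix (Fin 4) (Fin 4) ℝ)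
    (T : (Fin 4 → ℝ) → Fin 4 → Fin 4 → ℝ) (x : Fin 4 → ℝ) : ℝ :=
  ∑ m, ∑ n, g x m n * T x m n

/-- The Levi-Civita symbol: the determinant of the 0-1 matrix whose `i`-th row marks the `i`-th
index. -/
def leviCivita (m n r s : Fin 4) : ℝ :=
  (Matrix.det (Matrix.of fun i j : Fin 4 => if ![m, n, r, s] i = j then (1 : ℤ) else 0) : ℤ)

/-- `E_{m n r s} = √(-det g) ε_{m n r s}`. -/
noncomputable def volTensor (g : (Fin 4 → ℝ) → Matrix (Fin 4) (Fin 4) ℝ) (x : Fin 4 → ℝ)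
    (m n r s : Fin 4) : ℝ :=
  √(-(g x).det) * leviCivita m n r s

/-- The four-velocity `u = β / √(β²)` of a four-temperature field `β`. -/
noncomputable def velocity (g : (Fin 4 → ℝ) → Matrix (Fin 4) (Fin 4) ℝ)
    (β : (Fin 4 → ℝ) → Fin 4 → ℝ) (x : Fin 4 → ℝ) (m : Fin 4) : ℝ :=
  β x m / √(∑ a, ∑ b, g x a b * β x a * β x b)

/-- The acceleration `A^m = u^n ∇_n u^m`. -/
noncomputable def acceleration (g : (Fin 4 → ℝ) → Matrix (Fin 4) (Fin 4) ℝ)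
    (β : (Fin 4 → ℝ) → Fin 4 → ℝ) (x : Fin 4 → ℝ) (m : Fin 4) : ℝ :=
  ∑ n, velocity g β x n * covDeriv g (velocity g β) x n m

/-- The vorticity `ω^m = (1/2) g^{m a} E_{a n r s} u^n ∇^r u^s`. -/
noncomputable def vorticity (g : (Fin 4 → ℝ) → Matrix (Fin 4) (Fin 4) ℝ)
    (β : (Fin 4 → ℝ) → Fin 4 → ℝ) (x : Fin 4 → ℝ) (m : Fin 4) : ℝ :=
  ∑ a, (g x)⁻¹ m a * (1 / 2 * ∑ n, ∑ r, ∑ s, volTensor g x a n r s * velocity g β x n *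
    ∑ b, (g x)⁻¹ r b * covDeriv g (velocity g β) x b s)

/-- The fourth vector of the tetrad, `l^m = g^{m a} E_{a n r s} u^n A^r ω^s`. -/
noncomputable def lVector (g : (Fin 4 → ℝ) → Matrix (Fin 4) (Fin 4) ℝ)
    (β : (Fin 4 → ℝ) → Fin 4 → ℝ) (x : Fin 4 → ℝ) (m : Fin 4) : ℝ :=
  ∑ a, (g x)⁻¹ m a * ∑ n, ∑ r, ∑ s, volTensor g x a n r s * velocity g β x n *
    acceleration g β x r * vorticity g β x s

/-! ### The Closed Einstein Universe, coordinates `(t, r, θ, φ)` -/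

/-- Diagonal entries of the metric, with `q = κ²` and `s = sin θ`. -/
def metricDiag {K : Type*} [Field K] (q r s : K) : Fin 4 → K :=
  ![1, -1 / (1 + q * r ^ 2 / 4) ^ 2, -r ^ 2 / (1 + q * r ^ 2 / 4) ^ 2,
    -(r ^ 2 * s ^ 2) / (1 + q * r ^ 2 / 4) ^ 2]

/-- The quantity `S = κ² r² sin² θ / (1 + κ² r² / 4)²`, with `q = κ²` and `s = sin θ`. -/
def paramS {K : Type*} [Field K] (q r s : K) : K :=
  q * r ^ 2 / (1 + q * r ^ 2 / 4) ^ 2 * s ^ 2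

/-- The coordinate chart. -/
def chart : Set (Fin 4 → ℝ) := {x | 0 < x 1 ∧ 0 < x 2 ∧ x 2 < π}

/-- The metric. -/
noncomputable def metric (κ : ℝ) (x : Fin 4 → ℝ) : Matrix (Fin 4) (Fin 4) ℝ :=
  Matrix.diagonal (metricDiag (κ ^ 2) (x 1) (sin (x 2)))

/-- The Killing four-temperature `β = β₀ (∂_t + κ ω₀ ∂_φ)`. -/
def fourTemperature (κ ω₀ β₀ : ℝ) (_x : Fin 4 → ℝ) : Fin 4 → ℝ :=
  ![β₀, 0, 0, β₀ * (κ * ω₀)]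

/-! ### Equilibrium at rest -/

/-- The energy density of the vacuum-subtracted thermal state at rest, for complex `κ`. -/
noncomputable def restDensity (β₀ : ℝ) (κ : ℂ) : ℂ :=
  κ ^ 4 / (16 * π ^ 2) * ∑' n : ℕ,
    (2 + Complex.cosh ((n + 1) * κ * β₀)) / Complex.sinh ((n + 1) * κ * β₀ / 2) ^ 4

/-- The covariant components `g_{μν}` at the point with coordinates `r, θ`, for complex `q = κ²`. -/
noncomputable def complexMetric (q : ℂ) (r θ : ℝ) (μ ν : Fin 4) : ℂ :=
  Matrix.diagonal (metricDiag q (r : ℂ) (sin θ : ℂ)) μ ν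

/-- The covariant components `u_μ = (1, 0, 0, 0)` of the four-velocity at rest. -/
def restVelocity : Fin 4 → ℂ := ![1, 0, 0, 0]

/-- `⟨T_{μν}⟩ = ρ u_μ u_ν - (ρ / 3) Δ_{μν}` at rest, with `Δ = g - u u`, for complex `κ`. -/
noncomputable def restStress (β₀ r θ : ℝ) (κ : ℂ) (μ ν : Fin 4) : ℂ :=
  restDensity β₀ κ * restVelocity μ * restVelocity ν -
    restDensity β₀ κ / 3 * (complexMetric (κ ^ 2) r θ μ ν - restVelocity μ * restVelocity ν)

/-- The integral term of the expansion of the series of `restDensity` has this integrand. -/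
noncomputable def restIntegrand (x : ℝ) : ℝ :=
  (2 + cosh x) / sinh (x / 2) ^ 4 - 48 / x ^ 4

/-- Contravariant components of `[π² / (90 β₀⁴) - κ⁴ / (1440 π²)] (-g + 4 u u)`. -/
noncomputable def restDistStress (κ β₀ : ℝ) (x : Fin 4 → ℝ) (μ ν : Fin 4) : ℝ :=
  (π ^ 2 / (90 * β₀ ^ 4) - κ ^ 4 / (1440 * π ^ 2)) *
    (-(metric κ x)⁻¹ μ ν + 4 * velocity (metric κ) (fourTemperature κ 0 β₀) x μ *
      velocity (metric κ) (fourTemperature κ 0 β₀) x ν)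

/-! ### Rotating equilibrium -/

/-- The five scalar thermodynamic functions of the rotating equilibrium. -/
inductive Coeff : Type
  | rho | p | A | W | G

/-- `1 - S - cosh x + S cosh (ω x)`. -/
noncomputable def den (S ω x : ℂ) : ℂ :=
  1 - S - Complex.cosh x + S * Complex.cosh (ω * x)

open Complex in
/-- The functions `R, P, F_A, F_W, F_q` of `x = n κ β₀` in the numerators of the series. -/
noncomputable def num (S ω x : ℂ) : Coeff → ℂ
  | .rho => 2 * (1 + S ^ 2 * ω ^ 2) + (-2 + S + S ^ 2 * ω ^ 2) * cosh x
      + (1 + S * ω ^ 2 - 2 * S ^ 2 * ω ^ 2) * cosh (ω * x)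
      - (1 + S + S * ω ^ 2 + S ^ 2 * ω ^ 2) * cosh x * cosh (ω * x)
      - (3 + S * ω ^ 2) * sinh x ^ 2 - S * (1 + 3 * S * ω ^ 2) * sinh (ω * x) ^ 2
      + 12 * S * ω * sinh x * sinh (ω * x)
  | .p => 1 + 7 * S + S * (7 + S) * ω ^ 2 - (1 + 3 * S * ω ^ 2) * cosh (2 * x)
      + 2 * (1 + S * (-2 + ω ^ 2)) * cosh (ω * x)
      - 2 * cosh x * (S * (-1 - (-2 + S) * ω ^ 2) + (1 + S) * (1 + S * ω ^ 2) * cosh (ω * x))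
      - S * (3 + S * ω ^ 2) * cosh (2 * (ω * x)) + 24 * S * ω * sinh x * sinh (ω * x)
  | .A => -2 * (1 + ω ^ 2) + ω ^ 2 * cosh (2 * x)
      + cosh x * (-1 + ω ^ 2 + (1 + ω ^ 2) * cosh (ω * x))
      - (-1 + ω ^ 2) * cosh (ω * x) + cosh (2 * (ω * x)) - 6 * ω * sinh x * sinh (ω * x)
  | .W => 1 - 3 * S + (-3 + S) * S * ω ^ 2 + S * ω ^ 2 * cosh (2 * x)
      - (1 + S * (-2 + S * ω ^ 2)) * cosh (ω * x) + S * cosh (2 * (ω * x))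
      + cosh x * (-1 - (-2 + S) * S * ω ^ 2 + (1 + S ^ 2 * ω ^ 2) * cosh (ω * x))
      - 6 * S * ω * sinh x * sinh (ω * x)
  | .G => (1 + S) * ω - (1 - S) * ω * cosh x + (1 - S) * ω * cosh (ω * x)
      - (1 + S) * ω * cosh x * cosh (ω * x) - 2 * ω * sinh x ^ 2 - 2 * S * ω * sinh (ω * x) ^ 2
      + 3 * (1 + S * ω ^ 2) * sinh x * sinh (ω * x)

/-- The factors in front of the series. -/
noncomputable def pref (S ω κ : ℂ) : Coeff → ℂ
  | .rho => κ ^ 4 / (12 * π ^ 2 * (1 - S * ω ^ 2))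
  | .p => κ ^ 4 / (24 * π ^ 2 * (1 - S * ω ^ 2))
  | .A => κ ^ 2 * (1 - S * ω ^ 2) / (6 * π ^ 2 * (1 - S) * ω ^ 4)
  | .W => κ ^ 2 * (1 - S * ω ^ 2) / (6 * π ^ 2 * (1 - S) * ω ^ 2)
  | .G => κ ^ 2 * (1 - S * ω ^ 2) / (6 * π ^ 2 * (1 - S) * ω ^ 3)

/-- The singular part at `x = 0` of `num / den ^ 3`. -/
noncomputable def polePart (S ω x : ℂ) : Coeff → ℂ
  | .rho => 36 / ((1 - S * ω ^ 2) * x ^ 4) + 2 * ω ^ 2 * (1 - S) / ((1 - S * ω ^ 2) ^ 2 * x ^ 2)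
  | .p => 24 / ((1 - S * ω ^ 2) * x ^ 4) + 4 * ω ^ 2 * (1 - S) / ((1 - S * ω ^ 2) ^ 2 * x ^ 2)
  | .A => 0
  | .W => -(2 * (1 - S) * ω ^ 2 / ((1 - S * ω ^ 2) ^ 2 * x ^ 2))
  | .G => 2 * ω * (1 - ω ^ 2) / ((1 - S * ω ^ 2) ^ 2 * x ^ 2)

/-- The term number `n + 1` of the series of `X`. -/
noncomputable def seriesTerm (X : Coeff) (ω₀ β₀ r θ : ℝ) (κ : ℂ) (n : ℕ) : ℂ :=
  num (paramS (κ ^ 2) r (sin θ)) ω₀ ((n + 1) * (κ * β₀)) X /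
    den (paramS (κ ^ 2) r (sin θ)) ω₀ ((n + 1) * (κ * β₀)) ^ 3

/-- The scalar thermodynamic function `X` at the point with coordinates `r, θ`, for complex `κ`. -/
noncomputable def scalarFun (X : Coeff) (ω₀ β₀ r θ : ℝ) (κ : ℂ) : ℂ :=
  pref (paramS (κ ^ 2) r (sin θ)) ω₀ κ X * ∑' n : ℕ, seriesTerm X ω₀ β₀ r θ κ n

/-- The integrand of the integral term `I_X`. -/
noncomputable def integrand (X : Coeff) (S ω : ℂ) (x : ℝ) : ℂ :=
  num S ω x X / den S ω x ^ 3 - polePart S ω x X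

/-- The contribution to the expansion of `scalarFun` of the integral term `I_X / (κ β₀)` of the
expansion of the series. -/
noncomputable def integralTerm (X : Coeff) (ω₀ β₀ r θ : ℝ) (κ : ℂ) : ℂ :=
  pref (paramS (κ ^ 2) r (sin θ)) ω₀ κ X *
    ((∫ x in Ioi (0 : ℝ), integrand X (paramS (κ ^ 2) r (sin θ)) ω₀ x) / (κ * β₀))

/-- The values of `z = κ²` in the complex plane cut along the negative real axis for which all
the denominators in the scalar thermodynamic functions are different from zero. -/
def domain (ω₀ β₀ r θ : ℝ) : Set ℂ :=
  {z | z ∈ Complex.slitPlane ∧ 1 - paramS z (r : ℂ) (sin θ : ℂ) ≠ 0 ∧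
    1 - paramS z (r : ℂ) (sin θ : ℂ) * (ω₀ : ℂ) ^ 2 ≠ 0 ∧
    ∀ n : ℕ, den (paramS z (r : ℂ) (sin θ : ℂ)) ω₀ ((n + 1) * (z ^ (1 / 2 : ℂ) * β₀)) ≠ 0}

/-- The distilled scalar thermodynamic functions as functions of `S, ω = ω₀, q = κ², b = β₀`;
the argument `c` is the number `π` in the field `K`. -/
def distCoeff {K : Type*} [Field K] (c S ω q b : K) : Coeff → K
  | .rho => c ^ 2 / (30 * (1 - S * ω ^ 2) ^ 2 * b ^ 4)
      + (1 - S) * ω ^ 2 * q / (36 * (1 - S * ω ^ 2) ^ 3 * b ^ 2)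
      - (3 * S ^ 2 * ω ^ 8 - 4 * S * (5 * S - 8) * ω ^ 6 + 10 * (S ^ 2 - 5 * S + 1) * ω ^ 4
          + 4 * (8 * S - 5) * ω ^ 2 + 3) / (1440 * c ^ 2 * (1 - S * ω ^ 2) ^ 4) * q ^ 2
  | .p => c ^ 2 / (90 * (1 - S * ω ^ 2) ^ 2 * b ^ 4)
      + (1 - S) * ω ^ 2 * q / (36 * (1 - S * ω ^ 2) ^ 3 * b ^ 2)
      - (S ^ 2 * ω ^ 8 + 4 * (16 - 5 * S) * S * ω ^ 6 + 10 * (1 - 11 * S + S ^ 2) * ω ^ 4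
          + 4 * (-5 + 16 * S) * ω ^ 2 + 1) / (1440 * c ^ 2 * (1 - S * ω ^ 2) ^ 4) * q ^ 2
  | .A => (1 - S * ω ^ 2) / (6 * c ^ 2 * (1 - S) * ω ^ 4) *
      (ω ^ 2 * (1 - ω ^ 2) ^ 2 / (4 * (1 - S * ω ^ 2) ^ 3) * q)
  | .W => (1 - S * ω ^ 2) / (6 * c ^ 2 * (1 - S) * ω ^ 2) *
      (-(c ^ 2 * (1 - S) * ω ^ 2 / (3 * (1 - S * ω ^ 2) ^ 2 * b ^ 2))
        - ω ^ 2 * (2 * S ^ 2 * ω ^ 4 - 5 * S * ω ^ 4 - S ^ 2 * ω ^ 2 + 8 * S * ω ^ 2 - ω ^ 2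
          - 5 * S + 2) / (12 * (1 - S * ω ^ 2) ^ 3) * q)
  | .G => (1 - S * ω ^ 2) / (6 * c ^ 2 * (1 - S) * ω ^ 3) *
      (c ^ 2 * ω * (1 - ω ^ 2) / (3 * (1 - S * ω ^ 2) ^ 2 * b ^ 2)
        + ω * (ω ^ 4 - 1) / (60 * (1 - S * ω ^ 2) ^ 2) * q)

/-- The distilled scalar thermodynamic function `X` at the point `x`, for real `κ`. -/
noncomputable def distScalar (X : Coeff) (κ ω₀ β₀ : ℝ) (x : Fin 4 → ℝ) : ℝ :=
  distCoeff π (paramS (κ ^ 2) (x 1) (sin (x 2))) ω₀ (κ ^ 2) β₀ X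

/-- The distillate `ρ u u - p Δ + W ω ω + 𝒜 A A + G (u l + l u)` of the stress-energy tensor, in
contravariant components, with the distilled scalar functions. -/
noncomputable def distStress (κ ω₀ β₀ : ℝ) (x : Fin 4 → ℝ) (μ ν : Fin 4) : ℝ :=
  let g := metric κ
  let β := fourTemperature κ ω₀ β₀
  let u := velocity g β x
  let A := acceleration g β x
  let ω := vorticity g β x
  let l := lVector g β x
  distScalar .rho κ ω₀ β₀ x * u μ * u ν
    - distScalar .p κ ω₀ β₀ x * ((g x)⁻¹ μ ν - u μ * u ν)
    + distScalar .W κ ω₀ β₀ x * ω μ * ω ν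
    + distScalar .A κ ω₀ β₀ x * A μ * A ν
    + distScalar .G κ ω₀ β₀ x * (u μ * l ν + u ν * l μ)

end CEU

/-! Put `h = κ β₀` and remove from `Φ_X` its polar part `a₄ / x⁴ + a₂ / x²`. The remainder `g_S` is
even and takes the value `a₀` at `0`. For small `S` it is holomorphic on the unit disc together with
a double cone of any prescribed aperture, and it is bounded there by `C / (1 + ‖x‖)²` with `C`
independent of `S` (`Numerator.exists_evenDecay`).

Poisson summation for `t ↦ g_S (t h)` turns the sum over all integers into the zero mode plus the
nonzero modes. Cauchy estimates on discs of radius proportional to `1 + ‖x‖` make the nonzero modes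
smaller than every power of `h`. The zero mode is `2 I / h`, because the integral may be rotated
from the ray through `h` to the positive axis. Evenness halves the sum: the series of `g_S` is `I /
h - a₀ / 2` up to arbitrarily high order (`exists_eulerMaclaurin_bound`). Restoring the polar part
adds `a₄ ζ(4) / h⁴ + a₂ ζ(2) / h²`. All bounds are uniform in `g`, hence in `S`; this is essential,
because `S` itself moves with `κ`.

With `z = κ²`, a sector `|arg z| < π - δ` corresponds to a cone for `h`. After multiplication by the
prefactor, the pole and constant terms form a function of `z` analytic at `0`, the claimed
distillate. The integral term is `√z` times another analytic function, since `I` depends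
analytically on `S`, so it contributes only half-integer powers. Thus the expansion is `A z + √z B
z` in every sector, and `A` is the distillate (`isDistillate_of_isBigO`). The values of `a₄`, `a₂`,
`a₀` come from even Taylor expansions, once the numerators are written as combinations of `cosh (λ
x) - 1`. The state at rest is the case `ω = 0`, where the integral vanishes by an explicit
primitive.

For conservation, the kinematic vectors are computed in closed form. Acceleration and vorticity span
the `r`-`θ` plane, and the vorticity is tangent to the level sets of `S`. The tensor is therefore
given by five functions of `S` (`stressForm`). Its trace condition is one algebraic relation, and
its conservation follows from the single equation `F = P + 2 S P' + S M`. Both are rational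
identities for the distilled coefficients (`energyFn_eq`, `azimuthalFn_eq`). -/

namespace CEU

/-! ### The Euler–Maclaurin expansion in a cone -/

/-- The double cone `|Im x| < b |Re x|` together with the open unit disc. -/
def doubleCone (b : ℝ) : Set ℂ := {x | |x.im| < b * |x.re|} ∪ Metric.ball 0 1

lemma isOpen_doubleCone (b : ℝ) : IsOpen (doubleCone b) := by
  refine IsOpen.union ?_ Metric.isOpen_ball
  exact isOpen_lt (by fun_prop) (by fun_prop)

lemma norm_le_of_abs_im_le {a : ℝ} {x : ℂ} (hx : |x.im| ≤ a * |x.re|) :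
    ‖x‖ ≤ (1 + a) * |x.re| := by
  linarith [Complex.norm_le_abs_re_add_abs_im x]

/-- The room between the cones of slopes `a` and `b` grows linearly with `‖x‖`, so discs of radius
proportional to `1 + ‖x‖` fit inside. Near the vertex, where the cones pinch, the unit disc provides
the room. -/
lemma exists_ball_subset_doubleCone {a b : ℝ} (ha : 0 ≤ a) (hab : a < b) :
    ∃ ε > 0, ∀ x : ℂ, |x.im| ≤ a * |x.re| → ∀ y : ℂ, ‖y - x‖ ≤ ε * (1 + ‖x‖) →
      y ∈ doubleCone b ∧ 1 + ‖x‖ ≤ 2 * (1 + ‖y‖) := by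
  have hb : 0 < b := ha.trans_lt hab
  -- For `‖x‖ ≥ 1/2` the radius is at most `3 ε (1 + a) |x.re|`. The condition `ε D < b - a` says
  -- that `|x.im|` plus this radius stays below `b` times `|x.re|` minus this radius.
  set D := 3 * (1 + a) * (1 + b) with hD
  have hDpos : 0 < D := by positivity
  refine ⟨min (1 / 4) ((b - a) / (2 * D)), lt_min (by norm_num) (by
    have : 0 < b - a := by linarith
    positivity), ?_⟩
  set ε := min (1 / 4) ((b - a) / (2 * D)) with hε
  have h1 : ε ≤ 1 / 4 := min_le_left _ _
  have h2 : ε * D < b - a := by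
    have h3 : ε ≤ (b - a) / (2 * D) := min_le_right _ _
    have h4 : ε * D ≤ (b - a) / (2 * D) * D := by gcongr
    have h5 : (b - a) / (2 * D) * D = (b - a) / 2 := by field_simp
    linarith
  have h0 : 0 < ε := lt_min (by norm_num) (by
    have : 0 < b - a := by linarith
    positivity)
  intro x hx y hy
  have hn := norm_nonneg x
  have hxy : ‖x‖ ≤ ‖y‖ + ‖y - x‖ := by
    have := norm_sub_norm_le x y
    rw [norm_sub_rev] at this; linarith
  have hyx : ‖y‖ ≤ ‖x‖ + ‖y - x‖ := by
    have := norm_sub_norm_le y x; linarith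
  have h6 : ε * (1 + ‖x‖) ≤ 1 / 4 * (1 + ‖x‖) := by gcongr
  refine ⟨?_, by linarith⟩
  by_cases hs : ‖x‖ < 1 / 2
  · right
    rw [mem_ball_zero_iff]
    linarith
  · left
    push Not at hs
    have h7 : ‖y - x‖ ≤ 3 * ε * ‖x‖ := by nlinarith
    have h8 : ‖x‖ ≤ (1 + a) * |x.re| := norm_le_of_abs_im_le hx
    have h9 : ‖y - x‖ ≤ 3 * ε * ((1 + a) * |x.re|) := h7.trans (by gcongr)
    have h10 : |y.im| ≤ |x.im| + ‖y - x‖ := by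
      have := Complex.abs_im_le_norm (y - x)
      rw [Complex.sub_im] at this
      have h' := abs_sub_abs_le_abs_sub y.im x.im
      linarith
    have h11 : |x.re| ≤ |y.re| + ‖y - x‖ := by
      have := Complex.abs_re_le_norm (y - x)
      rw [Complex.sub_re, abs_sub_comm] at this
      have h' := abs_sub_abs_le_abs_sub x.re y.re
      linarith
    have h12 : 0 < |x.re| := by
      by_contra h
      have h13 : |x.re| = 0 := le_antisymm (not_lt.1 h) (abs_nonneg _)
      rw [h13] at h8; linarith
    show |y.im| < b * |y.re|
    have h14 : b * (|x.re| - 3 * ε * ((1 + a) * |x.re|)) ≤ b * |y.re| := by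
      gcongr; linarith
    have h15 : ε * D * |x.re| < (b - a) * |x.re| := by gcongr
    rw [hD] at h15
    nlinarith

/-- The function `g` is even and holomorphic on `doubleCone b`, with `‖g x‖ ≤ C / (1 + ‖x‖) ^ 2`. -/
structure EvenDecay (b C : ℝ) (g : ℂ → ℂ) : Prop where
  diff : DifferentiableOn ℂ g (doubleCone b)
  even : ∀ x ∈ doubleCone b, g (-x) = g x
  bound : ∀ x ∈ doubleCone b, ‖g x‖ ≤ C / (1 + ‖x‖) ^ 2

/-- Cauchy's estimate on a circle of radius `ε (1 + ‖x‖)`: each derivative gains a factor `1 / (1 +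
‖x‖)`. The constant depends on `a`, `b`, `C`, `n` only, which is the source of all later uniformity
in `S`. -/
lemma exists_norm_iteratedDeriv_le {a b : ℝ} (ha : 0 ≤ a) (hab : a < b) (C : ℝ) (n : ℕ) :
    ∃ K : ℝ, 0 ≤ K ∧ ∀ g : ℂ → ℂ, EvenDecay b C g → ∀ x : ℂ, |x.im| ≤ a * |x.re| →
      ‖iteratedDeriv n g x‖ ≤ K / (1 + ‖x‖) ^ (n + 2) := by
  obtain ⟨ε, hε, H⟩ := exists_ball_subset_doubleCone ha hab
  refine ⟨n.factorial * (4 * |C|) / ε ^ n, by positivity, fun g hg x hx => ?_⟩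
  have hpos : 0 < 1 + ‖x‖ := by positivity
  have hd : DiffContOnCl ℂ g (Metric.ball x (ε * (1 + ‖x‖))) := by
    apply DifferentiableOn.diffContOnCl
    refine hg.diff.mono ?_
    intro y hy
    have := Metric.closure_ball_subset_closedBall hy
    rw [mem_closedBall_iff_norm] at this
    exact (H x hx y this).1
  have := Complex.norm_iteratedDeriv_le_of_forall_mem_sphere_norm_le n
    (R := ε * (1 + ‖x‖)) (C := 4 * |C| / (1 + ‖x‖) ^ 2) (by positivity) hd (by
      intro z hz
      obtain ⟨h1, h2⟩ := H x hx z (mem_sphere_iff_norm.1 hz).le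
      have h3 : 0 < 1 + ‖z‖ := by positivity
      calc ‖g z‖ ≤ C / (1 + ‖z‖) ^ 2 := hg.bound z h1
        _ ≤ |C| / (1 + ‖z‖) ^ 2 := by gcongr; exact le_abs_self C
        _ = 4 * |C| / (2 * (1 + ‖z‖)) ^ 2 := by field_simp; norm_num
        _ ≤ 4 * |C| / (1 + ‖x‖) ^ 2 := by gcongr)
  refine this.trans (le_of_eq ?_)
  rw [mul_pow, pow_add]
  field_simp

lemma ray_mem_cone {a : ℝ} (ha : 0 ≤ a) {h : ℂ} (hh : |h.im| ≤ a * h.re) (t : ℝ) :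
    |((t : ℂ) * h).im| ≤ a * |((t : ℂ) * h).re| := by
  simp only [Complex.re_ofReal_mul, Complex.im_ofReal_mul, abs_mul]
  nlinarith [mul_le_mul_of_nonneg_left hh (abs_nonneg t),
    mul_le_mul_of_nonneg_left (le_abs_self h.re) (mul_nonneg ha (abs_nonneg t))]

lemma cone_mem_doubleCone {a b : ℝ} (ha : 0 ≤ a) (hab : a < b) {x : ℂ}
    (hx : |x.im| ≤ a * |x.re|) : x ∈ doubleCone b := by
  obtain ⟨ε, hε, H⟩ := exists_ball_subset_doubleCone ha hab
  exact (H x hx x (by simp; positivity)).1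

/-! ### Restriction to rays, rotation of the integral, and Poisson summation. -/

section EulerMaclaurin

open scoped FourierTransform

lemma integrable_inv_one_add_abs_mul_sq {c : ℝ} (hc : 0 < c) :
    Integrable fun t : ℝ => 1 / (1 + |t| * c) ^ 2 := by
  have h1 : Integrable fun t : ℝ => (1 + ‖t‖) ^ (-(2 : ℝ)) :=
    integrable_one_add_norm (by simp)
  have h2 := h1.comp_mul_right' hc.ne'
  refine h2.congr (Eventually.of_forall fun t => ?_)
  simp only [Real.norm_eq_abs, abs_mul, abs_of_pos hc]
  rw [Real.rpow_neg (by positivity), one_div]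
  norm_cast

lemma integral_inv_one_add_abs_mul_sq {c : ℝ} (hc : 0 < c) :
    ∫ t : ℝ, 1 / (1 + |t| * c) ^ 2 = (∫ t : ℝ, 1 / (1 + |t|) ^ 2) / c := by
  have := Measure.integral_comp_mul_right (fun t : ℝ => 1 / (1 + |t|) ^ 2) c
  simp only [abs_mul, abs_of_pos hc] at this
  rw [this, abs_of_pos (by positivity), smul_eq_mul]
  field_simp

lemma norm_pos_of_re_pos {h : ℂ} (h0 : 0 < h.re) : 0 < ‖h‖ :=
  norm_pos_iff.2 fun h' => by simp [h'] at h0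

variable {a b C : ℝ} {g : ℂ → ℂ} {h : ℂ}

lemma EvenDecay.analyticAt (hg : EvenDecay b C g) {x : ℂ} (hx : x ∈ doubleCone b) :
    AnalyticAt ℂ g x :=
  hg.diff.analyticAt ((isOpen_doubleCone b).mem_nhds hx)

lemma EvenDecay.differentiableAt_iteratedDeriv (hg : EvenDecay b C g) {x : ℂ}
    (hx : x ∈ doubleCone b) (n : ℕ) : DifferentiableAt ℂ (iteratedDeriv n g) x :=
  by
  rw [iteratedDeriv_eq_iterate]
  exact (AnalyticAt.iterated_deriv (hg.analyticAt hx) n).differentiableAt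

lemma EvenDecay.ray_mem (ha : 0 ≤ a) (hab : a < b) (hh : |h.im| ≤ a * h.re) (t : ℝ) :
    (t : ℂ) * h ∈ doubleCone b :=
  cone_mem_doubleCone ha hab (ray_mem_cone ha hh t)

lemma EvenDecay.hasDerivAt_ray (hg : EvenDecay b C g) (ha : 0 ≤ a) (hab : a < b)
    (hh : |h.im| ≤ a * h.re) (n : ℕ) (t : ℝ) :
    HasDerivAt (fun t : ℝ => iteratedDeriv n g (t * h)) (h * iteratedDeriv (n + 1) g (t * h)) t := by
  have h1 : HasDerivAt (fun s : ℂ => s * h) h (t : ℂ) := by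
    simpa using (hasDerivAt_id (t : ℂ)).mul_const h
  have h2 := (hg.differentiableAt_iteratedDeriv (EvenDecay.ray_mem ha hab hh t) n).hasDerivAt
  have h3 := (h2.comp (t : ℂ) h1).comp_ofReal
  rw [iteratedDeriv_succ, mul_comm]
  exact h3

lemma EvenDecay.iteratedDeriv_ray (hg : EvenDecay b C g) (ha : 0 ≤ a) (hab : a < b)
    (hh : |h.im| ≤ a * h.re) (n : ℕ) :
    iteratedDeriv n (fun t : ℝ => g (t * h)) = fun t : ℝ => h ^ n * iteratedDeriv n g (t * h) := by
  induction n with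
  | zero => simp
  | succ n ih =>
    rw [iteratedDeriv_succ, ih]
    ext t
    rw [((hg.hasDerivAt_ray ha hab hh n t).const_mul (h ^ n)).deriv]
    ring

lemma EvenDecay.continuous_ray (hg : EvenDecay b C g) (ha : 0 ≤ a) (hab : a < b)
    (hh : |h.im| ≤ a * h.re) (n : ℕ) : Continuous fun t : ℝ => iteratedDeriv n g (t * h) :=
  continuous_iff_continuousAt.2 fun t => (hg.hasDerivAt_ray ha hab hh n t).continuousAt

lemma EvenDecay.contDiff_ray (hg : EvenDecay b C g) (ha : 0 ≤ a) (hab : a < b)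
    (hh : |h.im| ≤ a * h.re) (N : ℕ) : ContDiff ℝ N (fun t : ℝ => g (t * h)) := by
  rw [contDiff_nat_iff_iteratedDeriv]
  constructor
  · intro m _
    rw [hg.iteratedDeriv_ray ha hab hh]
    exact continuous_const.mul (hg.continuous_ray ha hab hh m)
  · intro m _
    rw [hg.iteratedDeriv_ray ha hab hh]
    exact fun t => ((hg.hasDerivAt_ray ha hab hh m t).const_mul _).differentiableAt

lemma norm_ofReal_mul' (t : ℝ) (h : ℂ) : ‖(t : ℂ) * h‖ = |t| * ‖h‖ := by simp

lemma exists_norm_iteratedDeriv_ray_le (ha : 0 ≤ a) (hab : a < b) (C : ℝ) (n : ℕ) :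
    ∃ K : ℝ, 0 ≤ K ∧ ∀ g : ℂ → ℂ, EvenDecay b C g → ∀ h : ℂ, |h.im| ≤ a * h.re → ∀ t : ℝ,
      ‖iteratedDeriv n g (t * h)‖ ≤ K * (1 / (1 + |t| * ‖h‖) ^ 2) := by
  obtain ⟨K, hK, H⟩ := exists_norm_iteratedDeriv_le ha hab C n
  refine ⟨K, hK, fun g hg h hh t => (H g hg _ (ray_mem_cone ha hh t)).trans ?_⟩
  rw [norm_ofReal_mul', mul_one_div]
  have : 0 ≤ |t| * ‖h‖ := by positivity
  gcongr
  · linarith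
  · omega

lemma EvenDecay.integrable_ray (hg : EvenDecay b C g) (ha : 0 ≤ a) (hab : a < b)
    (hh : |h.im| ≤ a * h.re) (h0 : 0 < h.re) (n : ℕ) :
    Integrable fun t : ℝ => iteratedDeriv n g (t * h) := by
  obtain ⟨K, hK, H⟩ := exists_norm_iteratedDeriv_ray_le ha hab C n
  refine ((integrable_inv_one_add_abs_mul_sq (norm_pos_of_re_pos h0)).const_mul K).mono'
    (hg.continuous_ray ha hab hh n).aestronglyMeasurable ?_
  exact Eventually.of_forall fun t => H g hg h hh t

/-- Integration by parts `n + 2` times. The derivatives along the ray give `‖h‖ ^ (n + 2)`, the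
integral over the ray costs `1 / ‖h‖`, and `|k| ^ (n + 2)` in the denominator is summable over the
nonzero integers. -/
lemma exists_norm_fourier_ray_le (ha : 0 ≤ a) (hab : a < b) (C : ℝ) (n : ℕ) :
    ∃ K : ℝ, 0 ≤ K ∧ ∀ g : ℂ → ℂ, EvenDecay b C g → ∀ h : ℂ, |h.im| ≤ a * h.re → 0 < h.re →
      ∀ k : ℤ, k ≠ 0 → ‖𝓕 (fun t : ℝ => g (t * h)) k‖ ≤ K * ‖h‖ ^ (n + 1) * (1 / |(k : ℝ)| ^ (n + 2)) := by
  obtain ⟨K, hK, H⟩ := exists_norm_iteratedDeriv_ray_le ha hab C (n + 2)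
  refine ⟨K * ∫ t : ℝ, 1 / (1 + |t|) ^ 2, mul_nonneg hK (integral_nonneg fun t => by positivity),
    fun g hg h hh h0 k hk => ?_⟩
  have hn := norm_pos_of_re_pos h0
  have h1 := Real.fourier_iteratedDeriv (n := n + 2) (N := (n + 2 : ℕ))
    (by exact_mod_cast hg.contDiff_ray ha hab hh (n + 2)) (by
      intro m _
      rw [hg.iteratedDeriv_ray ha hab hh]
      exact (hg.integrable_ray ha hab hh h0 m).const_mul _) le_rfl
  have h2 := congrFun h1 k
  have h3 : ‖𝓕 (iteratedDeriv (n + 2) fun t : ℝ => g (t * h)) k‖ ≤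
      K * (∫ t : ℝ, 1 / (1 + |t|) ^ 2) * ‖h‖ ^ (n + 1) := by
    refine (VectorFourier.norm_fourierIntegral_le_integral_norm _ _ _ _ _).trans ?_
    rw [hg.iteratedDeriv_ray ha hab hh]
    calc ∫ t : ℝ, ‖h ^ (n + 2) * iteratedDeriv (n + 2) g (t * h)‖
        ≤ ∫ t : ℝ, ‖h‖ ^ (n + 2) * (K * (1 / (1 + |t| * ‖h‖) ^ 2)) := by
          refine integral_mono_of_nonneg (Eventually.of_forall fun t => norm_nonneg _)
            (((integrable_inv_one_add_abs_mul_sq hn).const_mul K).const_mul _)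
            (Eventually.of_forall fun t => ?_)
          simp only [norm_mul, norm_pow]
          gcongr
          exact H g hg h hh t
      _ = K * (∫ t : ℝ, 1 / (1 + |t|) ^ 2) * ‖h‖ ^ (n + 1) := by
          rw [integral_const_mul, integral_const_mul, integral_inv_one_add_abs_mul_sq hn]
          field_simp
          ring
  rw [h2, norm_smul, norm_pow] at h3
  have hk' : (0 : ℝ) < |(k : ℝ)| := by positivity
  have hk1 : |(k : ℝ)| ≤ ‖(2 * π * Complex.I * ((k : ℝ) : ℂ) : ℂ)‖ := by
    simp only [norm_mul, Complex.norm_ofNat, Complex.norm_real, Complex.norm_I, mul_one,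
      Real.norm_eq_abs, abs_of_pos pi_pos]
    nlinarith [pi_gt_three]
  have h4 : |(k : ℝ)| ^ (n + 2) * ‖𝓕 (fun t : ℝ => g (t * h)) k‖ ≤
      K * (∫ t : ℝ, 1 / (1 + |t|) ^ 2) * ‖h‖ ^ (n + 1) := by
    refine le_trans ?_ h3
    gcongr
  rw [mul_one_div, le_div_iff₀ (by positivity)]
  linarith

lemma EvenDecay.integrable_ray_zero (hg : EvenDecay b C g) (ha : 0 ≤ a) (hab : a < b)
    (hh : |h.im| ≤ a * h.re) (h0 : 0 < h.re) : Integrable fun t : ℝ => g (t * h) := by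
  simpa using hg.integrable_ray ha hab hh h0 0

/-- The integrand is the derivative of `t g (t h)`, which vanishes at `0` and, by the quadratic
decay of `g`, at infinity. -/
lemma EvenDecay.integral_ray_derivative (hg : EvenDecay b C g) (ha : 0 ≤ a) (hab : a < b)
    (hh : |h.im| ≤ a * h.re) (h0 : 0 < h.re)
    (hint : IntegrableOn (fun t : ℝ => g (t * h) + t * (h * deriv g (t * h))) (Ioi 0)) :
    ∫ t in Ioi (0 : ℝ), (g (t * h) + t * (h * deriv g (t * h))) = 0 := by
  have hd : ∀ t : ℝ, HasDerivAt (fun t : ℝ => (t : ℂ) * g (t * h))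
      (g (t * h) + t * (h * deriv g (t * h))) t := by
    intro t
    have h1 := hg.hasDerivAt_ray ha hab hh 0 t
    simp only [iteratedDeriv_zero, zero_add, iteratedDeriv_one] at h1
    have h2 : HasDerivAt (fun t : ℝ => (t : ℂ)) 1 t := Complex.ofRealCLM.hasDerivAt
    simpa only [one_mul] using! h2.mul h1
  have hn := norm_pos_of_re_pos h0
  have hlim : Tendsto (fun t : ℝ => (t : ℂ) * g (t * h)) atTop (𝓝 0) := by
    apply squeeze_zero_norm' (a := fun t : ℝ => |C| / ‖h‖ ^ 2 * t⁻¹)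
    · filter_upwards [eventually_gt_atTop 0] with t ht
      have h1 := hg.bound _ (EvenDecay.ray_mem ha hab hh t)
      rw [norm_ofReal_mul', abs_of_pos ht] at h1
      rw [norm_mul, Complex.norm_real, Real.norm_eq_abs, abs_of_pos ht]
      calc t * ‖g (t * h)‖ ≤ t * (|C| / (t * ‖h‖) ^ 2) := by
            gcongr
            refine h1.trans ?_
            gcongr
            · exact le_abs_self C
            · linarith
        _ = |C| / ‖h‖ ^ 2 * t⁻¹ := by field_simp
    · simpa using tendsto_inv_atTop_zero.const_mul (|C| / ‖h‖ ^ 2)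
  simpa using integral_Ioi_of_hasDerivAt_of_tendsto' (fun t _ => hd t) hint hlim

/-- Infinitesimal form of contour rotation: differentiation under the integral sign produces the
total derivative of the preceding lemma. -/
lemma EvenDecay.hasDerivAt_integral_ray (hg : EvenDecay b C g) (ha : 0 ≤ a) (hab : a < b)
    (hh : |h.im| < a * h.re) (h0 : 0 < h.re) :
    HasDerivAt (fun w : ℂ => ∫ t in Ioi (0 : ℝ), w * g (t * w)) 0 h := by
  obtain ⟨K, hK, H⟩ := exists_norm_iteratedDeriv_le ha hab C 1
  have hn := norm_pos_of_re_pos h0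
  -- Keeping `‖w‖` above `‖h‖ / 2` makes the dominating function independent of `w`.
  set s : Set ℂ := {w | |w.im| < a * w.re} ∩ ({w | 0 < w.re} ∩ {w | ‖h‖ / 2 < ‖w‖}) with hs
  have hso : IsOpen s := by
    have h1 : IsOpen {w : ℂ | |w.im| < a * w.re} := isOpen_lt (by fun_prop) (by fun_prop)
    have h2 : IsOpen {w : ℂ | 0 < w.re} := isOpen_lt (by fun_prop) (by fun_prop)
    have h3 : IsOpen {w : ℂ | ‖h‖ / 2 < ‖w‖} := isOpen_lt (by fun_prop) (by fun_prop)
    exact h1.inter (h2.inter h3)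
  have hmem : s ∈ 𝓝 h := hso.mem_nhds ⟨hh, h0, half_lt_self hn⟩
  have hderiv : ∀ w ∈ s, ∀ t : ℝ, HasDerivAt (fun w : ℂ => w * g (t * w))
      (g (t * w) + t * (w * deriv g (t * w))) w := by
    intro w hw t
    have h1 : HasDerivAt (fun w : ℂ => (t : ℂ) * w) t w := by
      simpa using (hasDerivAt_id w).const_mul (t : ℂ)
    have h2 := ((hg.analyticAt (EvenDecay.ray_mem ha hab hw.1.le t)).differentiableAt).hasDerivAt
    have h3 := (hasDerivAt_id w).mul (h2.comp w h1)
    refine HasDerivAt.congr_deriv (f := fun w : ℂ => w * g (t * w)) h3 ?_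
    show 1 * g (t * w) + w * (deriv g (t * w) * t) = _
    ring
  have hcont : ∀ w ∈ s, Continuous fun t : ℝ => g (t * w) + t * (w * deriv g (t * w)) := by
    intro w hw
    have h1 := hg.continuous_ray ha hab hw.1.le 0
    have h2 := hg.continuous_ray ha hab hw.1.le 1
    simp only [iteratedDeriv_zero, iteratedDeriv_one] at h1 h2
    exact h1.add (Complex.continuous_ofReal.mul (continuous_const.mul h2))
  have := hasDerivAt_integral_of_dominated_loc_of_deriv_le (μ := volume.restrict (Ioi (0 : ℝ)))
    (F := fun (w : ℂ) (t : ℝ) => w * g (t * w)) (x₀ := h)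
    (F' := fun (w : ℂ) (t : ℝ) => g (t * w) + t * (w * deriv g (t * w)))
    (bound := fun t => (|C| + K) * (1 / (1 + |t| * (‖h‖ / 2)) ^ 2)) hmem (by
      filter_upwards [hmem] with w hw
      have h1 := hg.continuous_ray ha hab hw.1.le 0
      simp only [iteratedDeriv_zero] at h1
      exact (continuous_const.mul h1).aestronglyMeasurable)
    ((hg.integrable_ray_zero ha hab hh.le h0).const_mul _).integrableOn
    (hcont h ⟨hh, h0, half_lt_self hn⟩).aestronglyMeasurable
    (Eventually.of_forall fun t w hw => by
      have h1 := hg.bound _ (EvenDecay.ray_mem ha hab hw.1.le t)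
      have h2 := H g hg _ (ray_mem_cone ha hw.1.le t)
      rw [iteratedDeriv_one] at h2
      rw [norm_ofReal_mul'] at h1 h2
      have hw2 : ‖h‖ / 2 < ‖w‖ := hw.2.2
      have hpos : 0 ≤ |t| * ‖w‖ := by positivity
      have h3 : ‖(t : ℂ) * (w * deriv g (t * w))‖ ≤ K / (1 + |t| * ‖w‖) ^ 2 := by
        rw [← mul_assoc, norm_mul, norm_ofReal_mul']
        calc |t| * ‖w‖ * ‖deriv g (t * w)‖
            ≤ (1 + |t| * ‖w‖) * (K / (1 + |t| * ‖w‖) ^ (1 + 2)) := by gcongr; linarith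
          _ = K / (1 + |t| * ‖w‖) ^ 2 := by field_simp; ring
      have h4 : 1 / (1 + |t| * ‖w‖) ^ 2 ≤ 1 / (1 + |t| * (‖h‖ / 2)) ^ 2 := by gcongr
      calc ‖g (t * w) + t * (w * deriv g (t * w))‖
          ≤ C / (1 + |t| * ‖w‖) ^ 2 + K / (1 + |t| * ‖w‖) ^ 2 :=
            (norm_add_le _ _).trans (add_le_add h1 h3)
        _ ≤ |C| / (1 + |t| * ‖w‖) ^ 2 + K / (1 + |t| * ‖w‖) ^ 2 := by
            gcongr; exact le_abs_self C
        _ = (|C| + K) * (1 / (1 + |t| * ‖w‖) ^ 2) := by ring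
        _ ≤ _ := by gcongr)
    (((integrable_inv_one_add_abs_mul_sq (by positivity)).const_mul _).integrableOn)
    (Eventually.of_forall fun t w hw => hderiv w hw t)
  have h5 := hg.integral_ray_derivative ha hab hh.le h0 this.1
  rw [h5] at this
  exact this.2

/-- The function `w ↦ ∫ w g (t w) dt` has zero derivative on a convex open cone containing both `h`
and `1`, so its two values agree. An intermediate slope `a'` makes the cone open while the bound on
`h` is not strict. -/
lemma EvenDecay.integral_ray (hg : EvenDecay b C g) (ha : 0 ≤ a) (hab : a < b)
    (hh : |h.im| ≤ a * h.re) (h0 : 0 < h.re) :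
    ∫ t in Ioi (0 : ℝ), g (t * h) = (∫ t in Ioi (0 : ℝ), g t) / h := by
  obtain ⟨a', haa', ha'b⟩ := exists_between hab
  have ha' : 0 < a' := ha.trans_lt haa'
  set V : Set ℂ := {w | |w.im| < a' * w.re} ∩ {w | 0 < w.re} with hV
  have hVo : IsOpen V := by
    have h1 : IsOpen {w : ℂ | |w.im| < a' * w.re} := isOpen_lt (by fun_prop) (by fun_prop)
    have h2 : IsOpen {w : ℂ | 0 < w.re} := isOpen_lt (by fun_prop) (by fun_prop)
    exact h1.inter h2
  have hVc : Convex ℝ V := by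
    intro x hx y hy p q hp hq hpq
    simp only [hV, mem_inter_iff, mem_ofPred_eq, Complex.add_im, Complex.add_re, Complex.smul_re, Complex.smul_im,
      smul_eq_mul, abs_lt] at hx hy ⊢
    obtain ⟨⟨hx1, hx2⟩, hx3⟩ := hx
    obtain ⟨⟨hy1, hy2⟩, hy3⟩ := hy
    rcases hp.eq_or_lt with rfl | hp'
    · have : q = 1 := by linarith
      subst this
      simpa using ⟨⟨hy1, hy2⟩, hy3⟩
    · refine ⟨⟨?_, ?_⟩, ?_⟩ <;> nlinarith
  have hd : ∀ w ∈ V, HasDerivAt (fun w : ℂ => ∫ t in Ioi (0 : ℝ), w * g (t * w)) 0 w :=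
    fun w hw => hg.hasDerivAt_integral_ray ha'.le ha'b hw.1 hw.2
  have hc := hVo.is_const_of_deriv_eq_zero hVc.isPreconnected
    (fun w hw => (hd w hw).differentiableAt.differentiableWithinAt) (fun w hw => (hd w hw).deriv)
    (x := h) (y := 1) ⟨hh.trans_lt (by gcongr), h0⟩ (by simp [hV, ha'])
  simp only [one_mul, mul_one, integral_const_mul] at hc
  rw [← hc, mul_div_cancel_left₀]
  rintro rfl; simp at h0

lemma EvenDecay.integral_line (hg : EvenDecay b C g) (ha : 0 ≤ a) (hab : a < b)
    (hh : |h.im| ≤ a * h.re) (h0 : 0 < h.re) :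
    ∫ t : ℝ, g (t * h) = 2 * ((∫ t in Ioi (0 : ℝ), g t) / h) := by
  have hi := hg.integrable_ray_zero ha hab hh h0
  rw [← hg.integral_ray ha hab hh h0, ← integral_add_compl (measurableSet_Ioi (a := 0)) hi,
    compl_Ioi, two_mul]
  congr 1
  have := integral_comp_neg_Ioi (0 : ℝ) (fun t : ℝ => g (t * h))
  rw [neg_zero] at this
  rw [← this]
  refine integral_congr_ae (Eventually.of_forall fun t => ?_)
  simp only [Complex.ofReal_neg, neg_mul]
  exact hg.even _ (EvenDecay.ray_mem ha hab hh t)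

/-- The zero Fourier mode is the integral over the whole line, which is twice the rotated half-line
integral. The remaining modes form the error. -/
lemma exists_poisson_bound (ha : 0 ≤ a) (hab : a < b) (C : ℝ) (n : ℕ) :
    ∃ K : ℝ, 0 ≤ K ∧ ∀ g : ℂ → ℂ, EvenDecay b C g → ∀ h : ℂ, |h.im| ≤ a * h.re → 0 < h.re →
      ‖∑' k : ℤ, g (k * h) - 2 * ((∫ t in Ioi (0 : ℝ), g t) / h)‖ ≤ K * ‖h‖ ^ (n + 1) := by
  obtain ⟨K, hK, H⟩ := exists_norm_fourier_ray_le ha hab C n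
  have hs : Summable fun k : ℤ => 1 / |(k : ℝ)| ^ (n + 2) := by
    have := (Real.summable_one_div_int_pow (p := n + 2)).2 (by omega)
    simpa [abs_div, abs_pow] using this.abs
  refine ⟨K * ∑' k : ℤ, 1 / |(k : ℝ)| ^ (n + 2), mul_nonneg hK (tsum_nonneg fun k => by positivity),
    fun g hg h hh h0 => ?_⟩
  have hn := norm_pos_of_re_pos h0
  set F : ℤ → ℂ := fun k => 𝓕 (fun t : ℝ => g (t * h)) k with hF
  have hb : ∀ k : ℤ, k ≠ 0 → ‖F k‖ ≤ K * ‖h‖ ^ (n + 1) * (1 / |(k : ℝ)| ^ (n + 2)) :=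
    fun k hk => H g hg h hh h0 k hk
  have hF0 : F 0 = 2 * ((∫ t in Ioi (0 : ℝ), g t) / h) := by
    rw [← hg.integral_line ha hab hh h0, hF]
    simp [Real.fourier_eq]
  have hs' : Summable fun k : ℤ => if k = 0 then 0 else F k := by
    refine Summable.of_norm_bounded (hs.mul_left (K * ‖h‖ ^ (n + 1))) fun k => ?_
    split_ifs with hk
    · simp; positivity
    · exact hb k hk
  have hFs : Summable F := by
    refine (hs'.add (hasSum_ite_eq (0 : ℤ) (F 0)).summable).congr fun k => ?_
    by_cases hk : k = 0 <;> simp [hk]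
  have hc := hg.continuous_ray ha hab hh 0
  simp only [iteratedDeriv_zero] at hc
  have hP := Real.tsum_eq_tsum_fourier_of_rpow_decay_of_summable hc (b := 2) (by norm_num) (by
    refine IsBigO.of_bound (|C| / ‖h‖ ^ 2) ?_
    have h1 : ∀ᶠ t : ℝ in cocompact ℝ, t ≠ 0 := by
      have : {(0 : ℝ)}ᶜ ∈ cocompact ℝ := isCompact_singleton.compl_mem_cocompact
      filter_upwards [this] with t ht using ht
    filter_upwards [h1] with t ht
    have h2 := hg.bound _ (EvenDecay.ray_mem ha hab hh t)
    rw [norm_ofReal_mul'] at h2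
    have ht' : 0 < |t| := abs_pos.2 ht
    rw [Real.norm_of_nonneg (Real.rpow_nonneg (abs_nonneg t) _), Real.rpow_neg (abs_nonneg t)]
    calc ‖g (t * h)‖ ≤ |C| / (|t| * ‖h‖) ^ 2 := by
          refine h2.trans ?_
          gcongr
          · exact le_abs_self C
          · linarith
      _ = |C| / ‖h‖ ^ 2 * (|t| ^ (2 : ℝ))⁻¹ := by
          rw [Real.rpow_two]; field_simp) hFs 0
  have hP' : ∑' k : ℤ, g (k * h) = ∑' k : ℤ, F k := by
    simpa using hP
  rw [hP', hFs.tsum_eq_add_tsum_ite 0, hF0, add_sub_cancel_left]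
  have h1 : ∀ k : ℤ, ‖if k = 0 then 0 else F k‖ ≤ K * ‖h‖ ^ (n + 1) * (1 / |(k : ℝ)| ^ (n + 2)) := by
    intro k
    split_ifs with hk
    · rw [norm_zero]; positivity
    · exact hb k hk
  calc _ ≤ ∑' k : ℤ, K * ‖h‖ ^ (n + 1) * (1 / |(k : ℝ)| ^ (n + 2)) :=
        tsum_of_norm_bounded (hs.mul_left _).hasSum h1
    _ = _ := by rw [tsum_mul_left]; ring

lemma EvenDecay.summable_int (hg : EvenDecay b C g) (ha : 0 ≤ a) (hab : a < b)
    (hh : |h.im| ≤ a * h.re) (h0 : 0 < h.re) : Summable fun k : ℤ => g (k * h) := by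
  have hn := norm_pos_of_re_pos h0
  have hs : Summable fun k : ℤ => |C| / ‖h‖ ^ 2 * (1 / (k : ℝ) ^ 2) :=
    ((Real.summable_one_div_int_pow (p := 2)).2 (by norm_num)).mul_left _
  refine Summable.of_norm_bounded_eventually hs ?_
  refine (Set.finite_singleton (0 : ℤ)).subset fun k hk => ?_
  by_contra hk0
  refine hk ?_
  have h2 := hg.bound _ (EvenDecay.ray_mem ha hab hh k)
  rw [norm_ofReal_mul'] at h2
  have hk' : (0 : ℝ) < |(k : ℝ)| := abs_pos.2 (by exact_mod_cast hk0)
  calc ‖g (k * h)‖ ≤ |C| / (|(k : ℝ)| * ‖h‖) ^ 2 := by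
        refine (by exact_mod_cast h2 : ‖g (k * h)‖ ≤ C / (1 + |(k : ℝ)| * ‖h‖) ^ 2).trans ?_
        gcongr
        · exact le_abs_self C
        · linarith
    _ = |C| / ‖h‖ ^ 2 * (1 / (k : ℝ) ^ 2) := by
        rw [mul_pow, sq_abs]; field_simp

/-- Euler–Maclaurin expansion of `∑ g (n h)` for even `g`: only the integral and the value at `0`
contribute, uniformly in `g` and in `h` in a cone. -/
theorem exists_eulerMaclaurin_bound (ha : 0 ≤ a) (hab : a < b) (C : ℝ) (n : ℕ) :
    ∃ K : ℝ, 0 ≤ K ∧ ∀ g : ℂ → ℂ, EvenDecay b C g → ∀ h : ℂ, |h.im| ≤ a * h.re → 0 < h.re →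
      (Summable fun k : ℕ => g ((k + 1) * h)) ∧
      ‖∑' k : ℕ, g ((k + 1) * h) + g 0 / 2 - (∫ t in Ioi (0 : ℝ), g t) / h‖ ≤ K * ‖h‖ ^ (n + 1) := by
  obtain ⟨K, hK, H⟩ := exists_poisson_bound ha hab C n
  refine ⟨K / 2, by positivity, fun g hg h hh h0 => ?_⟩
  have hs := hg.summable_int ha hab hh h0
  have hev : Function.Even fun k : ℤ => g (k * h) := fun k => by
    have := hg.even _ (EvenDecay.ray_mem ha hab hh k)
    push_cast at this ⊢
    rw [neg_mul]; exact this
  have h1 := tsum_int_eq_zero_add_two_mul_tsum_pnat hev hs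
  have h2 : ∑' k : ℕ+, g (((k : ℤ) : ℂ) * h) = ∑' k : ℕ, g ((k + 1) * h) := by
    rw [tsum_pnat_eq_tsum_succ (f := fun k : ℕ => g (((k : ℤ) : ℂ) * h))]
    push_cast; rfl
  rw [h2] at h1
  have h3 := H g hg h hh h0
  rw [h1] at h3
  refine ⟨?_, ?_⟩
  · have := hs.comp_injective (i := fun k : ℕ => ((k + 1 : ℕ) : ℤ))
      (fun x y hxy => by simpa using hxy)
    refine this.congr fun k => ?_
    simp
  · have h4 : ∑' k : ℕ, g ((k + 1) * h) + g 0 / 2 - (∫ t in Ioi (0 : ℝ), g t) / h =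
        (1 / 2) * (g (((0 : ℤ) : ℂ) * h) + 2 * ∑' k : ℕ, g ((k + 1) * h) -
          2 * ((∫ t in Ioi (0 : ℝ), g t) / h)) := by
      simp only [Int.cast_zero, zero_mul]; ring
    rw [h4, norm_mul]
    norm_num
    norm_num at h3
    linarith

end EulerMaclaurin

/-! ### Bounds for the denominator -/

lemma norm_sinh_le_exp (w : ℂ) : ‖Complex.sinh w‖ ≤ rexp |w.re| := by
  rw [Complex.sinh, norm_div, Complex.norm_ofNat]
  have h1 := norm_sub_le (Complex.exp w) (Complex.exp (-w))
  rw [Complex.norm_exp, Complex.norm_exp, Complex.neg_re] at h1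
  have h2 : rexp w.re ≤ rexp |w.re| := exp_le_exp.2 (le_abs_self _)
  have h3 : rexp (-w.re) ≤ rexp |w.re| := exp_le_exp.2 (neg_le_abs _)
  linarith

lemma norm_cosh_le_exp (w : ℂ) : ‖Complex.cosh w‖ ≤ rexp |w.re| := by
  rw [Complex.cosh, norm_div, Complex.norm_ofNat]
  have h1 := norm_add_le (Complex.exp w) (Complex.exp (-w))
  rw [Complex.norm_exp, Complex.norm_exp, Complex.neg_re] at h1
  have h2 : rexp w.re ≤ rexp |w.re| := exp_le_exp.2 (le_abs_self _)
  have h3 : rexp (-w.re) ≤ rexp |w.re| := exp_le_exp.2 (neg_le_abs _)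
  linarith

lemma le_norm_sinh (w : ℂ) : (rexp |w.re| - rexp (-|w.re|)) / 2 ≤ ‖Complex.sinh w‖ := by
  have key : ∀ w : ℂ, 0 ≤ w.re → (rexp w.re - rexp (-w.re)) / 2 ≤ ‖Complex.sinh w‖ := by
    intro w _
    rw [Complex.sinh, norm_div, Complex.norm_ofNat]
    have h1 := norm_sub_norm_le (Complex.exp w) (Complex.exp (-w))
    rw [Complex.norm_exp, Complex.norm_exp, Complex.neg_re] at h1
    linarith
  rcases le_total 0 w.re with h | h
  · rw [abs_of_nonneg h]; exact key w h
  · have := key (-w) (by simpa using h)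
    rw [abs_of_nonpos h]
    simpa [Complex.sinh_neg] using this

lemma norm_sinh_sub_le {w : ℂ} (hw : ‖w‖ ≤ 1) : ‖Complex.sinh w - w‖ ≤ ‖w‖ ^ 2 := by
  have h1 := Complex.norm_exp_sub_one_sub_id_le hw
  have h2 := Complex.norm_exp_sub_one_sub_id_le (x := -w) (by simpa using hw)
  rw [norm_neg] at h2
  have : Complex.sinh w - w =
      ((Complex.exp w - 1 - w) - (Complex.exp (-w) - 1 - -w)) / 2 := by
    rw [Complex.sinh]; ring
  rw [this, norm_div, Complex.norm_ofNat]
  have := norm_sub_le (Complex.exp w - 1 - w) (Complex.exp (-w) - 1 - -w)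
  linarith

lemma norm_sinh_le_two_mul {w : ℂ} (hw : ‖w‖ ≤ 1 / 2) : ‖Complex.sinh w‖ ≤ 2 * ‖w‖ := by
  have h1 := norm_sinh_sub_le (hw.trans (by norm_num))
  have h2 := norm_sub_norm_le (Complex.sinh w) w
  nlinarith [norm_nonneg w]

lemma le_norm_sinh_of_norm_le {w : ℂ} (hw : ‖w‖ ≤ 1 / 2) : ‖w‖ / 2 ≤ ‖Complex.sinh w‖ := by
  have h1 := norm_sinh_sub_le (hw.trans (by norm_num))
  have h2 := norm_sub_norm_le w (Complex.sinh w)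
  rw [norm_sub_rev] at h2
  nlinarith [norm_nonneg w]

lemma den_eq (S ω x : ℂ) :
    den S ω x = 2 * S * Complex.sinh (ω * x / 2) ^ 2 - 2 * Complex.sinh (x / 2) ^ 2 := by
  have h : ∀ y : ℂ, Complex.cosh y = 1 + 2 * Complex.sinh (y / 2) ^ 2 := fun y => by
    have h1 := Complex.cosh_two_mul (y / 2)
    rw [mul_div_cancel₀ _ two_ne_zero, Complex.cosh_sq] at h1
    rw [h1]; ring
  rw [den, h x, h (ω * x)]
  ring

lemma norm_den_ge (S ω x : ℂ) : 2 * ‖Complex.sinh (x / 2)‖ ^ 2 -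
    2 * ‖S‖ * ‖Complex.sinh (ω * x / 2)‖ ^ 2 ≤ ‖den S ω x‖ := by
  rw [den_eq, norm_sub_rev]
  refine le_trans (le_of_eq ?_) (norm_sub_norm_le _ _)
  simp

lemma abs_re_ofReal_mul_le {ω : ℝ} (hω : |ω| < 1) (x : ℂ) : |((ω : ℂ) * x).re| ≤ |x.re| := by
  rw [Complex.re_ofReal_mul, abs_mul]
  nlinarith [abs_nonneg x.re]

/-- The denominator does not degenerate on a double cone when `S` is small. -/
lemma exists_norm_den_ge {ω : ℝ} (hω : |ω| < 1) {b : ℝ} (hb : 0 < b) :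
    ∃ s > 0, s ≤ 1 / 2 ∧ ∃ c > 0, ∀ S : ℂ, ‖S‖ ≤ s → ∀ x : ℂ,
      (‖x‖ ≤ 1 → c * ‖x‖ ^ 2 ≤ ‖den S ω x‖) ∧
      (|x.im| < b * |x.re| → 1 ≤ ‖x‖ → c * rexp |x.re| ≤ ‖den S ω x‖) := by
  -- In the cone, `‖x‖ ≥ 1` forces `|x.re| ≥ 1 / (1 + b)`, so `‖sinh (x / 2)‖ ≥ d exp (|x.re| / 2)`.
  -- The limits `1/32` and `d² / 2` on `‖S‖` let the `S` term consume at most half of the lower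
  -- bound, inside and outside the unit disc respectively.
  set d : ℝ := (1 - rexp (-(1 / (1 + b)))) / 2 with hd
  have hd0 : 0 < d := by
    have : rexp (-(1 / (1 + b))) < 1 := Real.exp_lt_one_iff.2 (by
      have : 0 < 1 / (1 + b) := by positivity
      linarith)
    linarith
  refine ⟨min (1 / 32) (d ^ 2 / 2), by positivity, (min_le_left _ _).trans (by norm_num),
    min (1 / 16) (d ^ 2), by positivity, fun S hS x => ⟨fun hx => ?_, fun hx h1 => ?_⟩⟩
  · have h1 : ‖x / 2‖ ≤ 1 / 2 := by rw [norm_div, Complex.norm_ofNat]; linarith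
    have h2 : ‖(ω : ℂ) * x / 2‖ ≤ ‖x‖ / 2 := by
      rw [norm_div, norm_mul, Complex.norm_ofNat, Complex.norm_real, Real.norm_eq_abs]
      nlinarith [norm_nonneg x]
    have h3 := le_norm_sinh_of_norm_le h1
    have h4 := norm_sinh_le_two_mul (h2.trans (by linarith))
    have h5 : ‖Complex.sinh ((ω : ℂ) * x / 2)‖ ≤ ‖x‖ := by linarith
    rw [norm_div, Complex.norm_ofNat] at h3
    have h6 : ‖S‖ ≤ 1 / 32 := hS.trans (min_le_left _ _)
    refine le_trans ?_ (norm_den_ge S ω x)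
    have h7 : ‖S‖ * ‖Complex.sinh ((ω : ℂ) * x / 2)‖ ^ 2 ≤ 1 / 32 * ‖x‖ ^ 2 := by gcongr
    have h8 : (‖x‖ / 2 / 2) ^ 2 ≤ ‖Complex.sinh (x / 2)‖ ^ 2 := by gcongr
    have h9 : min (1 / 16) (d ^ 2) * ‖x‖ ^ 2 ≤ 1 / 16 * ‖x‖ ^ 2 := by
      gcongr; exact min_le_left _ _
    nlinarith
  · have h2 : 1 / (1 + b) ≤ |x.re| := by
      rw [div_le_iff₀ (by positivity)]
      linarith [norm_le_of_abs_im_le hx.le]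
    have h3 := le_norm_sinh (x / 2)
    have h4 := norm_sinh_le_exp ((ω : ℂ) * x / 2)
    have h5 : |(x / 2).re| = |x.re| / 2 := by simp [abs_div]
    have h6 : |((ω : ℂ) * x / 2).re| ≤ |x.re| / 2 := by
      have := abs_re_ofReal_mul_le hω x
      have h' : |((ω : ℂ) * x / 2).re| = |((ω : ℂ) * x).re| / 2 := by
        rw [Complex.div_ofNat_re, abs_div]; norm_num
      rw [h']; linarith
    rw [h5] at h3
    have h7 : ‖Complex.sinh ((ω : ℂ) * x / 2)‖ ≤ rexp (|x.re| / 2) :=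
      h4.trans (exp_le_exp.2 h6)
    have h8 : d * rexp (|x.re| / 2) ≤ ‖Complex.sinh (x / 2)‖ := by
      refine le_trans ?_ h3
      have : rexp (-(|x.re| / 2)) ≤ rexp (-(1 / (1 + b))) * rexp (|x.re| / 2) := by
        rw [← exp_add]; exact exp_le_exp.2 (by linarith)
      rw [hd]; linarith
    have h9 : rexp (|x.re| / 2) ^ 2 = rexp |x.re| := by rw [← exp_nat_mul]; congr 1; push_cast; ring
    refine le_trans ?_ (norm_den_ge S ω x)
    have h10 : (d * rexp (|x.re| / 2)) ^ 2 ≤ ‖Complex.sinh (x / 2)‖ ^ 2 := by gcongr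
    have h11 : ‖S‖ * ‖Complex.sinh ((ω : ℂ) * x / 2)‖ ^ 2 ≤ d ^ 2 / 2 * rexp (|x.re| / 2) ^ 2 := by
      gcongr
      exact hS.trans (min_le_right _ _)
    have h12 : min (1 / 16) (d ^ 2) * rexp |x.re| ≤ d ^ 2 * rexp |x.re| := by
      gcongr; exact min_le_right _ _
    rw [mul_pow, h9] at h10
    rw [h9] at h11
    linarith

lemma differentiable_den (S ω : ℂ) : Differentiable ℂ (den S ω) := by
  unfold den
  fun_prop

lemma den_neg (S ω x : ℂ) : den S ω (-x) = den S ω x := by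
  simp [den]

lemma tendsto_sinh_div (c : ℂ) :
    Tendsto (fun x : ℂ => Complex.sinh (c * x) / x) (𝓝[≠] 0) (𝓝 c) := by
  have h1 : HasDerivAt (fun x : ℂ => Complex.sinh (c * x)) (Complex.cosh (c * 0) * c) 0 := by
    have := (hasDerivAt_id (0 : ℂ)).const_mul c
    simp only [mul_one] at this
    exact this.csinh
  rw [hasDerivAt_iff_tendsto_slope_zero] at h1
  simp only [mul_zero, Complex.cosh_zero, one_mul, zero_add, Complex.sinh_zero, sub_zero,
    smul_eq_mul] at h1
  refine h1.congr fun x => ?_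
  rw [div_eq_inv_mul]

lemma tendsto_den_div_sq (S ω : ℂ) :
    Tendsto (fun x : ℂ => den S ω x / x ^ 2) (𝓝[≠] 0) (𝓝 (-(1 - S * ω ^ 2) / 2)) := by
  have h1 := tendsto_sinh_div (ω / 2)
  have h2 := tendsto_sinh_div (1 / 2)
  have h3 := ((h1.pow 2).const_mul (2 * S)).sub ((h2.pow 2).const_mul 2)
  have h4 : 2 * S * (ω / 2) ^ 2 - 2 * (1 / 2) ^ 2 = -(1 - S * ω ^ 2) / 2 := by ring
  rw [h4] at h3
  refine h3.congr fun x => ?_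
  rw [den_eq, show ω / 2 * x = ω * x / 2 by ring, show 1 / 2 * x = x / 2 by ring]
  ring

lemma one_sub_mul_sq_ne_zero {S : ℂ} {ω : ℝ} (hS : ‖S‖ < 1) (hω : |ω| < 1) :
    1 - S * (ω : ℂ) ^ 2 ≠ 0 := by
  intro h
  have h1 : S * (ω : ℂ) ^ 2 = 1 := by linear_combination -h
  have h2 : ‖S‖ * |ω| ^ 2 = 1 := by
    have := congrArg norm h1
    simpa using this
  nlinarith [abs_nonneg ω, norm_nonneg S, sq_abs ω, pow_lt_one₀ (abs_nonneg ω) hω two_ne_zero]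

/-! ### Series with a parameter -/

section Series

/-- The entire even function `n S` has exponential type two, and near `x = 0` the quotient
`n S / den S ω ^ 3` is `a₄ / x ^ 4 + a₂ / x ^ 2 + a₀ + O(x ^ 2)`. -/
structure Numerator (ω : ℝ) (n : ℂ → ℂ → ℂ) (a₄ a₂ a₀ : ℂ → ℂ) : Prop where
  diff : ∀ S, Differentiable ℂ (n S)
  diff_param : ∀ x, Differentiable ℂ fun S => n S x
  even : ∀ S x, n S (-x) = n S x
  bound : ∀ R : ℝ, ∃ K : ℝ, 0 ≤ K ∧ ∀ S, ‖S‖ ≤ R → ∀ x, ‖n S x‖ ≤ K * rexp (2 * |x.re|)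
  diff_four : DifferentiableOn ℂ a₄ (Metric.ball 0 1)
  diff_two : DifferentiableOn ℂ a₂ (Metric.ball 0 1)
  jet : ∀ S, ‖S‖ < 1 → (fun x : ℂ => x ^ 4 * n S x -
    (a₄ S + a₂ S * x ^ 2 + a₀ S * x ^ 4) * den S ω x ^ 3) =O[𝓝[≠] 0] fun x => x ^ 12

/-- The quotient `n S / den S ω ^ 3` without its singular part, extended by its limit at `0`. -/
noncomputable def regular (ω : ℝ) (n : ℂ → ℂ → ℂ) (a₄ a₂ a₀ : ℂ → ℂ) (S x : ℂ) : ℂ :=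
  if x = 0 then a₀ S else n S x / den S ω x ^ 3 - a₄ S / x ^ 4 - a₂ S / x ^ 2

variable {ω : ℝ} {n : ℂ → ℂ → ℂ} {a₄ a₂ a₀ : ℂ → ℂ}

lemma regular_zero (S : ℂ) : regular ω n a₄ a₂ a₀ S 0 = a₀ S := by simp [regular]

lemma regular_of_ne (S : ℂ) {x : ℂ} (hx : x ≠ 0) : regular ω n a₄ a₂ a₀ S x =
    n S x / den S ω x ^ 3 - a₄ S / x ^ 4 - a₂ S / x ^ 2 := by simp [regular, hx]

/-! ### Holomorphy and uniform decay of the regular part. -/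

namespace Numerator

variable (H : Numerator ω n a₄ a₂ a₀)
include H

/-- Over a common denominator the difference from `a₀` is the `jet` expression divided by `x ^ 4 *
den ^ 3`. That denominator has exact order `x ^ 10`, because `1 - S ω²` does not vanish, while the
numerator is `O(x ^ 12)`. -/
lemma tendsto_regular (hω : |ω| < 1) {S : ℂ} (hS : ‖S‖ < 1) :
    Tendsto (regular ω n a₄ a₂ a₀ S) (𝓝[≠] 0) (𝓝 (a₀ S)) := by
  have hk := one_sub_mul_sq_ne_zero hS hω
  have h1 := tendsto_den_div_sq S ω
  have hl : -(1 - S * (ω : ℂ) ^ 2) / 2 ≠ 0 := div_ne_zero (neg_ne_zero.2 hk) two_ne_zero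
  have h2 : Tendsto (fun x : ℂ => (x ^ 4 * n S x -
      (a₄ S + a₂ S * x ^ 2 + a₀ S * x ^ 4) * den S ω x ^ 3) / x ^ 10) (𝓝[≠] 0) (𝓝 0) := by
    refine ((H.jet S hS).trans_isLittleO ?_).tendsto_div_nhds_zero
    exact (isLittleO_pow_pow (by norm_num)).mono nhdsWithin_le_nhds
  have h3 := h2.div (h1.pow 3) (pow_ne_zero 3 hl)
  rw [zero_div] at h3
  have h4 := h3.add_const (a₀ S)
  rw [zero_add] at h4
  refine h4.congr' ?_
  filter_upwards [self_mem_nhdsWithin, h1.eventually_ne hl] with x hx hd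
  have hx : x ≠ 0 := hx
  have hd' : den S ω x ≠ 0 := fun h => hd (by rw [h, zero_div])
  rw [regular_of_ne S hx]
  simp only [Pi.div_apply]
  field_simp
  ring

lemma differentiableAt_regular {S x : ℂ} (hx : x ≠ 0) (hd : den S ω x ≠ 0) :
    DifferentiableAt ℂ (regular ω n a₄ a₂ a₀ S) x := by
  have h1 : DifferentiableAt ℂ
      (fun x => n S x / den S ω x ^ 3 - a₄ S / x ^ 4 - a₂ S / x ^ 2) x := by
    have := (H.diff S) x
    have := (differentiable_den S ω) x
    refine DifferentiableAt.sub (DifferentiableAt.sub ?_ ?_) ?_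
    · exact DifferentiableAt.div (by fun_prop) (by fun_prop) (pow_ne_zero 3 hd)
    · exact DifferentiableAt.div (by fun_prop) (by fun_prop) (pow_ne_zero 4 hx)
    · exact DifferentiableAt.div (by fun_prop) (by fun_prop) (pow_ne_zero 2 hx)
  refine h1.congr_of_eventuallyEq ?_
  filter_upwards [isOpen_ne.mem_nhds hx] with y hy
  exact regular_of_ne S hy

/-- Riemann's removable singularity theorem, since `regular` takes its limit as its value at `0`. -/
lemma differentiableAt_regular_zero (hω : |ω| < 1) {S : ℂ} (hS : ‖S‖ < 1) :
    DifferentiableAt ℂ (regular ω n a₄ a₂ a₀ S) 0 := by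
  have hk := one_sub_mul_sq_ne_zero hS hω
  have hl : -(1 - S * (ω : ℂ) ^ 2) / 2 ≠ 0 := div_ne_zero (neg_ne_zero.2 hk) two_ne_zero
  refine (Complex.analyticAt_of_differentiable_on_punctured_nhds_of_continuousAt
    ?_ ?_).differentiableAt
  · filter_upwards [self_mem_nhdsWithin, (tendsto_den_div_sq S ω).eventually_ne hl] with x hx hd
    exact H.differentiableAt_regular hx fun h => hd (by rw [h, zero_div])
  · rw [continuousAt_iff_punctured_nhds, regular_zero]
    exact H.tendsto_regular hω hS

lemma exists_norm_coeff_le : ∃ A : ℝ, 0 ≤ A ∧ ∀ S : ℂ, ‖S‖ ≤ 1 / 2 → ‖a₄ S‖ ≤ A ∧ ‖a₂ S‖ ≤ A := by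
  have hsub : Metric.closedBall (0 : ℂ) (1 / 2) ⊆ Metric.ball 0 1 :=
    Metric.closedBall_subset_ball (by norm_num)
  obtain ⟨A, hA⟩ := (isCompact_closedBall (0 : ℂ) (1 / 2)).exists_bound_of_continuousOn
    (H.diff_four.continuousOn.mono hsub)
  obtain ⟨B, hB⟩ := (isCompact_closedBall (0 : ℂ) (1 / 2)).exists_bound_of_continuousOn
    (H.diff_two.continuousOn.mono hsub)
  refine ⟨max 0 (max A B), le_max_left _ _, fun S hS => ?_⟩
  have hS' : S ∈ Metric.closedBall (0 : ℂ) (1 / 2) := by simpa using hS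
  exact ⟨(hA S hS').trans ((le_max_left _ _).trans (le_max_right _ _)),
    (hB S hS').trans ((le_max_right _ _).trans (le_max_right _ _))⟩

lemma regular_neg (S x : ℂ) : regular ω n a₄ a₂ a₀ S (-x) = regular ω n a₄ a₂ a₀ S x := by
  by_cases hx : x = 0
  · simp [hx]
  · rw [regular_of_ne S hx, regular_of_ne S (neg_ne_zero.2 hx), H.even, den_neg]
    ring

/-- Far out in the cone the numerator grows at most like `exp (2 |x.re|)` and the cubed denominator
at least like `exp (3 |x.re|)`, so the quotient decays exponentially and the pole terms dictate the
quadratic rate. Near `0` only the unit circle is estimated, because inside it the separate terms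
blow up. -/
lemma exists_norm_regular_le (hω : |ω| < 1) {b : ℝ} (hb : 0 < b) :
    ∃ s > 0, s ≤ 1 / 2 ∧ ∃ C, 0 ≤ C ∧ ∀ S : ℂ, ‖S‖ ≤ s → ∀ x : ℂ,
      (‖x‖ ≤ 1 → x ≠ 0 → den S ω x ≠ 0) ∧
      (|x.im| < b * |x.re| → 1 ≤ ‖x‖ → den S ω x ≠ 0) ∧
      (‖x‖ = 1 → ‖regular ω n a₄ a₂ a₀ S x‖ ≤ C) ∧
      (|x.im| < b * |x.re| → 1 ≤ ‖x‖ → ‖regular ω n a₄ a₂ a₀ S x‖ ≤ C / (1 + ‖x‖) ^ 2) := by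
  obtain ⟨s, hs, hs2, c, hc, hden⟩ := exists_norm_den_ge hω hb
  obtain ⟨A, hA, hAb⟩ := H.exists_norm_coeff_le
  obtain ⟨K, hK, hKb⟩ := H.bound (1 / 2)
  have hn : ∀ S : ℂ, ‖S‖ ≤ s → ∀ x : ℂ, ‖n S x‖ ≤ K * rexp (2 * |x.re|) :=
    fun S hS x => hKb S (hS.trans hs2) x
  set C₁ := K * rexp 2 / c ^ 3 + A + A with hC₁
  set C₂ := K / c ^ 3 * (8 * (1 + b) ^ 2) + 4 * A + 4 * A with hC₂
  have hC₁0 : 0 ≤ C₁ := by positivity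
  have hC₂0 : 0 ≤ C₂ := by positivity
  refine ⟨s, hs, hs2, max C₁ C₂, hC₁0.trans (le_max_left _ _), fun S hS x => ⟨?_, ?_, ?_, ?_⟩⟩
  · intro hx hx0 h
    have := (hden S hS x).1 hx
    rw [h, norm_zero] at this
    have : 0 < c * ‖x‖ ^ 2 := by positivity
    linarith
  · intro hx h1 h
    have := (hden S hS x).2 hx h1
    rw [h, norm_zero] at this
    have : 0 < c * rexp |x.re| := by positivity
    linarith
  · intro hx
    have hx0 : x ≠ 0 := by rintro rfl; simp at hx
    have h1 := (hden S hS x).1 hx.le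
    rw [hx, one_pow, mul_one] at h1
    have h2 := hn S hS x
    have h3 : rexp (2 * |x.re|) ≤ rexp 2 := by
      rw [exp_le_exp]
      have := Complex.abs_re_le_norm x
      linarith
    have h4 := hAb S (hS.trans hs2)
    rw [regular_of_ne S hx0]
    refine le_trans ?_ (le_max_left _ _)
    refine (norm_sub_le _ _).trans (add_le_add ((norm_sub_le _ _).trans (add_le_add ?_ ?_)) ?_)
    · rw [norm_div, norm_pow]
      gcongr
      exact h2.trans (by gcongr)
    · simpa [hx] using h4.1
    · simpa [hx] using h4.2
  · intro hx h1
    have hx0 : x ≠ 0 := by rintro rfl; norm_num at h1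
    have h2 := (hden S hS x).2 hx h1
    have h3 := hn S hS x
    have h4 := hAb S (hS.trans hs2)
    have h5 : (1 + ‖x‖) ^ 2 ≤ 4 * ‖x‖ ^ 2 := by nlinarith
    have hpow : ∀ y : ℝ, 0 ≤ y → y / ‖x‖ ^ 2 ≤ 4 * y / (1 + ‖x‖) ^ 2 := by
      intro y hy
      rw [div_le_div_iff₀ (by positivity) (by positivity)]
      nlinarith [mul_le_mul_of_nonneg_left h5 hy]
    rw [regular_of_ne S hx0]
    refine le_trans ?_ (div_le_div_of_nonneg_right (le_max_right C₁ C₂) (by positivity))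
    rw [hC₂, add_div, add_div]
    refine (norm_sub_le _ _).trans (add_le_add ((norm_sub_le _ _).trans (add_le_add ?_ ?_)) ?_)
    · rw [norm_div, norm_pow]
      have h6 : ‖x‖ / (1 + b) ≤ |x.re| := by
        rw [div_le_iff₀ (by positivity)]
        linarith [norm_le_of_abs_im_le hx.le]
      have h7 : (|x.re|) ^ 2 / 2 ≤ rexp |x.re| := by
        have := Real.quadratic_le_exp_of_nonneg (abs_nonneg x.re)
        nlinarith [abs_nonneg x.re]
      have h8 : (‖x‖ / (1 + b)) ^ 2 / 2 ≤ rexp |x.re| := by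
        refine le_trans ?_ h7
        gcongr
      calc ‖n S x‖ / ‖den S ω x‖ ^ 3 ≤ K * rexp (2 * |x.re|) / (c * rexp |x.re|) ^ 3 := by
            gcongr
        _ = K / c ^ 3 * (1 / rexp |x.re|) := by
            have : rexp (2 * |x.re|) = rexp |x.re| ^ 2 := by
              rw [← exp_nat_mul]; norm_num
            rw [this]
            field_simp
        _ ≤ K / c ^ 3 * (1 / ((‖x‖ / (1 + b)) ^ 2 / 2)) := by gcongr
        _ = K / c ^ 3 * (2 * (1 + b) ^ 2) / ‖x‖ ^ 2 := by field_simp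
        _ ≤ 4 * (K / c ^ 3 * (2 * (1 + b) ^ 2)) / (1 + ‖x‖) ^ 2 := hpow _ (by positivity)
        _ = _ := by ring
    · rw [norm_div, norm_pow]
      refine le_trans ?_ (hpow A hA)
      gcongr
      · exact h4.1
      · norm_num
    · rw [norm_div, norm_pow]
      refine le_trans ?_ (hpow A hA)
      gcongr
      exact h4.2

/-- Inside the unit disc the maximum principle carries the bound inwards from the circle. This
avoids any estimate of the cancellation of poles that is uniform in `S`. The factor `4` absorbs `(1
+ ‖x‖)²` there. -/
lemma exists_evenDecay (hω : |ω| < 1) {b : ℝ} (hb : 0 < b) :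
    ∃ s > 0, s ≤ 1 / 2 ∧ ∃ C, ∀ S : ℂ, ‖S‖ ≤ s → EvenDecay b C (regular ω n a₄ a₂ a₀ S) ∧
      ∀ x ∈ doubleCone b, x ≠ 0 → den S ω x ≠ 0 := by
  obtain ⟨s, hs, hs2, C, hC, h⟩ := H.exists_norm_regular_le hω hb
  refine ⟨s, hs, hs2, 4 * C, fun S hS => ?_⟩
  have hS1 : ‖S‖ < 1 := by linarith
  have hden : ∀ x ∈ doubleCone b, x ≠ 0 → den S ω x ≠ 0 := by
    rintro x (hx | hx) hx0
    · rcases le_total ‖x‖ 1 with h1 | h1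
      · exact (h S hS x).1 h1 hx0
      · exact (h S hS x).2.1 hx h1
    · exact (h S hS x).1 (mem_ball_zero_iff.1 hx).le hx0
  have hdiff : ∀ x, (x ≠ 0 → den S ω x ≠ 0) →
      DifferentiableAt ℂ (regular ω n a₄ a₂ a₀ S) x := by
    intro x hx
    by_cases hx0 : x = 0
    · rw [hx0]; exact H.differentiableAt_regular_zero hω hS1
    · exact H.differentiableAt_regular hx0 (hx hx0)
  have hball : ∀ x ∈ Metric.ball (0 : ℂ) 1, ‖regular ω n a₄ a₂ a₀ S x‖ ≤ C := by
    intro x hx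
    refine Complex.norm_le_of_forall_mem_frontier_norm_le Metric.isBounded_ball
      (DifferentiableOn.diffContOnCl fun y hy => ?_) (fun y hy => ?_) (subset_closure hx)
    · have : ‖y‖ ≤ 1 := by simpa using Metric.closure_ball_subset_closedBall hy
      exact (hdiff y ((h S hS y).1 this)).differentiableWithinAt
    · have : ‖y‖ = 1 := by simpa using Metric.frontier_ball_subset_sphere hy
      exact (h S hS y).2.2.1 this
  refine ⟨⟨fun x hx => (hdiff x (hden x hx)).differentiableWithinAt,
    fun x _ => H.regular_neg S x, fun x hx => ?_⟩, hden⟩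
  rcases lt_or_ge ‖x‖ 1 with h1 | h1
  · refine (hball x (mem_ball_zero_iff.2 h1)).trans ?_
    rw [le_div_iff₀ (by positivity)]
    have : (1 + ‖x‖) ^ 2 ≤ 4 := by nlinarith [norm_nonneg x]
    nlinarith
  · rcases hx with hx | hx
    · refine ((h S hS x).2.2.2 hx h1).trans ?_
      gcongr
      linarith
    · exact absurd (mem_ball_zero_iff.1 hx) (not_lt.2 h1)

end Numerator

/-- A dominated integral of functions holomorphic in a parameter is holomorphic. -/
lemma differentiableOn_integral_of_norm_le {α : Type*} [MeasurableSpace α] {μ : Measure α}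
    {F : ℂ → α → ℂ} {s : ℝ} {bound : α → ℝ}
    (hmeas : ∀ S ∈ Metric.ball (0 : ℂ) s, AEStronglyMeasurable (F S) μ)
    (hdiff : ∀ᵐ x ∂μ, DifferentiableOn ℂ (fun S => F S x) (Metric.ball 0 s))
    (hbound : ∀ᵐ x ∂μ, ∀ S ∈ Metric.ball (0 : ℂ) s, ‖F S x‖ ≤ bound x)
    (hint : Integrable bound μ) :
    DifferentiableOn ℂ (fun S => ∫ x, F S x ∂μ) (Metric.ball 0 s) := by
  intro S hS
  have hS' : ‖S‖ < s := mem_ball_zero_iff.1 hS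
  -- A point within `r` of `S`, and then a circle of radius `r` around it, still lie in the ball, as
  -- `‖S‖ + 2 r < s`.
  set r := (s - ‖S‖) / 3 with hr
  have hr0 : 0 < r := by linarith
  have hsub : ∀ T ∈ Metric.ball S r, Metric.closedBall T r ⊆ Metric.ball 0 s := by
    intro T hT U hU
    rw [mem_ball_iff_norm] at hT
    rw [mem_closedBall_iff_norm] at hU
    rw [mem_ball_zero_iff]
    have h1 := norm_sub_norm_le T S
    have h2 := norm_sub_norm_le U T
    linarith
  have hsubT : ∀ T ∈ Metric.ball S r, T ∈ Metric.ball (0 : ℂ) s := fun T hT =>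
    hsub T hT (Metric.mem_closedBall_self hr0.le)
  have hderiv : ∀ᵐ x ∂μ, ∀ T ∈ Metric.ball S r,
      HasDerivAt (fun S => F S x) (deriv (fun S => F S x) T) T := by
    filter_upwards [hdiff] with x hx T hT
    exact (hx.differentiableAt (Metric.isOpen_ball.mem_nhds (hsubT T hT))).hasDerivAt
  refine (hasDerivAt_integral_of_dominated_loc_of_deriv_le (F := F) (x₀ := S)
    (F' := fun T x => deriv (fun S => F S x) T) (bound := fun x => bound x / r)
    (Metric.ball_mem_nhds S hr0) ?_ ?_ ?_ ?_ ?_ hderiv).2.differentiableAt.differentiableWithinAt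
  · filter_upwards [Metric.isOpen_ball.mem_nhds hS] with T hT using hmeas T hT
  · exact hint.mono' (hmeas S hS) (hbound.mono fun x hx => hx S hS)
  -- The derivative in the parameter is measurable as a pointwise limit of difference quotients. The
  -- steps `r / (k + 2)` are nonzero and strictly below `r`.
  · have hu : Tendsto (fun k : ℕ => (r / (k + 2 : ℝ) : ℝ)) atTop (𝓝 0) := by
      have h1 : Tendsto (fun k : ℕ => ((k : ℝ) + 2)) atTop atTop :=
        tendsto_atTop_add_const_right _ _ tendsto_natCast_atTop_atTop
      exact h1.const_div_atTop r
    have hupos : ∀ k : ℕ, 0 < r / ((k : ℝ) + 2) := fun k => by positivity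
    have hult : ∀ k : ℕ, r / ((k : ℝ) + 2) < r := fun k => by
      rw [div_lt_iff₀ (by positivity)]
      nlinarith [(k.cast_nonneg : (0 : ℝ) ≤ k)]
    refine aestronglyMeasurable_of_tendsto_ae atTop (f := fun (k : ℕ) x =>
      ((r / ((k : ℝ) + 2) : ℝ) : ℂ)⁻¹ • (F (S + ((r / ((k : ℝ) + 2) : ℝ) : ℂ)) x - F S x))
      (fun k => ?_) ?_
    · refine AEStronglyMeasurable.const_smul ((hmeas _ (hsubT _ ?_)).sub (hmeas S hS))
        (((r / ((k : ℝ) + 2) : ℝ) : ℂ)⁻¹)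
      rw [mem_ball_iff_norm, add_sub_cancel_left, Complex.norm_real,
        Real.norm_of_nonneg (hupos k).le]
      exact hult k
    · filter_upwards [hderiv] with x hx
      have h1 := (hasDerivAt_iff_tendsto_slope_zero.1 (hx S (Metric.mem_ball_self hr0)))
      refine h1.comp (tendsto_nhdsWithin_iff.2 ⟨?_, Eventually.of_forall fun k => ?_⟩)
      · exact (Complex.continuous_ofReal.tendsto 0).comp hu
      · exact Complex.ofReal_ne_zero.2 (hupos k).ne'
  -- Cauchy's estimate on the circle of radius `r` bounds the derivative by `bound x / r`.
  · filter_upwards [hdiff, hbound] with x hx hb T hT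
    refine Complex.norm_deriv_le_of_forall_mem_sphere_norm_le hr0 ?_ ?_
    · exact DifferentiableOn.diffContOnCl (hx.mono fun U hU =>
        hsub T hT (Metric.closure_ball_subset_closedBall hU))
    · exact fun U hU => hb U (hsub T hT (Metric.sphere_subset_closedBall hU))
  · exact hint.div_const r

/-- The integral of the regular part. -/
noncomputable def regularIntegral (ω : ℝ) (n : ℂ → ℂ → ℂ) (a₄ a₂ : ℂ → ℂ) (S : ℂ) : ℂ :=
  ∫ x in Ioi (0 : ℝ), (n S x / den S ω x ^ 3 - a₄ S / (x : ℂ) ^ 4 - a₂ S / (x : ℂ) ^ 2)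

lemma regularIntegral_eq (S : ℂ) : regularIntegral ω n a₄ a₂ S =
    ∫ x in Ioi (0 : ℝ), regular ω n a₄ a₂ a₀ S x := by
  refine setIntegral_congr_fun measurableSet_Ioi fun x hx => ?_
  have hx0 : (x : ℂ) ≠ 0 := Complex.ofReal_ne_zero.2 (ne_of_gt hx)
  exact (regular_of_ne S hx0).symm

lemma ofReal_mem_doubleCone {b : ℝ} (hb : 0 < b) (x : ℝ) : (x : ℂ) ∈ doubleCone b := by
  by_cases hx : x = 0
  · right; simp [hx]
  · left
    show |(x : ℂ).im| < b * |(x : ℂ).re|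
    simp only [Complex.ofReal_im, Complex.ofReal_re, abs_zero]
    positivity

/-! ### Analyticity of the integral in `S`, and the expansion of the series. -/

namespace Numerator

variable (H : Numerator ω n a₄ a₂ a₀)
include H

lemma analyticAt_regularIntegral (hω : |ω| < 1) : AnalyticAt ℂ (regularIntegral ω n a₄ a₂) 0 := by
  obtain ⟨s, hs, hs2, C, hC⟩ := H.exists_evenDecay hω one_pos
  have hint : Integrable fun x : ℝ => C * (1 / (1 + |x| * 1) ^ 2) :=
    (integrable_inv_one_add_abs_mul_sq one_pos).const_mul C
  have h1 := differentiableOn_integral_of_norm_le (μ := volume.restrict (Ioi (0 : ℝ)))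
    (F := fun S (x : ℝ) => regular ω n a₄ a₂ a₀ S x) (s := s)
    (bound := fun x : ℝ => C * (1 / (1 + |x| * 1) ^ 2)) (fun S hS => ?_) ?_ ?_ hint.integrableOn
  · rw [show regularIntegral ω n a₄ a₂ = fun S => ∫ x in Ioi (0 : ℝ), regular ω n a₄ a₂ a₀ S x from
      funext regularIntegral_eq]
    exact h1.analyticAt (Metric.ball_mem_nhds 0 hs)
  · have hS := (hC S (mem_ball_zero_iff.1 hS).le).1
    have := hS.continuous_ray le_rfl one_pos (h := 1) (by simp) 0
    simp only [iteratedDeriv_zero, mul_one] at this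
    exact this.aestronglyMeasurable
  · filter_upwards [ae_restrict_mem measurableSet_Ioi] with x hx
    have hx0 : (x : ℂ) ≠ 0 := Complex.ofReal_ne_zero.2 (ne_of_gt hx)
    intro S hS
    have hS' := mem_ball_zero_iff.1 hS
    have hd := (hC S hS'.le).2 x (ofReal_mem_doubleCone one_pos x) hx0
    have hS1 : Metric.ball (0 : ℂ) 1 ∈ 𝓝 S :=
      Metric.isOpen_ball.mem_nhds (mem_ball_zero_iff.2 (by linarith))
    have e : (fun S => regular ω n a₄ a₂ a₀ S x) =
        fun S => n S x / den S ω x ^ 3 - a₄ S / (x : ℂ) ^ 4 - a₂ S / (x : ℂ) ^ 2 :=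
      funext fun S => regular_of_ne S hx0
    rw [e]
    refine DifferentiableAt.differentiableWithinAt ?_
    have h1 := H.diff_param x S
    have h2 : DifferentiableAt ℂ (fun S => den S ω x) S := by unfold den; fun_prop
    have h3 := H.diff_four.differentiableAt hS1
    have h4 := H.diff_two.differentiableAt hS1
    exact ((h1.div (h2.pow 3) (pow_ne_zero 3 hd)).sub (h3.div_const _)).sub (h4.div_const _)
  · refine Eventually.of_forall fun x S hS => ?_
    have := (hC S (mem_ball_zero_iff.1 hS).le).1.bound x (ofReal_mem_doubleCone one_pos x)
    rw [Complex.norm_real, Real.norm_eq_abs] at this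
    rw [mul_one, mul_one_div]
    exact this

/-- The uniform expansion is applied to the regular part, and the pole terms are summed exactly as
`ζ(4) = π⁴ / 90` and `ζ(2) = π² / 6`. -/
lemma exists_asymptotic_bound (hω : |ω| < 1) {a : ℝ} (ha : 0 ≤ a) (N : ℕ) :
    ∃ s > 0, ∃ K : ℝ, 0 ≤ K ∧ ∀ S : ℂ, ‖S‖ ≤ s → ∀ h : ℂ, |h.im| ≤ a * h.re → 0 < h.re →
      ‖∑' k : ℕ, n S ((k + 1) * h) / den S ω ((k + 1) * h) ^ 3 -
        (a₄ S * (π ^ 4 / 90) / h ^ 4 + a₂ S * (π ^ 2 / 6) / h ^ 2 - a₀ S / 2) -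
        regularIntegral ω n a₄ a₂ S / h‖ ≤ K * ‖h‖ ^ (N + 1) := by
  have hab : a < a + 1 := by linarith
  obtain ⟨s, hs, hs2, C, hC⟩ := H.exists_evenDecay hω (ha.trans_lt hab)
  obtain ⟨K, hK, hKb⟩ := exists_eulerMaclaurin_bound ha hab C N
  refine ⟨s, hs, K, hK, fun S hS h hh h0 => ?_⟩
  obtain ⟨h1, h2⟩ := hKb _ (hC S hS).1 h hh h0
  have hh0 : h ≠ 0 := by rintro rfl; simp at h0
  have h4 : HasSum (fun k : ℕ => a₄ S / (((k + 1 : ℕ) : ℂ) * h) ^ 4)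
      (a₄ S * (π ^ 4 / 90) / h ^ 4) := by
    -- The zeta series is indexed from `0`, with a zeroth term equal to `0` by division by zero.
    -- Shifting by one matches the terms `n + 1`.
    have := (hasSum_nat_add_iff' 1).2 hasSum_zeta_four
    simp only [Finset.range_one, Finset.sum_singleton, Nat.cast_zero] at this
    norm_num at this
    have := ((Complex.hasSum_ofReal).2 this).mul_left (a₄ S / h ^ 4)
    push_cast at this
    convert! this using 1
    · ext k; push_cast; field_simp
    · ring
  have h5 : HasSum (fun k : ℕ => a₂ S / (((k + 1 : ℕ) : ℂ) * h) ^ 2)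
      (a₂ S * (π ^ 2 / 6) / h ^ 2) := by
    have := (hasSum_nat_add_iff' 1).2 hasSum_zeta_two
    simp only [Finset.range_one, Finset.sum_singleton, Nat.cast_zero] at this
    norm_num at this
    have := ((Complex.hasSum_ofReal).2 this).mul_left (a₂ S / h ^ 2)
    push_cast at this
    convert! this using 1
    · ext k; push_cast; field_simp
    · ring
  have h6 := (h1.hasSum.add h4).add h5
  have h7 : ∀ k : ℕ, regular ω n a₄ a₂ a₀ S ((k + 1) * h) + a₄ S / (((k + 1 : ℕ) : ℂ) * h) ^ 4 +
      a₂ S / (((k + 1 : ℕ) : ℂ) * h) ^ 2 = n S ((k + 1) * h) / den S ω ((k + 1) * h) ^ 3 := by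
    intro k
    rw [regular_of_ne S (mul_ne_zero (by exact_mod_cast k.succ_ne_zero) hh0)]
    push_cast; ring
  simp only [h7] at h6
  rw [h6.tsum_eq]
  rw [regular_zero, ← regularIntegral_eq] at h2
  refine le_trans (le_of_eq ?_) h2
  congr 1
  ring

end Numerator

/-- No smallness of `S` is needed: as `|ω| < 1`, the `S` term grows only like `exp (|ω| x.re)` and
is eventually below an eighth of `exp x.re`. -/
lemma exists_exp_le_norm_den {ω : ℝ} (hω : |ω| < 1) (S : ℂ) :
    ∃ X : ℝ, 0 ≤ X ∧ ∀ x : ℂ, X ≤ x.re → rexp x.re / 8 ≤ ‖den S ω x‖ := by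
  have h1 : Tendsto (fun y : ℝ => 2 * ‖S‖ * rexp (-((1 - |ω|) * y))) atTop (𝓝 0) := by
    have h2 : Tendsto (fun y : ℝ => (1 - |ω|) * y) atTop atTop :=
      tendsto_id.const_mul_atTop (by linarith)
    simpa using (tendsto_exp_neg_atTop_nhds_zero.comp h2).const_mul (2 * ‖S‖)
  obtain ⟨X, hX⟩ := eventually_atTop.1 ((h1.eventually_lt_const (show (0 : ℝ) < 1 / 8 by norm_num)))
  refine ⟨max X 4, by positivity, fun x hx => ?_⟩
  have hxX := hX x.re ((le_max_left _ _).trans hx)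
  have hx4 : 4 ≤ x.re := (le_max_right _ _).trans hx
  have h3 := le_norm_sinh (x / 2)
  have h4 := norm_sinh_le_exp ((ω : ℂ) * x / 2)
  have h5 : |(x / 2).re| = x.re / 2 := by
    rw [Complex.div_ofNat_re, abs_of_nonneg (by positivity)]
  have h6 : |((ω : ℂ) * x / 2).re| = |ω| * x.re / 2 := by
    rw [Complex.div_ofNat_re, Complex.re_ofReal_mul, abs_div, abs_mul,
      abs_of_nonneg (show 0 ≤ x.re by linarith)]
    norm_num
  rw [h5] at h3
  rw [h6] at h4
  have h7 : rexp (-(x.re / 2)) ≤ rexp (x.re / 2) := exp_le_exp.2 (by linarith)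
  have h8 : ((rexp (x.re / 2) - rexp (-(x.re / 2))) / 2) ^ 2 ≤ ‖Complex.sinh (x / 2)‖ ^ 2 :=
    pow_le_pow_left₀ (by linarith) h3 2
  have h9 : rexp (x.re / 2) ^ 2 = rexp x.re := by rw [← exp_nat_mul]; congr 1; push_cast; ring
  have h10 : rexp (x.re / 2) * rexp (-(x.re / 2)) = 1 := by rw [← exp_add]; simp
  have h11 : ‖Complex.sinh ((ω : ℂ) * x / 2)‖ ^ 2 ≤ rexp (|ω| * x.re) := by
    refine (pow_le_pow_left₀ (norm_nonneg _) h4 2).trans (le_of_eq ?_)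
    rw [← exp_nat_mul]; congr 1; push_cast; ring
  have h12 : rexp (|ω| * x.re) = rexp (-((1 - |ω|) * x.re)) * rexp x.re := by
    rw [← exp_add]; congr 1; ring
  have h13 : 2 * ‖S‖ * ‖Complex.sinh ((ω : ℂ) * x / 2)‖ ^ 2 ≤ 1 / 8 * rexp x.re := by
    calc _ ≤ 2 * ‖S‖ * rexp (|ω| * x.re) := by gcongr
      _ = 2 * ‖S‖ * rexp (-((1 - |ω|) * x.re)) * rexp x.re := by rw [h12]; ring
      _ ≤ _ := by gcongr
  have h14 := norm_den_ge S ω x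
  have h15 := add_one_le_exp x.re
  nlinarith [sq_nonneg (rexp (-(x.re / 2)))]

/-- On the real axis `|sinh (ω x / 2)| ≤ |sinh (x / 2)|`, so a factor of modulus below one cannot
balance the two terms of `den_eq`. -/
lemma den_ofReal_ne_zero {ω : ℝ} (hω : |ω| < 1) {S : ℂ} (hS : ‖S‖ < 1) {x : ℝ} (hx : x ≠ 0) :
    den S ω x ≠ 0 := by
  intro h
  have h1 := norm_den_ge S ω x
  rw [h, norm_zero] at h1
  have e1 : ‖Complex.sinh ((x : ℂ) / 2)‖ = |sinh (x / 2)| := by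
    rw [show (x : ℂ) / 2 = ((x / 2 : ℝ) : ℂ) by push_cast; rfl, ← Complex.ofReal_sinh,
      Complex.norm_real, Real.norm_eq_abs]
  have e2 : ‖Complex.sinh ((ω : ℂ) * x / 2)‖ = |sinh (ω * x / 2)| := by
    rw [show (ω : ℂ) * x / 2 = ((ω * x / 2 : ℝ) : ℂ) by push_cast; rfl, ← Complex.ofReal_sinh,
      Complex.norm_real, Real.norm_eq_abs]
  have h2 : |sinh (ω * x / 2)| ≤ |sinh (x / 2)| := by
    rw [abs_sinh, abs_sinh, sinh_le_sinh, abs_div, abs_div, abs_mul]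
    gcongr
    nlinarith [abs_nonneg x]
  have h3 : 0 < |sinh (x / 2)| := by
    rw [abs_pos]
    intro h
    exact hx (by simpa using sinh_eq_zero.1 h)
  rw [e1, e2] at h1
  have h4 : |sinh (ω * x / 2)| ^ 2 ≤ |sinh (x / 2)| ^ 2 := by gcongr
  have h5 : ‖S‖ * |sinh (ω * x / 2)| ^ 2 ≤ ‖S‖ * |sinh (x / 2)| ^ 2 := by gcongr
  nlinarith [pow_pos h3 2]

/-! ### Convergence of the series for every `S` and of the integral for `‖S‖ < 1`. -/

namespace Numerator

variable (H : Numerator ω n a₄ a₂ a₀)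
include H

lemma exists_norm_quotient_le (hω : |ω| < 1) (S : ℂ) :
    ∃ C X : ℝ, ∀ x : ℂ, X ≤ x.re → ‖n S x / den S ω x ^ 3‖ ≤ C * rexp (-x.re) := by
  obtain ⟨X, hX, h⟩ := exists_exp_le_norm_den hω S
  obtain ⟨K, hK, hKb⟩ := H.bound ‖S‖
  refine ⟨512 * K, X, fun x hx => ?_⟩
  have h1 := hKb S le_rfl x
  rw [abs_of_nonneg (hX.trans hx)] at h1
  rw [norm_div, norm_pow]
  calc ‖n S x‖ / ‖den S ω x‖ ^ 3
      ≤ K * rexp (2 * x.re) / (rexp x.re / 8) ^ 3 := by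
        gcongr; exact h x hx
    _ = 512 * K * rexp (-x.re) := by
        have : rexp (2 * x.re) = rexp x.re ^ 2 := by rw [← exp_nat_mul]; norm_num
        rw [this, exp_neg]
        field_simp
        norm_num

/-- Only the tail matters, and it decays geometrically. Finitely many terms with a vanishing
denominator would do no harm, so this holds for every `S`. -/
lemma summable_quotient (hω : |ω| < 1) (S : ℂ) {h : ℂ} (h0 : 0 < h.re) :
    Summable fun k : ℕ => n S ((k + 1) * h) / den S ω ((k + 1) * h) ^ 3 := by
  obtain ⟨C, X, hC⟩ := H.exists_norm_quotient_le hω S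
  have hs : Summable fun k : ℕ => C * rexp (-h.re) * rexp (k * -h.re) :=
    (Real.summable_exp_nat_mul_iff.2 (by linarith)).mul_left _
  refine Summable.of_norm_bounded_eventually_nat hs ?_
  have h1 : Tendsto (fun k : ℕ => (k : ℝ) * h.re) atTop atTop :=
    tendsto_natCast_atTop_atTop.atTop_mul_const h0
  filter_upwards [h1.eventually_ge_atTop X] with k hk
  have e : (((k : ℂ) + 1) * h).re = (k + 1) * h.re := by
    rw [show ((k : ℂ) + 1) = (((k : ℝ) + 1 : ℝ) : ℂ) by push_cast; rfl, Complex.re_ofReal_mul]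
  refine (hC _ (by rw [e]; linarith)).trans (le_of_eq ?_)
  rw [e, mul_assoc, ← exp_add]
  congr 2; ring

/-- On the real axis the denominator has no zero except the origin throughout the unit disc of `S`,
so the regular part is continuous up to `0`. At infinity it is `O(x ^ (-2))`. -/
lemma integrableOn_regular (hω : |ω| < 1) {S : ℂ} (hS : ‖S‖ < 1) :
    IntegrableOn (fun x : ℝ => n S x / den S ω x ^ 3 - a₄ S / (x : ℂ) ^ 4 - a₂ S / (x : ℂ) ^ 2)
      (Ioi 0) := by
  obtain ⟨C, X, hC⟩ := H.exists_norm_quotient_le hω S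
  have hcont : Continuous fun x : ℝ => regular ω n a₄ a₂ a₀ S x := by
    refine continuous_iff_continuousAt.2 fun x => ?_
    have : DifferentiableAt ℂ (regular ω n a₄ a₂ a₀ S) x := by
      by_cases hx : x = 0
      · rw [hx, Complex.ofReal_zero]; exact H.differentiableAt_regular_zero hω hS
      · exact H.differentiableAt_regular (Complex.ofReal_ne_zero.2 hx) (den_ofReal_ne_zero hω hS hx)
    exact this.continuousAt.comp Complex.continuous_ofReal.continuousAt
  have hO : (fun x : ℝ => regular ω n a₄ a₂ a₀ S x) =O[atTop] fun x : ℝ => x ^ (-2 : ℝ) := by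
    refine IsBigO.of_bound (2 * |C| + ‖a₄ S‖ + ‖a₂ S‖) ?_
    filter_upwards [eventually_ge_atTop X, eventually_ge_atTop 1] with x hX h1
    have hx0 : (x : ℂ) ≠ 0 := Complex.ofReal_ne_zero.2 (by linarith)
    have h2 := hC x (by simpa using hX)
    rw [Complex.ofReal_re] at h2
    rw [regular_of_ne S hx0, Real.norm_of_nonneg (by positivity), Real.rpow_neg (by linarith),
      Real.rpow_two]
    have h3 : rexp (-x) ≤ 2 * (x ^ 2)⁻¹ := by
      rw [exp_neg, ← div_eq_mul_inv, inv_eq_one_div, div_le_div_iff₀ (exp_pos x) (by positivity)]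
      have := Real.quadratic_le_exp_of_nonneg (show 0 ≤ x by linarith)
      nlinarith
    have h4 : (1 : ℝ) / x ^ 4 ≤ (x ^ 2)⁻¹ := by
      rw [← one_div]
      exact one_div_le_one_div_of_le (by positivity) (pow_le_pow_right₀ h1 (by norm_num))
    rw [add_mul, add_mul]
    refine (norm_sub_le _ _).trans (add_le_add ((norm_sub_le _ _).trans (add_le_add ?_ ?_)) ?_)
    · calc _ ≤ C * rexp (-x) := h2
        _ ≤ |C| * rexp (-x) := by gcongr; exact le_abs_self C
        _ ≤ |C| * (2 * (x ^ 2)⁻¹) := by gcongr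
        _ = _ := by ring
    · rw [norm_div, norm_pow, Complex.norm_real, Real.norm_of_nonneg (by linarith), div_eq_mul_one_div]
      gcongr
    · rw [norm_div, norm_pow, Complex.norm_real, Real.norm_of_nonneg (by linarith), div_eq_mul_inv]
  have hI : IntegrableOn (fun x : ℝ => regular ω n a₄ a₂ a₀ S x) (Ici 0) := by
    refine LocallyIntegrableOn.integrableOn_of_isBigO_atTop
      (hcont.locallyIntegrable.locallyIntegrableOn _) hO ?_
    exact ⟨Ioi 1, Ioi_mem_atTop 1, integrableOn_Ioi_rpow_of_lt (by norm_num) one_pos⟩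
  refine (hI.mono_set Ioi_subset_Ici_self).congr_fun (fun x hx => ?_) measurableSet_Ioi
  exact regular_of_ne S (Complex.ofReal_ne_zero.2 (ne_of_gt hx))

end Numerator

end Series

/-! ### Distillation of a function with an integer and a half-integer part -/

lemma re_cpow_half_pos {z : ℂ} (hz : z ∈ Complex.slitPlane) : 0 < (z ^ (1 / 2 : ℂ)).re := by
  have hz0 := Complex.slitPlane_ne_zero hz
  have hπ : Complex.arg z ≠ π := Complex.slitPlane_arg_ne_pi hz
  rw [Complex.cpow_def_of_ne_zero hz0, Complex.exp_re]
  have h1 : (Complex.log z * (1 / 2)).im = z.arg / 2 := by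
    rw [show (1 / 2 : ℂ) = ((1 / 2 : ℝ) : ℂ) by push_cast; rfl, mul_comm, Complex.im_ofReal_mul,
      Complex.log_im]
    ring
  rw [h1]
  refine mul_pos (exp_pos _) (cos_pos_of_mem_Ioo ⟨?_, ?_⟩)
  · linarith [Complex.neg_pi_lt_arg z]
  · linarith [lt_of_le_of_ne (Complex.arg_le_pi z) hπ]

lemma cpow_half_sq (z : ℂ) : (z ^ (1 / 2 : ℂ)) ^ 2 = z := by
  rw [one_div]; exact Complex.cpow_nat_inv_pow z two_ne_zero

/-- The square root maps the sector of opening `2 (π - δ)` into a cone. -/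
lemma abs_im_cpow_half_le {δ : ℝ} (hδ : 0 < δ) (hδπ : δ < π) {z : ℂ}
    (hz : z ∈ sector 0 (-(π - δ)) (π - δ)) :
    |(z ^ (1 / 2 : ℂ)).im| ≤ tan ((π - δ) / 2) * (z ^ (1 / 2 : ℂ)).re := by
  obtain ⟨hz0, h1, h2⟩ := hz
  rw [sub_zero] at h1 h2
  rw [Complex.cpow_def_of_ne_zero hz0, Complex.exp_re, Complex.exp_im]
  have h3 : (Complex.log z * (1 / 2)).im = z.arg / 2 := by
    rw [show (1 / 2 : ℂ) = ((1 / 2 : ℝ) : ℂ) by push_cast; rfl, mul_comm, Complex.im_ofReal_mul,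
      Complex.log_im]
    ring
  rw [h3, abs_mul, abs_of_pos (exp_pos _), mul_left_comm]
  refine mul_le_mul_of_nonneg_left ?_ (exp_pos _).le
  have hc : 0 < cos (z.arg / 2) := cos_pos_of_mem_Ioo ⟨by linarith, by linarith⟩
  rw [← div_le_iff₀ hc, ← abs_of_pos hc, ← abs_div, ← tan_eq_sin_div_cos, abs_le]
  constructor
  · rw [← tan_neg]
    exact (strictMonoOn_tan.le_iff_le ⟨by linarith, by linarith⟩ ⟨by linarith, by linarith⟩).2
      (by linarith)
  · exact (strictMonoOn_tan.le_iff_le ⟨by linarith, by linarith⟩ ⟨by linarith, by linarith⟩).2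
      (by linarith)

lemma sector_subset_slitPlane {δ : ℝ} (hδ : 0 < δ) :
    sector 0 (-(π - δ)) (π - δ) ⊆ Complex.slitPlane := by
  rintro z ⟨hz0, h1, h2⟩
  rw [sub_zero] at h1 h2
  rw [Complex.mem_slitPlane_iff_arg]
  exact ⟨by intro h; linarith, hz0⟩

/-- The coefficients of the transseries with coefficients `a n` at `n` and `b n` at `n + 1 / 2`. -/
noncomputable def halfIntegerCoeff (a b : ℕ → ℂ) : ℝ → ℂ :=
  Function.extend (fun n : ℕ => (n : ℝ)) a (Function.extend (fun n : ℕ => (n : ℝ) + 1 / 2) b 0)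

lemma natCast_ne_natCast_add_half (m n : ℕ) : (m : ℝ) ≠ n + 1 / 2 := by
  intro h
  have h1 : ((2 * m : ℕ) : ℝ) = ((2 * n + 1 : ℕ) : ℝ) := by push_cast; linarith
  have h2 : 2 * m = 2 * n + 1 := by exact_mod_cast h1
  omega

lemma halfIntegerCoeff_natCast (a b : ℕ → ℂ) (n : ℕ) : halfIntegerCoeff a b n = a n :=
  Function.Injective.extend_apply Nat.cast_injective a _ n

lemma halfIntegerCoeff_add_half (a b : ℕ → ℂ) (n : ℕ) :
    halfIntegerCoeff a b ((n : ℝ) + 1 / 2) = b n := by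
  rw [halfIntegerCoeff, Function.extend_apply' _ _ _ (by
    rintro ⟨m, hm⟩; exact natCast_ne_natCast_add_half m n hm)]
  exact Function.Injective.extend_apply (fun x y hxy => by simpa using hxy) b _ n

lemma exists_of_halfIntegerCoeff_ne_zero {a b : ℕ → ℂ} {α : ℝ} (h : halfIntegerCoeff a b α ≠ 0) :
    ∃ n : ℕ, α = n ∨ α = n + 1 / 2 := by
  by_contra hc
  push Not at hc
  refine h ?_
  rw [halfIntegerCoeff, Function.extend_apply' _ _ _ (by
    rintro ⟨m, hm⟩; exact (hc m).1 hm.symm), Function.extend_apply' _ _ _ (by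
    rintro ⟨m, hm⟩; exact (hc m).2 hm.symm)]
  rfl

lemma natCast_add_half_lt_iff (n N : ℕ) : (n : ℝ) + 1 / 2 < N ↔ n < N := by
  constructor
  · intro h
    have : (n : ℝ) < N := by linarith
    exact_mod_cast this
  · intro h
    have : ((n + 1 : ℕ) : ℝ) ≤ N := by exact_mod_cast h
    push_cast at this
    linarith

/-- Truncation below order `N` keeps exactly `N` candidate integer exponents and `N` candidate
half-integer ones, since `n + 1/2 < N` is the same as `n < N`. Vanishing coefficients are filtered
out because a transseries lists only its nonzero terms. -/
lemma exists_finset_halfIntegerCoeff (a b : ℕ → ℂ) (N : ℕ) :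
    ∃ F : Finset ℝ, (∀ α : ℝ, α ∈ F ↔ halfIntegerCoeff a b α ≠ 0 ∧ α < N) ∧
      ∀ z : ℂ, z ≠ 0 → ∑ α ∈ F, halfIntegerCoeff a b α * z ^ (α : ℂ) =
        ∑ n ∈ Finset.range N, z ^ n * a n +
          z ^ (1 / 2 : ℂ) * ∑ n ∈ Finset.range N, z ^ n * b n := by
  classical
  set F₁ := (Finset.range N).image fun n : ℕ => (n : ℝ) with hF₁
  set F₂ := (Finset.range N).image fun n : ℕ => (n : ℝ) + 1 / 2 with hF₂
  refine ⟨(F₁ ∪ F₂).filter fun α => halfIntegerCoeff a b α ≠ 0, fun α => ?_, fun z hz => ?_⟩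
  · simp only [hF₁, hF₂, Finset.mem_filter, Finset.mem_union, Finset.mem_image, Finset.mem_range]
    constructor
    · rintro ⟨⟨n, hn, rfl⟩ | ⟨n, hn, rfl⟩, h⟩
      · exact ⟨h, by exact_mod_cast hn⟩
      · exact ⟨h, (natCast_add_half_lt_iff n N).2 hn⟩
    · rintro ⟨h, hα⟩
      refine ⟨?_, h⟩
      obtain ⟨n, rfl | rfl⟩ := exists_of_halfIntegerCoeff_ne_zero h
      · exact Or.inl ⟨n, by exact_mod_cast hα, rfl⟩
      · exact Or.inr ⟨n, (natCast_add_half_lt_iff n N).1 hα, rfl⟩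
  · rw [Finset.sum_filter_of_ne (fun α _ h => left_ne_zero_of_mul h), Finset.sum_union, hF₁, hF₂,
      Finset.sum_image (fun x _ y _ hxy => by simpa using hxy),
      Finset.sum_image (fun x _ y _ hxy => by simpa using hxy), Finset.mul_sum]
    · congr 1
      · refine Finset.sum_congr rfl fun n _ => ?_
        rw [halfIntegerCoeff_natCast, Complex.ofReal_natCast, Complex.cpow_natCast, mul_comm]
      · refine Finset.sum_congr rfl fun n _ => ?_
        rw [halfIntegerCoeff_add_half]
        push_cast
        rw [Complex.cpow_add _ _ hz, Complex.cpow_natCast]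
        ring
    · rw [Finset.disjoint_left]
      simp only [hF₁, hF₂, Finset.mem_image]
      rintro α ⟨m, _, rfl⟩ ⟨n, _, h⟩
      exact natCast_ne_natCast_add_half m n h.symm

lemma isBigO_sub_sum_coeff {A : ℂ → ℂ} {p : FormalMultilinearSeries ℂ ℂ ℂ}
    (hp : HasFPowerSeriesAt A p 0) (N : ℕ) :
    (fun z : ℂ => A z - ∑ n ∈ Finset.range N, z ^ n * p.coeff n) =O[𝓝 0] fun z => ‖z‖ ^ N := by
  have := hp.isBigO_sub_partialSum_pow N
  simpa [FormalMultilinearSeries.partialSum, FormalMultilinearSeries.apply_eq_pow_smul_coeff]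
    using this

lemma isBigO_cpow_half_one : (fun z : ℂ => z ^ (1 / 2 : ℂ)) =O[𝓝 0] fun _ : ℂ => (1 : ℝ) := by
  refine IsBigO.of_bound 1 ?_
  filter_upwards [Metric.ball_mem_nhds (0 : ℂ) one_pos] with z hz
  have hz' : ‖z‖ < 1 := by simpa using hz
  have h1 : ‖z ^ (1 / 2 : ℂ)‖ ^ 2 = ‖z‖ := by rw [← norm_pow, cpow_half_sq]
  rw [norm_one, mul_one]
  nlinarith [norm_nonneg (z ^ (1 / 2 : ℂ))]

lemma ofReal_mem_sector {δ : ℝ} (hδπ : δ < π) {t : ℝ} (ht : 0 < t) :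
    (t : ℂ) ∈ sector 0 (-(π - δ)) (π - δ) := by
  refine ⟨Complex.ofReal_ne_zero.2 ht.ne', ?_, ?_⟩ <;>
    rw [sub_zero, Complex.arg_ofReal_of_nonneg ht.le] <;> linarith

lemma zero_mem_closure_of_eventually {E : Set ℂ} (h : ∀ᶠ t : ℝ in 𝓝[>] 0, (t : ℂ) ∈ E) :
    (0 : ℂ) ∈ closure E := by
  refine mem_closure_of_tendsto (b := 𝓝[>] (0 : ℝ)) (f := fun t : ℝ => (t : ℂ)) ?_ h
  have := Complex.continuous_ofReal.tendsto 0
  rw [Complex.ofReal_zero] at this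
  exact this.mono_left nhdsWithin_le_nhds

/-- If, in all sectors around the positive axis, `f z = A z + √z B z` up to terms of arbitrarily
high order, with `A` and `B` analytic at `0`, then `A` is the analytic distillate of `f`. -/
theorem isDistillate_of_isBigO {D : Set ℂ} {f A B : ℂ → ℂ} (hD : D ⊆ Complex.slitPlane)
    (hpos : ∀ᶠ t : ℝ in 𝓝[>] 0, (t : ℂ) ∈ D) (hA : AnalyticAt ℂ A 0) (hB : AnalyticAt ℂ B 0)
    (h : ∀ δ : ℝ, 0 < δ → δ < π → ∀ N : ℕ, (fun z => f z - A z - z ^ (1 / 2 : ℂ) * B z)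
      =O[𝓝[sector 0 (-(π - δ)) (π - δ)] 0] fun z => ‖z‖ ^ N) :
    IsDistillate D 0 f A := by
  obtain ⟨p, hp⟩ := hA
  obtain ⟨q, hq⟩ := hB
  have h0D : ∀ z ∈ D, z ≠ 0 := fun z hz => Complex.slitPlane_ne_zero (hD hz)
  -- The sectors of all openings below the full cut plane exhaust it. The same coefficients serve in
  -- each of them, so every integer coefficient is common to all parts.
  set Λ : Set (ℝ × ℝ) := (fun δ : ℝ => (-(π - δ), π - δ)) '' Ioo 0 π with hΛ
  have hne : ((fun δ : ℝ => (-(π - δ), π - δ)) (π / 2)) ∈ Λ :=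
    mem_image_of_mem _ ⟨by positivity, by linarith [pi_pos]⟩
  refine ⟨?_, Λ, fun _ => halfIntegerCoeff p.coeff q.coeff, p.coeff, ?_, ?_, ?_, ?_, ?_⟩
  · refine zero_mem_closure_of_eventually ?_
    filter_upwards [hpos] with t ht using ⟨ht, h0D _ ht⟩
  · rintro z ⟨hz, -⟩
    have hz' := Complex.mem_slitPlane_iff_arg.1 (hD hz)
    have h1 : |z.arg| < π := abs_lt.2 ⟨Complex.neg_pi_lt_arg z,
      lt_of_le_of_ne (Complex.arg_le_pi z) hz'.1⟩
    refine mem_biUnion (mem_image_of_mem _ (⟨?_, ?_⟩ : (π - |z.arg|) / 2 ∈ Ioo 0 π)) ⟨hz'.2, ?_, ?_⟩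
    · linarith
    · linarith [abs_nonneg z.arg, pi_pos]
    · rw [sub_zero]
      linarith [neg_abs_le z.arg]
    · rw [sub_zero]
      linarith [le_abs_self z.arg]
  · rintro _ ⟨δ, ⟨hδ, hδπ⟩, rfl⟩
    refine ⟨?_, fun N => ?_⟩
    · refine zero_mem_closure_of_eventually ?_
      filter_upwards [hpos, self_mem_nhdsWithin] with t ht ht0
      exact ⟨ht, ofReal_mem_sector hδπ ht0⟩
    · obtain ⟨F, hF, hsum⟩ := exists_finset_halfIntegerCoeff p.coeff q.coeff N
      refine ⟨F, hF, ?_⟩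
      have h1 := (h δ hδ hδπ N).mono (nhdsWithin_mono 0 (inter_subset_right (s := D)))
      have h2 := (isBigO_sub_sum_coeff hp N).mono
        (nhdsWithin_le_nhds (s := D ∩ sector 0 (-(π - δ)) (π - δ)))
      have h3 := (isBigO_cpow_half_one.mul (isBigO_sub_sum_coeff hq N)).mono
        (nhdsWithin_le_nhds (s := D ∩ sector 0 (-(π - δ)) (π - δ)))
      simp only [one_mul] at h3
      simp only [sub_zero]
      refine ((h1.add h2).add h3).congr' ?_ EventuallyEq.rfl
      filter_upwards [self_mem_nhdsWithin] with z hz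
      rw [hsum z (h0D z hz.1)]
      ring
  · intro n v hv
    rw [← hv _ hne]
    exact (halfIntegerCoeff_natCast _ _ n).symm
  -- The alternative of coefficients that differ between sectors does not occur.
  · intro n hn
    exact absurd ⟨p.coeff n, fun s _ => halfIntegerCoeff_natCast _ _ n⟩ hn
  · obtain ⟨ε, hε, hε'⟩ := Metric.eventually_nhds_iff_ball.1 (hasFPowerSeriesAt_iff.1 hp)
    refine ⟨ε, hε, fun z hz => ?_⟩
    have := hε' z hz
    simpa [mul_comm] using this

/-! ### Even Taylor expansions -/

/-- `f x = c₀ + c₁ x ^ 2 + c₂ x ^ 4 + O(x ^ 6)` for `x → 0`, `x ≠ 0`. -/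
def HasEvenJet (f : ℂ → ℂ) (c₀ c₁ c₂ : ℂ) : Prop :=
  (fun x : ℂ => f x - (c₀ + c₁ * x ^ 2 + c₂ * x ^ 4)) =O[𝓝[≠] 0] fun x => x ^ 6

namespace HasEvenJet

variable {f g : ℂ → ℂ} {c₀ c₁ c₂ d₀ d₁ d₂ : ℂ}

lemma add (hf : HasEvenJet f c₀ c₁ c₂) (hg : HasEvenJet g d₀ d₁ d₂) :
    HasEvenJet (fun x => f x + g x) (c₀ + d₀) (c₁ + d₁) (c₂ + d₂) := by
  refine (IsBigO.add hf hg).congr_left fun x => ?_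
  ring

lemma const_mul (hf : HasEvenJet f c₀ c₁ c₂) (k : ℂ) :
    HasEvenJet (fun x => k * f x) (k * c₀) (k * c₁) (k * c₂) := by
  refine (IsBigO.const_mul_left hf k).congr_left fun x => ?_
  ring

lemma poly (c₀ c₁ c₂ : ℂ) : HasEvenJet (fun x => c₀ + c₁ * x ^ 2 + c₂ * x ^ 4) c₀ c₁ c₂ := by
  simpa [HasEvenJet] using isBigO_zero (E' := ℂ) (fun x : ℂ => x ^ 6) (𝓝[≠] 0)

lemma sum {ι : Type*} (s : Finset ι) {F : ι → ℂ → ℂ} {c₀ c₁ c₂ : ι → ℂ}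
    (h : ∀ i ∈ s, HasEvenJet (F i) (c₀ i) (c₁ i) (c₂ i)) :
    HasEvenJet (fun x => ∑ i ∈ s, F i x) (∑ i ∈ s, c₀ i) (∑ i ∈ s, c₁ i) (∑ i ∈ s, c₂ i) := by
  refine (IsBigO.sum h).congr_left fun x => ?_
  simp only [Finset.sum_apply, Finset.sum_sub_distrib, Finset.sum_add_distrib, Finset.sum_mul]

lemma isBigO_of_continuous {h : ℂ → ℂ} (hc : Continuous h) :
    h =O[𝓝[≠] 0] fun _ => (1 : ℂ) :=
  (hc.tendsto 0).isBigO_one ℂ |>.mono nhdsWithin_le_nhds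

/-- The error is that of `f` times the bounded `g`, plus the polynomial of `f` times the error of
`g`, plus the monomials of degree at least `6` in the product of the polynomials. -/
lemma mul (hf : HasEvenJet f c₀ c₁ c₂) (hg : HasEvenJet g d₀ d₁ d₂) :
    HasEvenJet (fun x => f x * g x) (c₀ * d₀) (c₀ * d₁ + c₁ * d₀)
      (c₀ * d₂ + c₁ * d₁ + c₂ * d₀) := by
  have h6 : (fun x : ℂ => x ^ 6) =O[𝓝[≠] 0] fun _ => (1 : ℂ) :=
    isBigO_of_continuous (by fun_prop)
  have hg1 : g =O[𝓝[≠] 0] fun _ => (1 : ℂ) := by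
    have := (IsBigO.trans hg h6).add
      (isBigO_of_continuous (h := fun x => d₀ + d₁ * x ^ 2 + d₂ * x ^ 4) (by fun_prop))
    simpa using this
  have h1 := IsBigO.mul hf hg1
  have h2 := (isBigO_of_continuous (h := fun x => c₀ + c₁ * x ^ 2 + c₂ * x ^ 4) (by fun_prop)).mul hg
  have h3 := (isBigO_of_continuous
    (h := fun x => (c₁ * d₂ + c₂ * d₁) + c₂ * d₂ * x ^ 2) (by fun_prop)).mul
    (isBigO_refl (fun x : ℂ => x ^ 6) (𝓝[≠] 0))
  simp only [mul_one, one_mul] at h1 h2 h3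
  refine ((h1.add h2).add h3).congr_left fun x => ?_
  ring

lemma congr (hf : HasEvenJet f c₀ c₁ c₂) (e₀ : c₀ = d₀) (e₁ : c₁ = d₁) (e₂ : c₂ = d₂) :
    HasEvenJet f d₀ d₁ d₂ := by
  subst e₀ e₁ e₂; exact hf

end HasEvenJet

/-- The expansion runs to `y ^ 6` because division by `x ^ 2` later costs two orders. -/
lemma isBigO_cosh_sub : (fun y : ℂ => Complex.cosh y - (1 + y ^ 2 / 2 + y ^ 4 / 24 + y ^ 6 / 720))
    =O[𝓝 0] fun y => y ^ 8 := by
  have h1 := Complex.exp_sub_sum_range_isBigO_pow 8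
  have h2 := h1.comp_tendsto (show Tendsto (fun y : ℂ => -y) (𝓝 0) (𝓝 0) by
    simpa using (continuous_neg (G := ℂ)).tendsto 0)
  have h3 : ((fun x : ℂ => x ^ 8) ∘ fun y => -y) = fun y => y ^ 8 := by
    ext y; simp [Even.neg_pow (show Even 8 by decide)]
  rw [h3] at h2
  refine ((h1.add h2).const_mul_left (1 / 2)).congr_left fun y => ?_
  simp only [Function.comp_apply, Finset.sum_range_succ, Finset.sum_range_zero, Nat.factorial,
    Complex.cosh]
  push_cast
  ring

lemma hasEvenJet_cosh (l : ℂ) : HasEvenJet (fun x => (Complex.cosh (l * x) - 1) / x ^ 2)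
    (l ^ 2 / 2) (l ^ 4 / 24) (l ^ 6 / 720) := by
  have h1 := isBigO_cosh_sub.comp_tendsto (show Tendsto (fun x : ℂ => l * x) (𝓝[≠] 0) (𝓝 0) by
    have := (continuous_const_mul l).tendsto 0
    rw [mul_zero] at this
    exact this.mono_left nhdsWithin_le_nhds)
  have h2 : (fun x : ℂ => (l * x) ^ 8) =O[𝓝[≠] 0] fun x => x ^ 8 := by
    simp only [mul_pow]
    exact (isBigO_refl _ _).const_mul_left _
  have h3 := (h1.trans h2).mul (isBigO_refl (fun x : ℂ => (x ^ 2)⁻¹) (𝓝[≠] 0))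
  refine h3.congr' ?_ ?_
  · filter_upwards [self_mem_nhdsWithin] with x hx
    have hx : x ≠ 0 := hx
    simp only [Function.comp_apply]
    field_simp
    ring
  · filter_upwards [self_mem_nhdsWithin] with x hx
    have hx : x ≠ 0 := hx
    field_simp

lemma hasEvenJet_den (S ω : ℂ) : HasEvenJet (fun x => den S ω x / x ^ 2)
    (-(1 - S * ω ^ 2) / 2) (-(1 - S * ω ^ 4) / 24) (-(1 - S * ω ^ 6) / 720) := by
  have h := ((hasEvenJet_cosh 1).const_mul (-1)).add ((hasEvenJet_cosh ω).const_mul S)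
  refine (IsBigO.congr_left h fun x => ?_ : HasEvenJet _ _ _ _)
  simp only [den, one_mul]
  ring

/-- The three hypotheses match the coefficients of `1`, `x²`, `x⁴` in `f / x² = (a + b x² + c x⁴)
(den / x²)³`. Agreement of these leaves an error `x ^ 6`, and clearing the powers of `x` multiplies
it by another `x ^ 6`. -/
lemma jet_of_hasEvenJet {ω : ℂ} {S a b c n₀ n₁ n₂ d₀ d₁ d₂ : ℂ} {f : ℂ → ℂ}
    (hf : HasEvenJet (fun x => f x / x ^ 2) n₀ n₁ n₂)
    (hd : HasEvenJet (fun x => den S ω x / x ^ 2) d₀ d₁ d₂)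
    (h₀ : a * d₀ ^ 3 = n₀) (h₁ : a * (3 * d₀ ^ 2 * d₁) + b * d₀ ^ 3 = n₁)
    (h₂ : a * (3 * d₀ ^ 2 * d₂ + 3 * d₀ * d₁ ^ 2) + b * (3 * d₀ ^ 2 * d₁) + c * d₀ ^ 3 = n₂) :
    (fun x : ℂ => x ^ 4 * f x - (a + b * x ^ 2 + c * x ^ 4) * den S ω x ^ 3)
      =O[𝓝[≠] 0] fun x => x ^ 12 := by
  have h := hf.add (((HasEvenJet.poly a b c).mul (hd.mul (hd.mul hd))).const_mul (-1))
  have h' := h.congr (d₀ := 0) (d₁ := 0) (d₂ := 0) (by rw [← h₀]; ring) (by rw [← h₁]; ring)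
    (by rw [← h₂]; ring)
  have h'' := (isBigO_refl (fun x : ℂ => x ^ 6) (𝓝[≠] 0)).mul h'
  refine h''.congr' ?_ (Eventually.of_forall fun x => ?_)
  · filter_upwards [self_mem_nhdsWithin] with x hx
    have hx : x ≠ 0 := hx
    field_simp
    ring
  · ring

/-- A combination of the functions `cosh (λ x) - 1`, `|λ| ≤ 2`, is a `Numerator` as soon as the
coefficients of its Taylor expansion match. -/
lemma Numerator.of_sum_cosh {ι : Type*} [Fintype ι] {ω : ℝ} {n : ℂ → ℂ → ℂ} {a₄ a₂ a₀ : ℂ → ℂ}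
    (w : ι → ℂ → ℂ) (l : ι → ℝ) (hw : ∀ i, Differentiable ℂ (w i)) (hl : ∀ i, |l i| ≤ 2)
    (hn : ∀ S x, n S x = ∑ i, w i S * (Complex.cosh (l i * x) - 1))
    (d₄ : DifferentiableOn ℂ a₄ (Metric.ball 0 1)) (d₂ : DifferentiableOn ℂ a₂ (Metric.ball 0 1))
    (h₄ : ∀ S : ℂ, ‖S‖ < 1 →
      a₄ S * (-(1 - S * ω ^ 2) / 2) ^ 3 = ∑ i, w i S * ((l i : ℂ) ^ 2 / 2))
    (h₂ : ∀ S : ℂ, ‖S‖ < 1 →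
      a₄ S * (3 * (-(1 - S * ω ^ 2) / 2) ^ 2 * (-(1 - S * ω ^ 4) / 24)) +
        a₂ S * (-(1 - S * ω ^ 2) / 2) ^ 3 = ∑ i, w i S * ((l i : ℂ) ^ 4 / 24))
    (h₀ : ∀ S : ℂ, ‖S‖ < 1 →
      a₄ S * (3 * (-(1 - S * ω ^ 2) / 2) ^ 2 * (-(1 - S * ω ^ 6) / 720) +
          3 * (-(1 - S * ω ^ 2) / 2) * (-(1 - S * ω ^ 4) / 24) ^ 2) +
        a₂ S * (3 * (-(1 - S * ω ^ 2) / 2) ^ 2 * (-(1 - S * ω ^ 4) / 24)) +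
        a₀ S * (-(1 - S * ω ^ 2) / 2) ^ 3 = ∑ i, w i S * ((l i : ℂ) ^ 6 / 720)) :
    Numerator ω n a₄ a₂ a₀ where
  diff S := by
    rw [funext (hn S)]
    fun_prop
  diff_param x := by
    rw [funext fun S => hn S x]
    fun_prop
  even S x := by
    rw [hn, hn]
    simp
  bound R := by
    have h1 : ∀ i, ∃ B : ℝ, 0 ≤ B ∧ ∀ S : ℂ, ‖S‖ ≤ R → ‖w i S‖ ≤ B := by
      intro i
      obtain ⟨B, hB⟩ := (isCompact_closedBall (0 : ℂ) R).exists_bound_of_continuousOn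
        (hw i).continuous.continuousOn
      exact ⟨max 0 B, le_max_left _ _, fun S hS =>
        (hB S (by simpa using hS)).trans (le_max_right _ _)⟩
    choose B hB0 hB using h1
    refine ⟨∑ i, B i * 2, Finset.sum_nonneg fun i _ => mul_nonneg (hB0 i) two_pos.le,
      fun S hS x => ?_⟩
    rw [hn, Finset.sum_mul]
    refine norm_sum_le_of_le _ fun i _ => ?_
    rw [norm_mul, mul_assoc]
    refine mul_le_mul (hB i S hS) ?_ (norm_nonneg _) (hB0 i)
    have h2 := norm_cosh_le_exp ((l i : ℂ) * x)
    rw [Complex.re_ofReal_mul, abs_mul] at h2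
    have h3 : rexp (|l i| * |x.re|) ≤ rexp (2 * |x.re|) := by
      gcongr
      exact hl i
    have h4 : 1 ≤ rexp (2 * |x.re|) := one_le_exp (by positivity)
    have h5 := norm_sub_le (Complex.cosh (l i * x)) 1
    rw [norm_one] at h5
    linarith
  diff_four := d₄
  diff_two := d₂
  jet S hS := by
    refine jet_of_hasEvenJet ?_ (hasEvenJet_den S ω) (h₄ S hS) (h₂ S hS) (h₀ S hS)
    have := HasEvenJet.sum Finset.univ
      fun i _ => (hasEvenJet_cosh (l i : ℂ)).const_mul (w i S)
    refine (IsBigO.congr_left this fun x => ?_ : HasEvenJet _ _ _ _)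
    rw [hn, Finset.sum_div]
    congr 1
    exact Finset.sum_congr rfl fun i _ => by ring

/-- The coefficient of `x ^ (-4)` in `polePart`. -/
noncomputable def poleFour (X : Coeff) (ω S : ℂ) : ℂ :=
  match X with
  | .rho => 36 / (1 - S * ω ^ 2)
  | .p => 24 / (1 - S * ω ^ 2)
  | .A => 0
  | .W => 0
  | .G => 0

/-- The coefficient of `x ^ (-2)` in `polePart`. -/
noncomputable def poleTwo (X : Coeff) (ω S : ℂ) : ℂ :=
  match X with
  | .rho => 2 * ω ^ 2 * (1 - S) / (1 - S * ω ^ 2) ^ 2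
  | .p => 4 * ω ^ 2 * (1 - S) / (1 - S * ω ^ 2) ^ 2
  | .A => 0
  | .W => -(2 * (1 - S) * ω ^ 2 / (1 - S * ω ^ 2) ^ 2)
  | .G => 2 * ω * (1 - ω ^ 2) / (1 - S * ω ^ 2) ^ 2

/-- The value at `x = 0` of `num / den ^ 3 - polePart`. -/
noncomputable def constTerm (X : Coeff) (ω S : ℂ) : ℂ :=
  match X with
  | .rho => (3 * S ^ 2 * ω ^ 8 - 4 * S * (5 * S - 8) * ω ^ 6 + 10 * (S ^ 2 - 5 * S + 1) * ω ^ 4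
          + 4 * (8 * S - 5) * ω ^ 2 + 3) / (60 * (1 - S * ω ^ 2) ^ 3)
  | .p => (S ^ 2 * ω ^ 8 + 4 * (16 - 5 * S) * S * ω ^ 6 + 10 * (1 - 11 * S + S ^ 2) * ω ^ 4
          + 4 * (-5 + 16 * S) * ω ^ 2 + 1) / (30 * (1 - S * ω ^ 2) ^ 3)
  | .A => -(ω ^ 2 * (1 - ω ^ 2) ^ 2 / (2 * (1 - S * ω ^ 2) ^ 3))
  | .W => ω ^ 2 * (2 * S ^ 2 * ω ^ 4 - 5 * S * ω ^ 4 - S ^ 2 * ω ^ 2 + 8 * S * ω ^ 2 - ω ^ 2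
          - 5 * S + 2) / (6 * (1 - S * ω ^ 2) ^ 3)
  | .G => -(ω * (ω ^ 4 - 1) / (30 * (1 - S * ω ^ 2) ^ 2))

/-- The coefficients of `cosh (λ x) - 1`, for `λ = 1, ω, 1 + ω, 1 - ω, 2, 2 ω`, in `num`. -/
noncomputable def coshWeight (X : Coeff) (ω S : ℂ) : Fin 6 → ℂ :=
  match X with
  | .rho => ![-2 + S + S ^ 2 * ω ^ 2, 1 + S * ω ^ 2 - 2 * S ^ 2 * ω ^ 2,
      -(1 + S + S * ω ^ 2 + S ^ 2 * ω ^ 2) / 2 + 6 * S * ω,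
      -(1 + S + S * ω ^ 2 + S ^ 2 * ω ^ 2) / 2 - 6 * S * ω,
      -(3 + S * ω ^ 2) / 2, -(S * (1 + 3 * S * ω ^ 2)) / 2]
  | .p => ![-2 * S * (-1 - (-2 + S) * ω ^ 2), 2 * (1 + S * (-2 + ω ^ 2)),
      -(1 + S) * (1 + S * ω ^ 2) + 12 * S * ω, -(1 + S) * (1 + S * ω ^ 2) - 12 * S * ω,
      -(1 + 3 * S * ω ^ 2), -S * (3 + S * ω ^ 2)]
  | .A => ![-1 + ω ^ 2, 1 - ω ^ 2, (1 + ω ^ 2) / 2 - 3 * ω, (1 + ω ^ 2) / 2 + 3 * ω, ω ^ 2, 1]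
  | .W => ![-1 - (-2 + S) * S * ω ^ 2, -(1 + S * (-2 + S * ω ^ 2)),
      (1 + S ^ 2 * ω ^ 2) / 2 - 3 * S * ω, (1 + S ^ 2 * ω ^ 2) / 2 + 3 * S * ω, S * ω ^ 2, S]
  | .G => ![-(1 - S) * ω, (1 - S) * ω, -(1 + S) * ω / 2 + 3 * (1 + S * ω ^ 2) / 2,
      -(1 + S) * ω / 2 - 3 * (1 + S * ω ^ 2) / 2, -ω, -S * ω]

/-- Products of hyperbolic functions are linearised by the addition formulas. Subtracting `1` from
each `cosh` is harmless because every numerator vanishes at `x = 0`. -/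
lemma num_eq_sum (X : Coeff) (ω : ℝ) (S x : ℂ) : num S ω x X =
    ∑ i, coshWeight X ω S i *
      (Complex.cosh (((![1, ω, 1 + ω, 1 - ω, 2, 2 * ω] : Fin 6 → ℝ) i : ℝ) * x) - 1) := by
  have h1 : Complex.cosh ((1 + ω) * x) = Complex.cosh x * Complex.cosh (ω * x) +
      Complex.sinh x * Complex.sinh (ω * x) := by
    rw [add_mul, one_mul, Complex.cosh_add]
  have h2 : Complex.cosh ((1 - ω) * x) = Complex.cosh x * Complex.cosh (ω * x) -
      Complex.sinh x * Complex.sinh (ω * x) := by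
    rw [sub_mul, one_mul, Complex.cosh_sub]
  have h3 : ∀ y : ℂ, Complex.sinh y ^ 2 = (Complex.cosh (2 * y) - 1) / 2 := fun y => by
    rw [Complex.cosh_two_mul, Complex.cosh_sq]; ring
  cases X <;>
  · simp only [num, coshWeight, Fin.sum_univ_succ, Fin.sum_univ_zero, Fin.isValue,
      Matrix.cons_val_zero, Matrix.cons_val_succ, Complex.ofReal_add, Complex.ofReal_sub,
      Complex.ofReal_one, Complex.ofReal_mul, Complex.ofReal_ofNat, h1, h2, h3, one_mul, mul_assoc]
    ring

lemma polePart_eq (X : Coeff) (S ω x : ℂ) :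
    polePart S ω x X = poleFour X ω S / x ^ 4 + poleTwo X ω S / x ^ 2 := by
  cases X <;> simp only [polePart, poleFour, poleTwo, div_div, zero_div, zero_add, neg_div, add_zero]

lemma numerator_num (X : Coeff) {ω : ℝ} (hω : |ω| < 1) :
    Numerator ω (fun S x => num S ω x X) (poleFour X ω) (poleTwo X ω) (constTerm X ω) := by
  have hne : ∀ S ∈ Metric.ball (0 : ℂ) 1, 1 - S * (ω : ℂ) ^ 2 ≠ 0 := fun S hS =>
    one_sub_mul_sq_ne_zero (by simpa using hS) hω
  have hω' := abs_lt.1 hω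
  refine Numerator.of_sum_cosh (fun i S => coshWeight X ω S i) ![1, ω, 1 + ω, 1 - ω, 2, 2 * ω]
    ?_ ?_ (fun S x => num_eq_sum X ω S x) ?_ ?_ ?_ ?_ ?_
  · intro i
    cases X <;> fin_cases i <;> simp [coshWeight] <;> fun_prop
  · intro i
    fin_cases i <;> simp <;> rw [abs_le] <;> constructor <;> linarith
  · intro S hS
    have := hne S hS
    refine DifferentiableAt.differentiableWithinAt (f := fun S => poleFour X ω S) ?_
    cases X <;> simp only [poleFour] <;> fun_prop (disch := assumption)
  · intro S hS
    have := pow_ne_zero 2 (hne S hS)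
    refine DifferentiableAt.differentiableWithinAt (f := fun S => poleTwo X ω S) ?_
    cases X <;> simp only [poleTwo] <;> fun_prop (disch := assumption)
  -- What remains is the matching of the coefficients of `x²`, `x⁴` and `x⁶`: rational identities in
  -- `S` and `ω` for each `X`.
  all_goals
    intro S hS
    have := one_sub_mul_sq_ne_zero hS hω
    cases X <;>
    · simp only [poleFour, poleTwo, constTerm, coshWeight, Fin.sum_univ_succ, Fin.sum_univ_zero,
        Fin.isValue, Matrix.cons_val_zero, Matrix.cons_val_succ, Complex.ofReal_add,
        Complex.ofReal_sub, Complex.ofReal_one, Complex.ofReal_mul, Complex.ofReal_ofNat]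
      field_simp
      ring

/-- The expansion of a parameter-dependent series on sectors, with a bounded prefactor. -/
theorem Numerator.isBigO_sub {ω : ℝ} {n : ℂ → ℂ → ℂ} {a₄ a₂ a₀ : ℂ → ℂ}
    (H : Numerator ω n a₄ a₂ a₀) (hω : |ω| < 1) {β₀ : ℝ} (hβ₀ : 0 < β₀) {s P : ℂ → ℂ}
    (hs : ContinuousAt s 0) (hs0 : s 0 = 0) (hP : P =O[𝓝 0] fun _ => (1 : ℝ)) {δ : ℝ} (hδ : 0 < δ)
    (hδπ : δ < π) (N : ℕ) :
    (fun z : ℂ => P z * (∑' k : ℕ, n (s z) ((k + 1) * (z ^ (1 / 2 : ℂ) * β₀)) /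
        den (s z) ω ((k + 1) * (z ^ (1 / 2 : ℂ) * β₀)) ^ 3 -
      (a₄ (s z) * (π ^ 4 / 90) / (z ^ (1 / 2 : ℂ) * β₀) ^ 4 +
        a₂ (s z) * (π ^ 2 / 6) / (z ^ (1 / 2 : ℂ) * β₀) ^ 2 - a₀ (s z) / 2) -
      regularIntegral ω n a₄ a₂ (s z) / (z ^ (1 / 2 : ℂ) * β₀)))
      =O[𝓝[sector 0 (-(π - δ)) (π - δ)] 0] fun z => ‖z‖ ^ N := by
  have ha : 0 ≤ tan ((π - δ) / 2) := (tan_pos_of_pos_of_lt_pi_div_two (by linarith) (by linarith)).le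
  -- The order is doubled because `h` is of size `√z`: the error `‖h‖ ^ (2 N + 1)` is `‖z‖ ^ N`
  -- times a bounded factor.
  obtain ⟨σ, hσ, K, hK, h⟩ := H.exists_asymptotic_bound hω ha (2 * N)
  have h1 := (hP.mono (nhdsWithin_le_nhds (s := sector 0 (-(π - δ)) (π - δ))))
  have hsmall : ∀ᶠ z in 𝓝 (0 : ℂ), ‖s z‖ < σ :=
    hs.norm.eventually_lt_const (by simpa [hs0] using hσ)
  have h2 := isBigO_cpow_half_one.mono (nhdsWithin_le_nhds (s := sector 0 (-(π - δ)) (π - δ)))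
  have h3 : (fun z : ℂ => ‖z ^ (1 / 2 : ℂ) * β₀‖ ^ (2 * N + 1))
      =O[𝓝[sector 0 (-(π - δ)) (π - δ)] 0] fun z => ‖z‖ ^ N := by
    have h4 := (h2.norm_left.mul (isBigO_refl (fun z : ℂ => ‖z‖ ^ N) _)).const_mul_left
      (β₀ ^ (2 * N + 1))
    simp only [one_mul] at h4
    refine h4.congr_left fun z => ?_
    have h5 : ‖z‖ ^ N = ‖z ^ (1 / 2 : ℂ)‖ ^ (2 * N) := by
      rw [pow_mul, ← norm_pow (z ^ (1 / 2 : ℂ)), cpow_half_sq]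
    rw [h5, norm_mul, Complex.norm_real, Real.norm_of_nonneg hβ₀.le]
    ring
  have h6 : ∀ f : ℂ → ℂ, f =O[𝓝[sector 0 (-(π - δ)) (π - δ)] 0] (fun z => ‖z‖ ^ N) →
      (fun z => P z * f z) =O[𝓝[sector 0 (-(π - δ)) (π - δ)] 0] fun z => ‖z‖ ^ N :=
    fun f hf => by simpa only [one_mul] using h1.mul hf
  refine h6 _ ((IsBigO.of_bound K ?_).trans h3)
  · filter_upwards [self_mem_nhdsWithin, nhdsWithin_le_nhds hsmall] with z hz hz2
    have hre := re_cpow_half_pos (sector_subset_slitPlane hδ hz)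
    rw [Real.norm_of_nonneg (by positivity)]
    refine h (s z) hz2.le _ ?_ ?_
    · rw [mul_comm, Complex.im_ofReal_mul, Complex.re_ofReal_mul, abs_mul, abs_of_pos hβ₀,
        mul_left_comm]
      exact mul_le_mul_of_nonneg_left (abs_im_cpow_half_le hδ hδπ hz) hβ₀.le
    · rw [mul_comm, Complex.re_ofReal_mul]
      positivity

/-! ### Rotating equilibrium: expansions -/

lemma integrand_eq (X : Coeff) (S ω : ℂ) : integrand X S ω = fun x : ℝ =>
    num S ω x X / den S ω x ^ 3 - poleFour X ω S / (x : ℂ) ^ 4 - poleTwo X ω S / (x : ℂ) ^ 2 := by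
  ext x
  rw [integrand, polePart_eq, sub_sub]

lemma integral_integrand (X : Coeff) (S : ℂ) (ω : ℝ) : ∫ x in Ioi (0 : ℝ), integrand X S ω x =
    regularIntegral ω (fun S x => num S ω x X) (poleFour X ω) (poleTwo X ω) S := by
  rw [regularIntegral, integrand_eq]

/-- Here the stated distillates enter: `ζ(4)` and `ζ(2)` times the pole coefficients, minus half the
constant term, times the prefactor. -/
lemma distCoeff_eq (X : Coeff) {S ω h b : ℂ} (hω : ω ≠ 0) (hb : b ≠ 0) (hh : h ≠ 0)
    (hk : 1 - S * ω ^ 2 ≠ 0) (hS : 1 - S ≠ 0) :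
    distCoeff (π : ℂ) S ω (h ^ 2) b X = pref S ω h X *
      (poleFour X ω S * (π ^ 4 / 90) / (h * b) ^ 4 + poleTwo X ω S * (π ^ 2 / 6) / (h * b) ^ 2 -
        constTerm X ω S / 2) := by
  have hπ : (π : ℂ) ≠ 0 := Complex.ofReal_ne_zero.2 pi_ne_zero
  cases X <;> simp only [distCoeff, pref, poleFour, poleTwo, constTerm] <;> field_simp <;> ring

lemma paramS_zero (r s : ℂ) : paramS 0 r s = 0 := by simp [paramS]

lemma analyticAt_paramS (r s : ℂ) : AnalyticAt ℂ (fun z => paramS z r s) 0 := by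
  unfold paramS
  fun_prop (disch := simp)

lemma tendsto_ofReal_nhdsGT : Tendsto (fun t : ℝ => (t : ℂ)) (𝓝[>] 0) (𝓝 0) := by
  have := Complex.continuous_ofReal.tendsto 0
  rw [Complex.ofReal_zero] at this
  exact this.mono_left nhdsWithin_le_nhds

lemma eventually_norm_paramS_lt_one (r s : ℂ) : ∀ᶠ z in 𝓝 (0 : ℂ), ‖paramS z r s‖ < 1 :=
  (analyticAt_paramS r s).continuousAt.norm.eventually_lt_const (by simp [paramS_zero])

lemma one_sub_ne_zero_of_norm_lt {S : ℂ} (hS : ‖S‖ < 1) : 1 - S ≠ 0 := by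
  intro h
  rw [← sub_eq_zero.1 h, norm_one] at hS
  exact lt_irrefl _ hS

lemma domain_subset_slitPlane (ω₀ β₀ r θ : ℝ) : domain ω₀ β₀ r θ ⊆ Complex.slitPlane :=
  fun _ hz => hz.1

lemma eventually_ofReal_mem_domain {ω₀ β₀ : ℝ} (hω : |ω₀| < 1) (hβ₀ : 0 < β₀) (r θ : ℝ) :
    ∀ᶠ t : ℝ in 𝓝[>] 0, (t : ℂ) ∈ domain ω₀ β₀ r θ := by
  filter_upwards [tendsto_ofReal_nhdsGT.eventually
    (eventually_norm_paramS_lt_one (r : ℂ) (sin θ : ℂ)), self_mem_nhdsWithin] with t ht ht0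
  have ht0 : 0 < t := ht0
  refine ⟨Or.inl (by simpa using ht0), one_sub_ne_zero_of_norm_lt ht,
    one_sub_mul_sq_ne_zero ht hω, fun n => ?_⟩
  have e : ((n : ℂ) + 1) * ((t : ℂ) ^ (1 / 2 : ℂ) * β₀) =
      (((n + 1) * (t ^ (1 / 2 : ℝ) * β₀) : ℝ) : ℂ) := by
    push_cast
    rw [Complex.ofReal_cpow ht0.le]
    push_cast; rfl
  rw [e]
  exact den_ofReal_ne_zero hω ht (by positivity)

/-- The prefactor `pref`, divided by `κ ^ 2`, as a function of `z = κ ^ 2`. -/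
noncomputable def reducedPref (S ω z : ℂ) : Coeff → ℂ
  | .rho => z / (12 * π ^ 2 * (1 - S * ω ^ 2))
  | .p => z / (24 * π ^ 2 * (1 - S * ω ^ 2))
  | .A => (1 - S * ω ^ 2) / (6 * π ^ 2 * (1 - S) * ω ^ 4)
  | .W => (1 - S * ω ^ 2) / (6 * π ^ 2 * (1 - S) * ω ^ 2)
  | .G => (1 - S * ω ^ 2) / (6 * π ^ 2 * (1 - S) * ω ^ 3)

/-- Evenness of the prefactor in `κ` makes the integral term odd. The extracted `κ²` cancels its
denominator `κ` and leaves one power of `√z`. -/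
lemma pref_eq (X : Coeff) (S ω κ : ℂ) :
    pref S ω κ X = κ ^ 2 * reducedPref S ω (κ ^ 2) X := by
  cases X <;> simp only [pref, reducedPref] <;> ring

lemma analyticAt_reducedPref (X : Coeff) {ω : ℂ} (hω : ω ≠ 0) (r s : ℂ) :
    AnalyticAt ℂ (fun z => reducedPref (paramS z r s) ω z X) 0 := by
  have h := analyticAt_paramS r s
  cases X <;> simp only [reducedPref] <;> fun_prop (disch := simp [paramS_zero, hω, pi_ne_zero])

lemma analyticAt_distCoeff (X : Coeff) {ω b : ℂ} (hω : ω ≠ 0) (hb : b ≠ 0) (r s : ℂ) :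
    AnalyticAt ℂ (fun z => distCoeff (π : ℂ) (paramS z r s) ω z b X) 0 := by
  have h := analyticAt_paramS r s
  cases X <;> simp only [distCoeff] <;> fun_prop (disch := simp [paramS_zero, hω, hb, pi_ne_zero])

section Rotating

variable (X : Coeff) {ω₀ β₀ : ℝ} (r θ : ℝ)

/-- The uniform expansion is evaluated at the moving parameter `S = paramS z r (sin θ)`, which tends
to `0` with `z`. -/
lemma scalarFun_isBigO {δ : ℝ} (hδ : 0 < δ) (hδπ : δ < π) (N : ℕ) (h0 : ω₀ ≠ 0) (hω : |ω₀| < 1)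
    (hβ₀ : 0 < β₀) :
    (fun z : ℂ => scalarFun X ω₀ β₀ r θ (z ^ (1 / 2 : ℂ))
      - distCoeff (π : ℂ) (paramS z (r : ℂ) (sin θ : ℂ)) ω₀ z β₀ X
      - integralTerm X ω₀ β₀ r θ (z ^ (1 / 2 : ℂ)))
      =O[𝓝[sector 0 (-(π - δ)) (π - δ)] 0] fun z => ‖z‖ ^ N := by
  have h1 : (fun z => z * reducedPref (paramS z r (sin θ)) ω₀ z X) =O[𝓝 0] fun _ => (1 : ℝ) :=
    (continuousAt_id.mul (analyticAt_reducedPref X (Complex.ofReal_ne_zero.2 h0) r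
      (sin θ)).continuousAt).isBigO_one ℝ
  have h2 := (numerator_num X hω).isBigO_sub hω hβ₀
    (analyticAt_paramS (r : ℂ) (sin θ : ℂ)).continuousAt (paramS_zero _ _) h1 hδ hδπ N
  refine h2.congr' ?_ EventuallyEq.rfl
  filter_upwards [self_mem_nhdsWithin,
    nhdsWithin_le_nhds (eventually_norm_paramS_lt_one (r : ℂ) (sin θ : ℂ))] with z hz hS
  have hz0 : z ^ (1 / 2 : ℂ) ≠ 0 := by
    intro h
    have := cpow_half_sq z
    rw [h] at this
    exact hz.1 (by rw [← this]; ring)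
  have h3 := distCoeff_eq X (S := paramS z r (sin θ)) (ω := ω₀) (h := z ^ (1 / 2 : ℂ)) (b := β₀)
    (Complex.ofReal_ne_zero.2 h0) (Complex.ofReal_ne_zero.2 hβ₀.ne') hz0
    (one_sub_mul_sq_ne_zero hS hω) (one_sub_ne_zero_of_norm_lt hS)
  rw [cpow_half_sq] at h3
  rw [h3, scalarFun, integralTerm]
  simp only [cpow_half_sq, integral_integrand, seriesTerm, pref_eq]
  ring

/-- This form shows the integral term as `√z` times a function analytic at `0`, hence without
integer powers. -/
lemma integralTerm_eq {z : ℂ} (hz : z ≠ 0) (hβ₀ : 0 < β₀) :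
    integralTerm X ω₀ β₀ r θ (z ^ (1 / 2 : ℂ)) = z ^ (1 / 2 : ℂ) *
      (reducedPref (paramS z r (sin θ)) ω₀ z X *
        (regularIntegral ω₀ (fun S x => num S ω₀ x X) (poleFour X ω₀) (poleTwo X ω₀)
          (paramS z r (sin θ)) / β₀)) := by
  have hz0 : z ^ (1 / 2 : ℂ) ≠ 0 := by
    intro h
    have := cpow_half_sq z
    rw [h] at this
    exact hz (by rw [← this]; ring)
  have hb : (β₀ : ℂ) ≠ 0 := Complex.ofReal_ne_zero.2 hβ₀.ne'
  rw [integralTerm, pref_eq, integral_integrand]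
  simp only [cpow_half_sq]
  nth_rewrite 1 [← cpow_half_sq z]
  field_simp

lemma analyticAt_integralTerm (h0 : ω₀ ≠ 0) (hω : |ω₀| < 1) :
    AnalyticAt ℂ (fun z => reducedPref (paramS z r (sin θ)) ω₀ z X *
        (regularIntegral ω₀ (fun S x => num S ω₀ x X) (poleFour X ω₀) (poleTwo X ω₀)
          (paramS z r (sin θ)) / β₀)) 0 := by
  refine (analyticAt_reducedPref X (Complex.ofReal_ne_zero.2 h0) _ _).mul ?_
  have h1 := (numerator_num X hω).analyticAt_regularIntegral hω
  exact (h1.fun_comp_of_eq (analyticAt_paramS (r : ℂ) (sin θ : ℂ)) (paramS_zero _ _)).div_const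

theorem isDistillate_scalarFun (h0 : ω₀ ≠ 0) (hω : |ω₀| < 1) (hβ₀ : 0 < β₀) :
    IsDistillate (domain ω₀ β₀ r θ) 0 (fun z => scalarFun X ω₀ β₀ r θ (z ^ (1 / 2 : ℂ)))
      (fun z => distCoeff (π : ℂ) (paramS z (r : ℂ) (sin θ : ℂ)) ω₀ z β₀ X) := by
  refine isDistillate_of_isBigO (domain_subset_slitPlane _ _ _ _)
    (eventually_ofReal_mem_domain hω hβ₀ r θ)
    (analyticAt_distCoeff X (Complex.ofReal_ne_zero.2 h0) (Complex.ofReal_ne_zero.2 hβ₀.ne') _ _)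
    (analyticAt_integralTerm X (β₀ := β₀) r θ h0 hω) fun δ hδ hδπ N => ?_
  refine (scalarFun_isBigO X r θ hδ hδπ N h0 hω hβ₀).congr' ?_ EventuallyEq.rfl
  filter_upwards [self_mem_nhdsWithin] with z hz
  rw [integralTerm_eq X r θ hz.1 hβ₀]

/-- The analytic part is zero and the half-integer part is exact, so the remainder vanishes
identically on each sector. -/
theorem isDistillate_integralTerm (h0 : ω₀ ≠ 0) (hω : |ω₀| < 1) (hβ₀ : 0 < β₀) :
    IsDistillate (domain ω₀ β₀ r θ) 0 (fun z => integralTerm X ω₀ β₀ r θ (z ^ (1 / 2 : ℂ)))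
      (fun _ => 0) := by
  refine isDistillate_of_isBigO (domain_subset_slitPlane _ _ _ _)
    (eventually_ofReal_mem_domain hω hβ₀ r θ) analyticAt_const
    (analyticAt_integralTerm X (β₀ := β₀) r θ h0 hω) fun δ hδ hδπ N => ?_
  refine (isBigO_zero (E' := ℂ) _ _).congr' ?_ EventuallyEq.rfl
  filter_upwards [self_mem_nhdsWithin] with z hz
  rw [integralTerm_eq X r θ hz.1 hβ₀]
  ring

lemma integralTerm_neg (κ : ℂ) : integralTerm X ω₀ β₀ r θ (-κ) = -integralTerm X ω₀ β₀ r θ κ := by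
  have h : ∀ S : ℂ, pref S ω₀ (-κ) X = pref S ω₀ κ X := fun S => by
    rw [pref_eq, pref_eq, neg_sq]
  rw [integralTerm, integralTerm, neg_sq, h, neg_mul, div_neg, mul_neg]

lemma summable_seriesTerm (hω : |ω₀| < 1) (hβ₀ : 0 < β₀) {z : ℂ} (hz : z ∈ Complex.slitPlane) :
    Summable (seriesTerm X ω₀ β₀ r θ (z ^ (1 / 2 : ℂ))) := by
  refine (numerator_num X hω).summable_quotient hω _ ?_
  rw [mul_comm, Complex.re_ofReal_mul]
  exact mul_pos hβ₀ (re_cpow_half_pos hz)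

lemma integrableOn_integrand (hω : |ω₀| < 1) {S : ℂ} (hS : ‖S‖ < 1) :
    IntegrableOn (integrand X S ω₀) (Ioi 0) := by
  rw [integrand_eq]
  exact (numerator_num X hω).integrableOn_regular hω hS

end Rotating

/-! ### Equilibrium at rest: expansions -/

/-- At `ω = 0` the denominator is `-2 sinh² (x / 2)` for every `S`. Multiplying numerator and
denominator by `sinh² (x / 2)` brings the rest series to the cubic form of the rotating one. -/
lemma numerator_rest : Numerator 0
    (fun _ x => -4 * (2 + Complex.cosh x) * (Complex.cosh x - 1))
    (fun _ => 48) (fun _ => 0) (fun _ => 1 / 15) := by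
  refine Numerator.of_sum_cosh (ι := Fin 2) (fun i _ => (![-4, -2] : Fin 2 → ℂ) i) ![1, 2] ?_ ?_ ?_
    (differentiableOn_const _) (differentiableOn_const _) ?_ ?_ ?_
  · intro i
    fun_prop
  · intro i
    fin_cases i <;> simp
  · intro S x
    have h : Complex.cosh (2 * x) = 2 * Complex.cosh x ^ 2 - 1 := by
      rw [Complex.cosh_two_mul, Complex.sinh_sq]; ring
    simp [h]
    ring
  all_goals
    intro S _
    simp
    norm_num

lemma rest_quotient_eq (S x : ℂ) :
    -4 * (2 + Complex.cosh x) * (Complex.cosh x - 1) / den S (0 : ℝ) x ^ 3 =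
      (2 + Complex.cosh x) / Complex.sinh (x / 2) ^ 4 := by
  have h1 := Complex.cosh_two_mul (x / 2)
  rw [mul_div_cancel₀ _ two_ne_zero, Complex.cosh_sq] at h1
  have h2 : den S (0 : ℝ) x = -(2 * Complex.sinh (x / 2) ^ 2) := by
    rw [den_eq]; simp
  have h3 : Complex.cosh x - 1 = 2 * Complex.sinh (x / 2) ^ 2 := by rw [h1]; ring
  rw [h2, h3]
  -- Both sides are then `0` by the convention for division by zero.
  by_cases h : Complex.sinh (x / 2) = 0
  · simp [h]
  · field_simp
    norm_num

lemma rest_term_eq (κ : ℂ) (β₀ : ℝ) (k : ℕ) :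
    (2 + Complex.cosh ((k + 1) * κ * β₀)) / Complex.sinh ((k + 1) * κ * β₀ / 2) ^ 4 =
      -4 * (2 + Complex.cosh ((k + 1) * (κ * β₀))) * (Complex.cosh ((k + 1) * (κ * β₀)) - 1) /
        den 0 (0 : ℝ) ((k + 1) * (κ * β₀)) ^ 3 := by
  rw [rest_quotient_eq, mul_assoc]

lemma summable_rest {β₀ : ℝ} (hβ₀ : 0 < β₀) {z : ℂ} (hz : z ∈ Complex.slitPlane) :
    Summable fun k : ℕ => (2 + Complex.cosh ((k + 1) * z ^ (1 / 2 : ℂ) * β₀)) /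
      Complex.sinh ((k + 1) * z ^ (1 / 2 : ℂ) * β₀ / 2) ^ 4 := by
  simp only [rest_term_eq]
  refine numerator_rest.summable_quotient (by simp) 0 ?_
  rw [mul_comm, Complex.re_ofReal_mul]
  exact mul_pos hβ₀ (re_cpow_half_pos hz)

lemma ofReal_restIntegrand (x : ℝ) : ((restIntegrand x : ℝ) : ℂ) =
    -4 * (2 + Complex.cosh x) * (Complex.cosh x - 1) / den 0 (0 : ℝ) x ^ 3 - 48 / (x : ℂ) ^ 4 -
      0 / (x : ℂ) ^ 2 := by
  rw [rest_quotient_eq, restIntegrand]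
  push_cast
  simp

lemma integrableOn_restIntegrand : IntegrableOn restIntegrand (Ioi 0) := by
  have h := numerator_rest.integrableOn_regular (by simp) (S := 0) (by simp)
  simp only [← ofReal_restIntegrand] at h
  have h' := h.re
  simp only [RCLike.re_to_complex, Complex.ofReal_re] at h'
  exact h'

/-! ### Vanishing of the integral term at rest. -/

lemma hasEvenJet_sinh : HasEvenJet (fun x => Complex.sinh x / x) 1 (1 / 6) (1 / 120) := by
  have h1 := Complex.exp_sub_sum_range_isBigO_pow 7
  have h2 := h1.comp_tendsto (show Tendsto (fun y : ℂ => -y) (𝓝 0) (𝓝 0) by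
    simpa using (continuous_neg (G := ℂ)).tendsto 0)
  have h3 : (fun y : ℂ => ((fun x : ℂ => x ^ 7) ∘ fun y => -y) y) =O[𝓝 0] fun y : ℂ => y ^ 7 := by
    exact IsBigO.of_bound 1 (Eventually.of_forall fun y => by simp)
  have h4 := (((h1.sub (h2.trans h3)).const_mul_left (1 / 2)).mono
    (nhdsWithin_le_nhds (s := {(0 : ℂ)}ᶜ))).mul (isBigO_refl (fun x : ℂ => x⁻¹) (𝓝[≠] 0))
  refine h4.congr' ?_ ?_
  · filter_upwards [self_mem_nhdsWithin] with x hx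
    have hx : x ≠ 0 := hx
    simp only [Function.comp_apply, Finset.sum_range_succ, Finset.sum_range_zero, Nat.factorial,
      Complex.sinh]
    push_cast
    field_simp
    ring
  · filter_upwards [self_mem_nhdsWithin] with x hx
    have hx : x ≠ 0 := hx
    field_simp

lemma hasEvenJet_cosh_self : HasEvenJet Complex.cosh 1 (1 / 2) (1 / 24) := by
  have h1 := isBigO_cosh_sub.mono (nhdsWithin_le_nhds (s := {(0 : ℂ)}ᶜ))
  have h2 : (fun x : ℂ => x ^ 8) =O[𝓝[≠] 0] fun x => x ^ 6 :=
    ((isLittleO_pow_pow (𝕜 := ℂ) (show 6 < 8 by norm_num)).isBigO).mono nhdsWithin_le_nhds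
  have h3 := (h1.trans h2).add ((isBigO_refl (fun x : ℂ => x ^ 6) (𝓝[≠] 0)).const_mul_left (1 / 720))
  refine h3.congr_left fun x => ?_
  ring

/-- Both `cosh y` and `(sinh y / y)³` begin with `1 + y² / 2`, so their difference is `o(y³)`, and
dividing by `sinh³ y` leaves something that tends to zero. This is the boundary value of the
primitive at `0`. -/
lemma tendsto_cosh_div_sinh_cube : Tendsto
    (fun y : ℂ => Complex.cosh y / Complex.sinh y ^ 3 - 1 / y ^ 3) (𝓝[≠] 0) (𝓝 0) := by
  have h1 := hasEvenJet_cosh_self.add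
    ((hasEvenJet_sinh.mul (hasEvenJet_sinh.mul hasEvenJet_sinh)).const_mul (-1))
  have h2 : (fun y : ℂ => Complex.cosh y - (Complex.sinh y / y) ^ 3) =o[𝓝[≠] 0] fun y => y ^ 3 := by
    have h3 : (fun x : ℂ => x ^ 6) =o[𝓝[≠] 0] fun x => x ^ 3 :=
      (isLittleO_pow_pow (𝕜 := ℂ) (by norm_num)).mono nhdsWithin_le_nhds
    have h4 : (fun x : ℂ => x ^ 4) =o[𝓝[≠] 0] fun x => x ^ 3 :=
      (isLittleO_pow_pow (𝕜 := ℂ) (by norm_num)).mono nhdsWithin_le_nhds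
    have h5 := (IsBigO.trans_isLittleO h1 h3).add (h4.const_mul_left
      (1 / 24 + -1 * (1 * (1 * (1 / 120) + 1 / 6 * (1 / 6) + 1 / 120 * 1) +
        1 / 6 * (1 * (1 / 6) + 1 / 6 * 1) + 1 / 120 * (1 * 1))))
    refine h5.congr_left fun x => ?_
    ring
  have h3 := tendsto_sinh_div 1
  have h4 := h2.tendsto_div_nhds_zero.div (h3.pow 3) (by simp)
  simp only [one_mul, one_pow, zero_div] at h4
  refine h4.congr' ?_
  filter_upwards [self_mem_nhdsWithin, h3.eventually_ne one_ne_zero] with y hy hs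
  have hy : y ≠ 0 := hy
  have hs' : Complex.sinh y ≠ 0 := fun h => hs (by simp [h])
  simp only [Pi.div_apply]
  field_simp

/-- An antiderivative of `restIntegrand`. -/
noncomputable def restPrimitive (x : ℝ) : ℝ :=
  -2 * (cosh (x / 2) / sinh (x / 2) ^ 3 - 1 / (x / 2) ^ 3)

lemma hasDerivAt_restPrimitive {x : ℝ} (hx : 0 < x) :
    HasDerivAt restPrimitive (restIntegrand x) x := by
  have hs : sinh (x / 2) ≠ 0 := (sinh_pos_iff.2 (by positivity)).ne'
  have h0 : HasDerivAt (fun x : ℝ => x / 2) (1 / 2) x := (hasDerivAt_id x).div_const 2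
  have h1 := ((h0.cosh.div (h0.sinh.pow 3) (pow_ne_zero 3 hs)).sub
    ((hasDerivAt_const x (1 : ℝ)).div (h0.pow 3) (pow_ne_zero 3 (show x / 2 ≠ 0 by positivity)))).const_mul (-2)
  refine HasDerivAt.congr_deriv (f := restPrimitive) h1 ?_
  have h2 := cosh_two_mul (x / 2)
  rw [mul_div_cancel₀ _ two_ne_zero] at h2
  have h3 : cosh (x / 2) ^ 2 = sinh (x / 2) ^ 2 + 1 := cosh_sq _
  simp only [restIntegrand, Pi.pow_apply, h2, h3]
  field_simp
  linear_combination 3 * x ^ 6 * sinh (x / 2) ^ 2 * h3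

lemma integral_restIntegrand : ∫ x in Ioi (0 : ℝ), restIntegrand x = 0 := by
  have hcont : ContinuousWithinAt restPrimitive (Ici 0) 0 := by
    rw [← continuousWithinAt_Ioi_iff_Ici]
    have h1 : Tendsto (fun x : ℝ => ((x / 2 : ℝ) : ℂ)) (𝓝[>] 0) (𝓝[≠] 0) := by
      refine tendsto_nhdsWithin_iff.2 ⟨?_, ?_⟩
      · have : Continuous fun x : ℝ => ((x / 2 : ℝ) : ℂ) := by fun_prop
        have := this.tendsto 0
        simp only [zero_div, Complex.ofReal_zero] at this
        exact this.mono_left nhdsWithin_le_nhds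
      · filter_upwards [self_mem_nhdsWithin] with x hx
        have hx : 0 < x := hx
        exact Complex.ofReal_ne_zero.2 (by positivity)
    have h2 := (Complex.continuous_re.tendsto 0).comp (tendsto_cosh_div_sinh_cube.comp h1)
    have h3 := h2.const_mul (-2)
    -- Division by zero assigns the primitive the value `0` at the origin, which is its limit from
    -- the right.
    have h4 : restPrimitive 0 = -2 * (0 : ℂ).re := by simp [restPrimitive]
    rw [ContinuousWithinAt, h4]
    refine h3.congr fun x => ?_
    simp only [Function.comp_apply, restPrimitive]
    congr 1
    rw [← Complex.ofReal_cosh, ← Complex.ofReal_sinh]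
    norm_cast
  have hlim : Tendsto restPrimitive atTop (𝓝 0) := by
    have hy : Tendsto (fun x : ℝ => x / 2) atTop atTop := tendsto_id.atTop_div_const two_pos
    have h1 : Tendsto (fun y : ℝ => 1 / y ^ 3) atTop (𝓝 0) := by
      simpa using tendsto_pow_neg_atTop (𝕜 := ℝ) (n := 3) (by norm_num)
    have h2 : Tendsto (fun y : ℝ => cosh y / sinh y ^ 3) atTop (𝓝 0) := by
      refine squeeze_zero' (g := fun y : ℝ => 2 * (1 / y ^ 2)) ?_ ?_ ?_
      · filter_upwards [eventually_gt_atTop 0] with y hy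
        have := sinh_pos_iff.2 hy
        have := cosh_pos y
        positivity
      · filter_upwards [eventually_ge_atTop 1] with y hy
        have hs : 0 < sinh y := sinh_pos_iff.2 (by linarith)
        have h3 : y ≤ sinh y := self_le_sinh_iff.2 (by linarith)
        have h4 : cosh y ≤ 2 * sinh y := by
          have e1 := add_one_le_exp y
          have e2 : rexp y * rexp (-y) = 1 := by rw [← exp_add]; simp
          have e3 := exp_pos (-y)
          rw [cosh_eq, sinh_eq]
          nlinarith
        calc cosh y / sinh y ^ 3 ≤ 2 * sinh y / sinh y ^ 3 := by gcongr
          _ = 2 * (1 / sinh y ^ 2) := by field_simp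
          _ ≤ 2 * (1 / y ^ 2) := by gcongr
      · have := (tendsto_pow_neg_atTop (𝕜 := ℝ) (n := 2) (by norm_num)).const_mul 2
        simpa using this
    have h3 := ((h2.sub h1).comp hy).const_mul (-2)
    show Tendsto (fun x => -2 * (cosh (x / 2) / sinh (x / 2) ^ 3 - 1 / (x / 2) ^ 3)) atTop (𝓝 0)
    simpa using h3
  have h := integral_Ioi_of_hasDerivAt_of_tendsto hcont
    (fun x hx => hasDerivAt_restPrimitive hx) integrableOn_restIntegrand hlim
  rw [h]
  simp [restPrimitive]

lemma regularIntegral_rest : regularIntegral 0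
    (fun _ x => -4 * (2 + Complex.cosh x) * (Complex.cosh x - 1)) (fun _ => 48) (fun _ => 0) 0 = 0 := by
  simp only [regularIntegral, ← ofReal_restIntegrand]
  rw [integral_complex_ofReal, integral_restIntegrand, Complex.ofReal_zero]

lemma restDensity_isBigO {β₀ : ℝ} (hβ₀ : 0 < β₀) {δ : ℝ} (hδ : 0 < δ) (hδπ : δ < π) (N : ℕ) :
    (fun z : ℂ => restDensity β₀ (z ^ (1 / 2 : ℂ)) -
      (π ^ 2 / (30 * β₀ ^ 4) - z ^ 2 / (480 * π ^ 2)))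
      =O[𝓝[sector 0 (-(π - δ)) (π - δ)] 0] fun z => ‖z‖ ^ N := by
  have hP : (fun z : ℂ => z ^ 2 / (16 * (π : ℂ) ^ 2)) =O[𝓝 0] fun _ => (1 : ℝ) :=
    (Continuous.continuousAt (by fun_prop)).isBigO_one ℝ
  have h := numerator_rest.isBigO_sub (by simp) hβ₀ (s := fun _ => 0) continuousAt_const rfl hP
    hδ hδπ N
  refine h.congr' ?_ EventuallyEq.rfl
  filter_upwards [self_mem_nhdsWithin] with z hz
  have hz0 : z ≠ 0 := hz.1
  have hπ : (π : ℂ) ≠ 0 := Complex.ofReal_ne_zero.2 pi_ne_zero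
  have hb : (β₀ : ℂ) ≠ 0 := Complex.ofReal_ne_zero.2 hβ₀.ne'
  have h4 : (z ^ (1 / 2 : ℂ)) ^ 4 = z ^ 2 := by
    rw [show 4 = 2 * 2 by norm_num, pow_mul, cpow_half_sq]
  rw [restDensity, regularIntegral_rest]
  simp only [rest_term_eq, mul_pow, h4]
  generalize (∑' k : ℕ, _ : ℂ) = T
  field_simp
  ring

/-- Multiplication by a factor analytic at `0` preserves this expansion. The weight `w = 1` serves
the density, and the metric components serve the tensor. -/
theorem isDistillate_restDensity {β₀ : ℝ} (hβ₀ : 0 < β₀) {w : ℂ → ℂ} (hw : AnalyticAt ℂ w 0) :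
    IsDistillate Complex.slitPlane 0 (fun z => restDensity β₀ (z ^ (1 / 2 : ℂ)) * w z)
      (fun z => (π ^ 2 / (30 * β₀ ^ 4) - z ^ 2 / (480 * π ^ 2)) * w z) := by
  refine isDistillate_of_isBigO (B := fun _ => 0) subset_rfl ?_ ?_ analyticAt_const ?_
  · filter_upwards [self_mem_nhdsWithin] with t ht
    exact Or.inl (by simpa using ht)
  · refine AnalyticAt.mul ?_ hw
    fun_prop (disch := simp [pi_ne_zero])
  · intro δ hδ hδπ N
    have hw1 : w =O[𝓝[sector 0 (-(π - δ)) (π - δ)] 0] fun _ => (1 : ℝ) :=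
      (hw.continuousAt.isBigO_one ℝ).mono nhdsWithin_le_nhds
    have h := (restDensity_isBigO hβ₀ hδ hδπ N).mul hw1
    simp only [mul_one] at h
    refine h.congr_left fun z => ?_
    ring

lemma analyticAt_complexMetric (r θ : ℝ) (μ ν : Fin 4) :
    AnalyticAt ℂ (fun z => complexMetric z r θ μ ν) 0 := by
  unfold complexMetric
  by_cases h : μ = ν
  · subst h
    simp only [Matrix.diagonal_apply_eq]
    fin_cases μ <;> simp [metricDiag] <;> fun_prop (disch := simp)
  · simp only [Matrix.diagonal_apply_ne _ h]
    exact analyticAt_const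

/-! ### Tensor calculus for functions of `r` and `θ` -/

lemma pd_congr {F G : (Fin 4 → ℝ) → ℝ} {x : Fin 4 → ℝ} (h : F =ᶠ[𝓝 x] G) (i : Fin 4) :
    pd i F x = pd i G x := by
  exact h.lineDeriv_eq

lemma pd_zero_of_two (Φ : ℝ → ℝ → ℝ) (x : Fin 4 → ℝ) : pd 0 (fun y => Φ (y 1) (y 2)) x = 0 := by
  simp [pd, lineDeriv]

lemma pd_three_of_two (Φ : ℝ → ℝ → ℝ) (x : Fin 4 → ℝ) : pd 3 (fun y => Φ (y 1) (y 2)) x = 0 := by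
  simp [pd, lineDeriv]

lemma pd_one_of_two {Φ : ℝ → ℝ → ℝ} {x : Fin 4 → ℝ} {d : ℝ}
    (h : HasDerivAt (fun r => Φ r (x 2)) d (x 1)) : pd 1 (fun y => Φ (y 1) (y 2)) x = d := by
  have h1 : HasDerivAt (fun t : ℝ => x 1 + t) 1 0 := by
    simpa using (hasDerivAt_id (0 : ℝ)).const_add (x 1)
  have h2 := HasDerivAt.comp (h₂ := fun r => Φ r (x 2)) (0 : ℝ) (by simpa using h) h1
  simpa [pd, lineDeriv, Function.comp_def] using h2.deriv

lemma pd_two_of_two {Φ : ℝ → ℝ → ℝ} {x : Fin 4 → ℝ} {d : ℝ}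
    (h : HasDerivAt (fun θ => Φ (x 1) θ) d (x 2)) : pd 2 (fun y => Φ (y 1) (y 2)) x = d := by
  have h1 : HasDerivAt (fun t : ℝ => x 2 + t) 1 0 := by
    simpa using (hasDerivAt_id (0 : ℝ)).const_add (x 2)
  have h2 := HasDerivAt.comp (h₂ := fun θ => Φ (x 1) θ) (0 : ℝ) (by simpa using h) h1
  simpa [pd, lineDeriv, Function.comp_def] using h2.deriv

lemma pd_of_two {Φ : ℝ → ℝ → ℝ} {x : Fin 4 → ℝ} {d₁ d₂ : ℝ}
    (h₁ : HasDerivAt (fun r => Φ r (x 2)) d₁ (x 1)) (h₂ : HasDerivAt (fun θ => Φ (x 1) θ) d₂ (x 2))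
    (i : Fin 4) : pd i (fun y => Φ (y 1) (y 2)) x = ![0, d₁, d₂, 0] i := by
  fin_cases i
  · exact pd_zero_of_two Φ x
  · exact pd_one_of_two h₁
  · exact pd_two_of_two h₂
  · exact pd_three_of_two Φ x

lemma isOpen_chart : IsOpen chart := by
  have h1 : IsOpen {x : Fin 4 → ℝ | 0 < x 1} := isOpen_lt (by fun_prop) (by fun_prop)
  have h2 : IsOpen {x : Fin 4 → ℝ | 0 < x 2} := isOpen_lt (by fun_prop) (by fun_prop)
  have h3 : IsOpen {x : Fin 4 → ℝ | x 2 < π} := isOpen_lt (by fun_prop) (by fun_prop)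
  exact h1.inter (h2.inter h3)

/-- The conformal factor `1 + κ² r² / 4`. -/
noncomputable def conf (κ r : ℝ) : ℝ := 1 + κ ^ 2 * r ^ 2 / 4

lemma conf_pos (κ r : ℝ) : 0 < conf κ r := by unfold conf; positivity

lemma hasDerivAt_conf (κ r : ℝ) : HasDerivAt (conf κ) (κ ^ 2 * r / 2) r := by
  have h := ((((hasDerivAt_id r).pow 2).const_mul (κ ^ 2)).div_const 4).const_add 1
  refine HasDerivAt.congr_deriv (f := conf κ) h ?_
  simp only [id]
  norm_num
  ring

/-- The derivatives `∂_i g_{j j}`. -/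
noncomputable def dMetric (κ : ℝ) (x : Fin 4 → ℝ) : Matrix (Fin 4) (Fin 4) ℝ :=
  !![0, 0, 0, 0;
    0, κ ^ 2 * x 1 / conf κ (x 1) ^ 3, -2 * x 1 * (2 - conf κ (x 1)) / conf κ (x 1) ^ 3,
      -2 * x 1 * sin (x 2) ^ 2 * (2 - conf κ (x 1)) / conf κ (x 1) ^ 3;
    0, 0, 0, -2 * x 1 ^ 2 * sin (x 2) * cos (x 2) / conf κ (x 1) ^ 2;
    0, 0, 0, 0]

lemma pd_metricDiag (κ : ℝ) (x : Fin 4 → ℝ) (i j : Fin 4) :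
    pd i (fun y => metricDiag (κ ^ 2) (y 1) (sin (y 2)) j) x = dMetric κ x i j := by
  have hc := conf_pos κ (x 1)
  have hh := hasDerivAt_conf κ (x 1)
  have hr := hasDerivAt_id (x 1)
  have hs := hasDerivAt_sin (x 2)
  have e : κ ^ 2 * x 1 ^ 2 = 4 * conf κ (x 1) - 4 := by unfold conf; ring
  have h₁ : HasDerivAt (fun r => -1 / conf κ r ^ 2) (κ ^ 2 * x 1 / conf κ (x 1) ^ 3) (x 1) := by
    refine ((hasDerivAt_const (x 1) (-1 : ℝ)).div (hh.pow 2) (pow_ne_zero 2 hc.ne')).congr_deriv ?_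
    simp only [Pi.pow_apply]
    field_simp
    norm_num
    ring
  have h₂ : ∀ t : ℝ, HasDerivAt (fun r => -(r ^ 2 * t) / conf κ r ^ 2)
      (-2 * x 1 * t * (2 - conf κ (x 1)) / conf κ (x 1) ^ 3) (x 1) := by
    intro t
    refine (((hr.pow 2).mul_const t).neg.div (hh.pow 2) (pow_ne_zero 2 hc.ne')).congr_deriv ?_
    simp only [Pi.pow_apply, Pi.neg_apply, id]
    field_simp
    norm_num
    linear_combination (2 * x 1 * t * conf κ (x 1)) * e
  have h₃ : HasDerivAt (fun θ => -(x 1 ^ 2 * sin θ ^ 2) / conf κ (x 1) ^ 2)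
      (-2 * x 1 ^ 2 * sin (x 2) * cos (x 2) / conf κ (x 1) ^ 2) (x 2) := by
    refine (((hs.pow 2).const_mul (x 1 ^ 2)).neg.div_const _).congr_deriv ?_
    norm_num
    ring
  have m₁ : (fun y : Fin 4 → ℝ => metricDiag (κ ^ 2) (y 1) (sin (y 2)) 1) =
      fun y => -1 / conf κ (y 1) ^ 2 := by ext y; simp [metricDiag, conf]
  have m₂ : (fun y : Fin 4 → ℝ => metricDiag (κ ^ 2) (y 1) (sin (y 2)) 2) =
      fun y => -(y 1 ^ 2 * 1) / conf κ (y 1) ^ 2 := by ext y; simp [metricDiag, conf]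
  have m₃ : (fun y : Fin 4 → ℝ => metricDiag (κ ^ 2) (y 1) (sin (y 2)) 3) =
      fun y => -(y 1 ^ 2 * sin (y 2) ^ 2) / conf κ (y 1) ^ 2 := by ext y; simp [metricDiag, conf]
  match j with
  | 0 => fin_cases i <;> simp [metricDiag, pd, lineDeriv, dMetric]
  | 1 =>
    rw [m₁]
    refine (pd_of_two (Φ := fun r _ => -1 / conf κ r ^ 2) h₁ (hasDerivAt_const _ _) i).trans ?_
    fin_cases i <;> simp [dMetric]
  | 2 =>
    rw [m₂]
    refine (pd_of_two (Φ := fun r _ => -(r ^ 2 * 1) / conf κ r ^ 2) (h₂ 1)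
      (hasDerivAt_const _ _) i).trans ?_
    fin_cases i <;> simp [dMetric]
  | 3 =>
    rw [m₃]
    refine (pd_of_two (Φ := fun r θ => -(r ^ 2 * sin θ ^ 2) / conf κ r ^ 2) (h₂ _) h₃ i).trans ?_
    fin_cases i <;> simp [dMetric]

lemma metricDiag_ne_zero (κ : ℝ) {x : Fin 4 → ℝ} (hx : x ∈ chart) (i : Fin 4) :
    metricDiag (κ ^ 2) (x 1) (sin (x 2)) i ≠ 0 := by
  obtain ⟨h1, h2, h3⟩ := hx
  have hs := sin_pos_of_pos_of_lt_pi h2 h3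
  have : 0 < 1 + κ ^ 2 * x 1 ^ 2 / 4 := by positivity
  fin_cases i <;> simp [metricDiag, this.ne', h1.ne', hs.ne']

lemma metric_inv (κ : ℝ) {x : Fin 4 → ℝ} (hx : x ∈ chart) : (metric κ x)⁻¹ =
    Matrix.diagonal fun i => (metricDiag (κ ^ 2) (x 1) (sin (x 2)) i)⁻¹ := by
  refine Matrix.inv_eq_right_inv ?_
  rw [metric, Matrix.diagonal_mul_diagonal, ← Matrix.diagonal_one]
  congr 1
  ext i
  exact mul_inv_cancel₀ (metricDiag_ne_zero κ hx i)

lemma christoffel_eq (κ : ℝ) {x : Fin 4 → ℝ} (hx : x ∈ chart) (l m n : Fin 4) :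
    christoffel (metric κ) x l m n = 1 / 2 * (metricDiag (κ ^ 2) (x 1) (sin (x 2)) l)⁻¹ *
      ((if l = n then dMetric κ x m l else 0) + (if l = m then dMetric κ x n l else 0) -
        (if m = n then dMetric κ x l m else 0)) := by
  have h : ∀ i j k : Fin 4, pd i (fun y => metric κ y j k) x =
      if j = k then dMetric κ x i j else 0 := by
    intro i j k
    simp only [metric, Matrix.diagonal_apply]
    split_ifs with hjk
    · exact pd_metricDiag κ x i j
    · simp [pd, lineDeriv]
  rw [christoffel, metric_inv κ hx, Finset.sum_eq_single l]
  · rw [Matrix.diagonal_apply_eq, h, h, h]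
    ring
  · intro s _ hs
    rw [Matrix.diagonal_apply_ne' _ hs, zero_mul]
  · simp

/-- The Christoffel symbols in closed form. -/
noncomputable def chr (κ : ℝ) (x : Fin 4 → ℝ) : Fin 4 → Matrix (Fin 4) (Fin 4) ℝ :=
  ![0,
    !![0, 0, 0, 0;
      0, -(κ ^ 2 * x 1) / (2 * conf κ (x 1)), 0, 0;
      0, 0, -(x 1 * (2 - conf κ (x 1))) / conf κ (x 1), 0;
      0, 0, 0, -(x 1 * sin (x 2) ^ 2 * (2 - conf κ (x 1))) / conf κ (x 1)],
    !![0, 0, 0, 0;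
      0, 0, (2 - conf κ (x 1)) / (x 1 * conf κ (x 1)), 0;
      0, (2 - conf κ (x 1)) / (x 1 * conf κ (x 1)), 0, 0;
      0, 0, 0, -(sin (x 2) * cos (x 2))],
    !![0, 0, 0, 0;
      0, 0, 0, (2 - conf κ (x 1)) / (x 1 * conf κ (x 1));
      0, 0, 0, cos (x 2) / sin (x 2);
      0, (2 - conf κ (x 1)) / (x 1 * conf κ (x 1)), cos (x 2) / sin (x 2), 0]]

lemma christoffel_eq_chr (κ : ℝ) {x : Fin 4 → ℝ} (hx : x ∈ chart) (l m n : Fin 4) :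
    christoffel (metric κ) x l m n = chr κ x l m n := by
  rw [christoffel_eq κ hx]
  obtain ⟨h1, h2, h3⟩ := hx
  have hs := sin_pos_of_pos_of_lt_pi h2 h3
  have hc := conf_pos κ (x 1)
  have e : (1 + κ ^ 2 * x 1 ^ 2 / 4) = conf κ (x 1) := rfl
  fin_cases l <;> fin_cases m <;> fin_cases n <;> simp [dMetric, chr, metricDiag, e] <;>
    field_simp

/-! ### Kinematics of the rotating four-velocity -/

lemma paramS_eq_conf (κ r s : ℝ) : paramS (κ ^ 2) r s = κ ^ 2 * r ^ 2 * s ^ 2 / conf κ r ^ 2 := by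
  rw [paramS, conf]
  ring

lemma paramS_nonneg (κ r s : ℝ) : 0 ≤ paramS (κ ^ 2) r s := by
  rw [paramS_eq_conf]
  positivity

lemma hasDerivAt_paramS_left (κ r s : ℝ) : HasDerivAt (fun r => paramS (κ ^ 2) r s)
    (2 * κ ^ 2 * s ^ 2 * r * (2 - conf κ r) / conf κ r ^ 3) r := by
  have hc := conf_pos κ r
  have e : κ ^ 2 * r ^ 2 = 4 * conf κ r - 4 := by unfold conf; ring
  have h := ((((hasDerivAt_id r).pow 2).const_mul (κ ^ 2)).mul_const (s ^ 2)).div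
    ((hasDerivAt_conf κ r).pow 2) (pow_ne_zero 2 hc.ne')
  refine (h.congr_deriv ?_).congr_of_eventuallyEq (.of_forall fun y => ?_)
  · simp only [Pi.pow_apply, id]
    field_simp
    norm_num
    linear_combination (-2 * s ^ 2 * r * conf κ r * κ ^ 2) * e
  · simp [paramS_eq_conf]

lemma hasDerivAt_paramS_sin (κ r θ : ℝ) : HasDerivAt (fun θ => paramS (κ ^ 2) r (sin θ))
    (2 * κ ^ 2 * r ^ 2 * sin θ * cos θ / conf κ r ^ 2) θ := by
  have h := (((hasDerivAt_sin θ).pow 2).const_mul (κ ^ 2 * r ^ 2)).div_const (conf κ r ^ 2)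
  refine (h.congr_deriv ?_).congr_of_eventuallyEq (.of_forall fun y => ?_)
  · norm_num
    ring
  · simp [paramS_eq_conf]

/-- The Lorentz factor as a function of `S`. -/
noncomputable def lorentz (ω S : ℝ) : ℝ := (√(1 - S * ω ^ 2))⁻¹

lemma velocity_eq (κ ω : ℝ) {β₀ : ℝ} (hβ₀ : 0 < β₀) (x : Fin 4 → ℝ) (m : Fin 4) :
    velocity (metric κ) (fourTemperature κ ω β₀) x m =
      lorentz ω (paramS (κ ^ 2) (x 1) (sin (x 2))) * ![1, 0, 0, κ * ω] m := by
  have h : ∑ a, ∑ b, metric κ x a b * fourTemperature κ ω β₀ x a * fourTemperature κ ω β₀ x b =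
      β₀ ^ 2 * (1 - paramS (κ ^ 2) (x 1) (sin (x 2)) * ω ^ 2) := by
    simp [Fin.sum_univ_four, metric, fourTemperature, metricDiag, paramS,
      Matrix.diagonal_apply]
    ring
  rw [velocity, h, sqrt_mul (sq_nonneg β₀), sqrt_sq hβ₀.le, lorentz]
  fin_cases m <;> simp [fourTemperature] <;> field_simp

lemma lorentz_sq {ω S : ℝ} (hk : 0 < 1 - S * ω ^ 2) : lorentz ω S ^ 2 = (1 - S * ω ^ 2)⁻¹ := by
  rw [lorentz, inv_pow, sq_sqrt hk.le]

lemma hasDerivAt_lorentz {ω : ℝ} {S : ℝ → ℝ} {t d : ℝ} (hk : 0 < 1 - S t * ω ^ 2)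
    (h : HasDerivAt S d t) : HasDerivAt (fun t => lorentz ω (S t))
      (lorentz ω (S t) * (ω ^ 2 * d / (2 * (1 - S t * ω ^ 2)))) t := by
  have h1 := (((h.mul_const (ω ^ 2)).const_sub 1).sqrt hk.ne').inv (sqrt_pos.2 hk).ne'
  refine h1.congr_deriv ?_
  rw [lorentz, sq_sqrt hk.le]
  field_simp

/-- The components `∇_m u^n` divided by the Lorentz factor. -/
noncomputable def shear (κ ω : ℝ) (x : Fin 4 → ℝ) : Matrix (Fin 4) (Fin 4) ℝ :=
  let k := 1 - paramS (κ ^ 2) (x 1) (sin (x 2)) * ω ^ 2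
  let h := conf κ (x 1)
  let dr := ω ^ 2 * (2 * κ ^ 2 * sin (x 2) ^ 2 * x 1 * (2 - h) / h ^ 3) / (2 * k)
  let dθ := ω ^ 2 * (2 * κ ^ 2 * x 1 ^ 2 * sin (x 2) * cos (x 2) / h ^ 2) / (2 * k)
  !![0, 0, 0, 0;
    dr, 0, 0, κ * ω * (dr + (2 - h) / (x 1 * h));
    dθ, 0, 0, κ * ω * (dθ + cos (x 2) / sin (x 2));
    0, -(x 1 * sin (x 2) ^ 2 * (2 - h)) / h * (κ * ω), -(sin (x 2) * cos (x 2)) * (κ * ω), 0]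

lemma covDeriv_velocity (κ : ℝ) {ω β₀ : ℝ} (hβ₀ : 0 < β₀) {x : Fin 4 → ℝ} (hx : x ∈ chart)
    (hk : 0 < 1 - paramS (κ ^ 2) (x 1) (sin (x 2)) * ω ^ 2) (m n : Fin 4) :
    covDeriv (metric κ) (velocity (metric κ) (fourTemperature κ ω β₀)) x m n =
      lorentz ω (paramS (κ ^ 2) (x 1) (sin (x 2))) * shear κ ω x m n := by
  have h1 := hasDerivAt_lorentz (S := fun r => paramS (κ ^ 2) r (sin (x 2))) hk
    (hasDerivAt_paramS_left κ (x 1) (sin (x 2)))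
  have h2 := hasDerivAt_lorentz (S := fun θ => paramS (κ ^ 2) (x 1) (sin θ)) hk
    (hasDerivAt_paramS_sin κ (x 1) (x 2))
  have hp (c : ℝ) := pd_of_two
    (Φ := fun r θ => lorentz ω (paramS (κ ^ 2) r (sin θ)) * c) (h1.mul_const c) (h2.mul_const c) m
  simp only [covDeriv, velocity_eq κ ω hβ₀, christoffel_eq_chr κ hx, hp]
  clear hp h1 h2
  fin_cases m <;> fin_cases n <;> simp [Fin.sum_univ_four, chr, shear] <;> ring

lemma acceleration_eq (κ : ℝ) {ω β₀ : ℝ} (hβ₀ : 0 < β₀) {x : Fin 4 → ℝ} (hx : x ∈ chart)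
    (hk : 0 < 1 - paramS (κ ^ 2) (x 1) (sin (x 2)) * ω ^ 2) (m : Fin 4) :
    acceleration (metric κ) (fourTemperature κ ω β₀) x m =
      ![0, -(κ ^ 2 * ω ^ 2 * x 1 * sin (x 2) ^ 2 * (2 - conf κ (x 1))) /
          (conf κ (x 1) * (1 - paramS (κ ^ 2) (x 1) (sin (x 2)) * ω ^ 2)),
        -(κ ^ 2 * ω ^ 2 * sin (x 2) * cos (x 2)) /
          (1 - paramS (κ ^ 2) (x 1) (sin (x 2)) * ω ^ 2), 0] m := by
  have hl := lorentz_sq hk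
  simp only [acceleration, covDeriv_velocity κ hβ₀ hx hk, velocity_eq κ ω hβ₀]
  have hc := conf_pos κ (x 1)
  generalize lorentz ω (paramS (κ ^ 2) (x 1) (sin (x 2))) = γ at *
  have hk' := hk.ne'
  fin_cases m <;> simp [Fin.sum_univ_four, shear]
  · generalize 1 - paramS (κ ^ 2) (x 1) (sin (x 2)) * ω ^ 2 = k at *
    rw [eq_div_iff (by positivity)]
    field_simp
    rw [hl]
    field_simp
  · generalize 1 - paramS (κ ^ 2) (x 1) (sin (x 2)) * ω ^ 2 = k at *
    rw [eq_div_iff (by positivity)]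
    linear_combination (-(κ ^ 2 * ω ^ 2 * sin (x 2) * cos (x 2) * k)) * hl -
      (κ ^ 2 * ω ^ 2 * sin (x 2) * cos (x 2)) * (inv_mul_cancel₀ hk')

/-- The Vandermonde product of the indices is alternating and equals `12` at `(0, 1, 2, 3)`. The
identity is checked over all index values. -/
lemma leviCivita_eq (m n r s : Fin 4) : leviCivita m n r s =
    (((n : ℤ) - m) * (r - m) * (s - m) * (r - n) * (s - n) * (s - r) / 12 : ℤ) := by
  have h : ∀ m n r s : Fin 4,
      Matrix.det (Matrix.of fun i j : Fin 4 => if ![m, n, r, s] i = j then (1 : ℤ) else 0) =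
        ((n : ℤ) - m) * (r - m) * (s - m) * (r - n) * (s - n) * (s - r) / 12 := by
    decide +kernel
  rw [leviCivita, h]

lemma sum_leviCivita (a : Fin 4) {u : Fin 4 → ℝ} (h₁ : u 1 = 0) (h₂ : u 2 = 0)
    (F : Fin 4 → Fin 4 → ℝ) : ∑ n, ∑ r, ∑ s, leviCivita a n r s * u n * F r s =
      ![u 3 * (F 1 2 - F 2 1), -(u 0 * (F 2 3 - F 3 2)) + u 3 * (F 2 0 - F 0 2),
        u 0 * (F 1 3 - F 3 1) + u 3 * (F 0 1 - F 1 0), -(u 0 * (F 1 2 - F 2 1))] a := by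
  simp only [leviCivita_eq]
  fin_cases a <;> simp [Fin.sum_univ_four, h₁, h₂] <;> ring

lemma sqrt_neg_det (κ : ℝ) {x : Fin 4 → ℝ} (hx : x ∈ chart) :
    √(-(metric κ x).det) = x 1 ^ 2 * sin (x 2) / conf κ (x 1) ^ 3 := by
  obtain ⟨h1, h2, h3⟩ := hx
  have hs := sin_pos_of_pos_of_lt_pi h2 h3
  have hc := conf_pos κ (x 1)
  have e : (1 + κ ^ 2 * x 1 ^ 2 / 4) = conf κ (x 1) := rfl
  have h : -(metric κ x).det = (x 1 ^ 2 * sin (x 2) / conf κ (x 1) ^ 3) ^ 2 := by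
    rw [metric, Matrix.det_diagonal]
    simp [Fin.prod_univ_four, metricDiag, e]
    field_simp
  rw [h, sqrt_sq (by positivity)]

lemma sum_volTensor (κ : ℝ) {x : Fin 4 → ℝ} (hx : x ∈ chart) (a : Fin 4) {u : Fin 4 → ℝ}
    (h₁ : u 1 = 0) (h₂ : u 2 = 0) (F : Fin 4 → Fin 4 → ℝ) :
    ∑ n, ∑ r, ∑ s, volTensor (metric κ) x a n r s * u n * F r s =
      x 1 ^ 2 * sin (x 2) / conf κ (x 1) ^ 3 *
        ![u 3 * (F 1 2 - F 2 1), -(u 0 * (F 2 3 - F 3 2)) + u 3 * (F 2 0 - F 0 2),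
          u 0 * (F 1 3 - F 3 1) + u 3 * (F 0 1 - F 1 0), -(u 0 * (F 1 2 - F 2 1))] a := by
  simp only [← sum_leviCivita a h₁ h₂, volTensor, sqrt_neg_det κ hx, Finset.mul_sum, mul_assoc]

lemma sum_metric_inv (κ : ℝ) {x : Fin 4 → ℝ} (hx : x ∈ chart) (m : Fin 4) (f : Fin 4 → ℝ) :
    ∑ a, (metric κ x)⁻¹ m a * f a = (metricDiag (κ ^ 2) (x 1) (sin (x 2)) m)⁻¹ * f m := by
  rw [metric_inv κ hx, Finset.sum_eq_single m]
  · rw [Matrix.diagonal_apply_eq]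
  · intro b _ hb
    rw [Matrix.diagonal_apply_ne' _ hb, zero_mul]
  · simp

lemma vorticity_eq (κ : ℝ) {ω β₀ : ℝ} (hβ₀ : 0 < β₀) {x : Fin 4 → ℝ} (hx : x ∈ chart)
    (hk : 0 < 1 - paramS (κ ^ 2) (x 1) (sin (x 2)) * ω ^ 2) (m : Fin 4) :
    vorticity (metric κ) (fourTemperature κ ω β₀) x m =
      κ * ω / (1 - paramS (κ ^ 2) (x 1) (sin (x 2)) * ω ^ 2) *
        ![0, -(cos (x 2) * conf κ (x 1)), sin (x 2) * (2 - conf κ (x 1)) / x 1, 0] m := by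
  have hl := lorentz_sq hk
  obtain ⟨h1, h2, h3⟩ := id hx
  have hs := sin_pos_of_pos_of_lt_pi h2 h3
  have hc := conf_pos κ (x 1)
  have e : (1 + κ ^ 2 * x 1 ^ 2 / 4) = conf κ (x 1) := rfl
  rw [vorticity, sum_metric_inv κ hx, sum_volTensor κ hx m (u := velocity _ _ x)
    (by simp [velocity_eq κ ω hβ₀]) (by simp [velocity_eq κ ω hβ₀])]
  simp only [sum_metric_inv κ hx, covDeriv_velocity κ hβ₀ hx hk, velocity_eq κ ω hβ₀]
  generalize lorentz ω (paramS (κ ^ 2) (x 1) (sin (x 2))) = γ at *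
  have hk' := hk.ne'
  fin_cases m <;> simp [shear, metricDiag, e]
  all_goals
    generalize 1 - paramS (κ ^ 2) (x 1) (sin (x 2)) * ω ^ 2 = k at *
    obtain rfl : k = (γ ^ 2)⁻¹ := by rw [hl, inv_inv]
    have hγ : γ ≠ 0 := by rintro rfl; simp at hk
    field_simp
    ring

/-- Acceleration and vorticity lie in the `r`-`θ` plane, so their dual with `u` is the direction in
the `t`-`φ` plane orthogonal to `u`. Its length involves `1 - S` through `key`. -/
lemma lVector_eq (κ : ℝ) {ω β₀ : ℝ} (hβ₀ : 0 < β₀) {x : Fin 4 → ℝ} (hx : x ∈ chart)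
    (hk : 0 < 1 - paramS (κ ^ 2) (x 1) (sin (x 2)) * ω ^ 2) (m : Fin 4) :
    lVector (metric κ) (fourTemperature κ ω β₀) x m =
      lorentz ω (paramS (κ ^ 2) (x 1) (sin (x 2))) *
        (-(ω ^ 2 * κ ^ 3 * ω * (1 - paramS (κ ^ 2) (x 1) (sin (x 2)))) /
          (1 - paramS (κ ^ 2) (x 1) (sin (x 2)) * ω ^ 2) ^ 2) *
      ![κ * ω * x 1 ^ 2 * sin (x 2) ^ 2 / conf κ (x 1) ^ 2, 0, 0, 1] m := by
  obtain ⟨h1, h2, h3⟩ := id hx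
  have hs := sin_pos_of_pos_of_lt_pi h2 h3
  have hc := conf_pos κ (x 1)
  have e : (1 + κ ^ 2 * x 1 ^ 2 / 4) = conf κ (x 1) := rfl
  -- With `κ² r² = 4 (h - 1)` one has `(2 - h)² = h² - κ² r²`, so the squared length of the
  -- vorticity direction is proportional to `1 - S`.
  have key : sin (x 2) ^ 2 * (2 - conf κ (x 1)) ^ 2 + cos (x 2) ^ 2 * conf κ (x 1) ^ 2 =
      conf κ (x 1) ^ 2 * (1 - paramS (κ ^ 2) (x 1) (sin (x 2))) := by
    have e' : κ ^ 2 * x 1 ^ 2 = 4 * conf κ (x 1) - 4 := by unfold conf; ring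
    rw [paramS_eq_conf, cos_sq']
    field_simp
    linear_combination sin (x 2) ^ 2 * e'
  simp only [lVector, mul_assoc (_ * _) (acceleration _ _ _ _)]
  rw [sum_metric_inv κ hx, sum_volTensor κ hx m (u := velocity _ _ x)
    (F := fun r s => acceleration _ _ x r * vorticity _ _ x s)
    (by simp [velocity_eq κ ω hβ₀]) (by simp [velocity_eq κ ω hβ₀])]
  simp only [acceleration_eq κ hβ₀ hx hk, vorticity_eq κ hβ₀ hx hk, velocity_eq κ ω hβ₀]
  generalize lorentz ω (paramS (κ ^ 2) (x 1) (sin (x 2))) = γ at *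
  have hk' := hk.ne'
  generalize 1 - paramS (κ ^ 2) (x 1) (sin (x 2)) * ω ^ 2 = k at *
  generalize paramS (κ ^ 2) (x 1) (sin (x 2)) = S at *
  fin_cases m <;> simp [metricDiag, e] <;> field_simp
  · linear_combination (-γ * κ ^ 4 * ω ^ 4) * key
  · linear_combination (-γ * κ ^ 3 * ω ^ 3) * key

/-! ### Stationary axisymmetric stress-energy tensors depending on `S` -/

/-- A stress-energy tensor whose components in a frame adapted to the level sets of `S` are
functions `T, Q, P, M, F` of `S`. -/
noncomputable def stressForm (κ : ℝ) (T Q P M F : ℝ → ℝ) (r θ : ℝ) : Matrix (Fin 4) (Fin 4) ℝ :=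
  let S := paramS (κ ^ 2) r (sin θ)
  let h := conf κ r
  !![T S, 0, 0, Q S;
    0, P S * h ^ 2 + M S * (cos θ * h) ^ 2, -(M S * (cos θ * h) * (sin θ * (2 - h) / r)), 0;
    0, -(M S * (cos θ * h) * (sin θ * (2 - h) / r)),
      P S * h ^ 2 / r ^ 2 + M S * (sin θ * (2 - h) / r) ^ 2, 0;
    Q S, 0, 0, F S * h ^ 2 / (r ^ 2 * sin θ ^ 2)]

lemma tensorTrace_stressForm {κ : ℝ} {T Q P M F : ℝ → ℝ} {x : Fin 4 → ℝ} (hx : x ∈ chart)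
    (h : let S := paramS (κ ^ 2) (x 1) (sin (x 2)); T S = 2 * P S + M S * (1 - S) + F S) :
    tensorTrace (metric κ) (fun y => stressForm κ T Q P M F (y 1) (y 2)) x = 0 := by
  obtain ⟨h1, h2, h3⟩ := hx
  have hs := sin_pos_of_pos_of_lt_pi h2 h3
  have hc := conf_pos κ (x 1)
  have e : (1 + κ ^ 2 * x 1 ^ 2 / 4) = conf κ (x 1) := rfl
  have e' : κ ^ 2 * x 1 ^ 2 = 4 * conf κ (x 1) - 4 := by unfold conf; ring
  have hS := paramS_eq_conf κ (x 1) (sin (x 2))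
  have hS' : paramS (κ ^ 2) (x 1) (sin (x 2)) * conf κ (x 1) ^ 2 =
      (4 * conf κ (x 1) - 4) * sin (x 2) ^ 2 := by rw [hS, ← e']; field_simp
  simp [tensorTrace, Fin.sum_univ_four, metric, metricDiag, e, stressForm]
  rw [h]
  generalize paramS (κ ^ 2) (x 1) (sin (x 2)) = S at *
  field_simp
  rw [cos_sq']
  linear_combination (-M S) * hS'

lemma differentiableAt_conf (κ r : ℝ) : DifferentiableAt ℝ (conf κ) r :=
  (hasDerivAt_conf κ r).differentiableAt

lemma differentiableAt_div {f g : (Fin 4 → ℝ) → ℝ} {x : Fin 4 → ℝ} (hf : DifferentiableAt ℝ f x)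
    (hg : DifferentiableAt ℝ g x) (h : g x ≠ 0) : DifferentiableAt ℝ (fun y => f y / g y) x := by
  simp only [div_eq_mul_inv]
  exact hf.mul (hg.inv h)

lemma differentiableAt_stressForm {κ : ℝ} {T Q P M F : ℝ → ℝ} {x : Fin 4 → ℝ} (hx : x ∈ chart)
    (h : ∀ f ∈ [T, Q, P, M, F], DifferentiableAt ℝ f (paramS (κ ^ 2) (x 1) (sin (x 2))))
    (m n : Fin 4) :
    DifferentiableAt ℝ (fun y : Fin 4 → ℝ => stressForm κ T Q P M F (y 1) (y 2) m n) x := by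
  obtain ⟨h1, h2, h3⟩ := hx
  have hs := sin_pos_of_pos_of_lt_pi h2 h3
  have hc := conf_pos κ (x 1)
  have d1 : DifferentiableAt ℝ (fun y : Fin 4 → ℝ => y 1) x := by fun_prop
  have ds : DifferentiableAt ℝ (fun y : Fin 4 → ℝ => sin (y 2)) x := by fun_prop
  have dc : DifferentiableAt ℝ (fun y : Fin 4 → ℝ => cos (y 2)) x := by fun_prop
  have dh : DifferentiableAt ℝ (fun y : Fin 4 → ℝ => conf κ (y 1)) x :=
    DifferentiableAt.comp (g := conf κ) x (differentiableAt_conf κ (x 1)) d1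
  have dS : DifferentiableAt ℝ (fun y : Fin 4 → ℝ => paramS (κ ^ 2) (y 1) (sin (y 2))) x := by
    simp only [paramS_eq_conf]
    exact differentiableAt_div
      (((d1.pow 2).const_mul (κ ^ 2)).mul (ds.pow 2)) (dh.pow 2) (pow_ne_zero 2 hc.ne')
  have dF : ∀ f ∈ [T, Q, P, M, F],
      DifferentiableAt ℝ (fun y : Fin 4 → ℝ => f (paramS (κ ^ 2) (y 1) (sin (y 2)))) x :=
    fun f hf => DifferentiableAt.comp (g := f) x (h f hf) dS
  simp only [List.forall_mem_cons] at dF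
  obtain ⟨dT, dQ, dP, dM, dF, -⟩ := dF
  have i1 := h1.ne'
  have i2 : x 1 ^ 2 ≠ 0 := by positivity
  have i3 : x 1 ^ 2 * sin (x 2) ^ 2 ≠ 0 := by positivity
  fin_cases m <;> fin_cases n <;> simp only [stressForm]
  all_goals first
    | exact differentiableAt_const 0
    | exact dT
    | exact dQ
    | exact (dP.mul (dh.pow 2)).add (dM.mul ((dc.mul dh).pow 2))
    | exact ((dM.mul (dc.mul dh)).mul (differentiableAt_div (ds.mul (dh.const_sub 2)) d1 i1)).neg
    | exact DifferentiableAt.fun_add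
        (differentiableAt_div (dP.mul (dh.pow 2)) (d1.pow 2) i2)
        (dM.mul ((differentiableAt_div (ds.mul (dh.const_sub 2)) d1 i1).pow 2))
    | exact differentiableAt_div
        (dF.mul (dh.pow 2)) ((d1.pow 2).mul (ds.pow 2)) i3

/-- The `t` and `φ` equations are trivial by symmetry. The `r` and `θ` equations are the defect of
the relation `h` times one common vector. The derivative of `M` drops out because the direction it
multiplies is tangent to the level sets of `S`. -/
lemma covDiv_stressForm {κ : ℝ} {T Q P M F : ℝ → ℝ} {x : Fin 4 → ℝ} (hx : x ∈ chart)
    {p' m' : ℝ} (hP : HasDerivAt P p' (paramS (κ ^ 2) (x 1) (sin (x 2))))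
    (hM : HasDerivAt M m' (paramS (κ ^ 2) (x 1) (sin (x 2))))
    (h : let S := paramS (κ ^ 2) (x 1) (sin (x 2)); F S = P S + 2 * S * p' + S * M S) (n : Fin 4) :
    covDiv (metric κ) (fun y => stressForm κ T Q P M F (y 1) (y 2)) x n = 0 := by
  obtain ⟨h1, h2, h3⟩ := id hx
  have hs := sin_pos_of_pos_of_lt_pi h2 h3
  have hc := conf_pos κ (x 1)
  have e' : κ ^ 2 * x 1 ^ 2 = 4 * conf κ (x 1) - 4 := by unfold conf; ring
  have hS := paramS_eq_conf κ (x 1) (sin (x 2))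
  have hS' : paramS (κ ^ 2) (x 1) (sin (x 2)) * conf κ (x 1) ^ 2 =
      κ ^ 2 * x 1 ^ 2 * sin (x 2) ^ 2 := by rw [hS]; field_simp
  have hcos := cos_sq' (x 2)
  have p0 (n : Fin 4) := pd_zero_of_two (fun r θ => stressForm κ T Q P M F r θ 0 n) x
  have p3 (n : Fin 4) := pd_three_of_two (fun r θ => stressForm κ T Q P M F r θ 3 n) x
  have Sr := hasDerivAt_paramS_left κ (x 1) (sin (x 2))
  have Sθ := hasDerivAt_paramS_sin κ (x 1) (x 2)
  have Pr := HasDerivAt.comp (h₂ := P) (x 1) hP Sr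
  have Mr := HasDerivAt.comp (h₂ := M) (x 1) hM Sr
  have Pθ := HasDerivAt.comp (h₂ := P) (x 2) hP Sθ
  have Mθ := HasDerivAt.comp (h₂ := M) (x 2) hM Sθ
  have hr := hasDerivAt_conf κ (x 1)
  have q11 := pd_one_of_two (Φ := fun r θ => stressForm κ T Q P M F r θ 1 1)
    ((Pr.mul (hr.pow 2)).add (Mr.mul ((hr.const_mul (cos (x 2))).pow 2)))
  have q12 := pd_one_of_two (Φ := fun r θ => stressForm κ T Q P M F r θ 1 2)
    ((Mr.mul (hr.const_mul (cos (x 2)))).mul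
      (((hr.const_sub 2).const_mul (sin (x 2))).div (hasDerivAt_id (x 1)) h1.ne')).neg
  have q21 := pd_two_of_two (Φ := fun r θ => stressForm κ T Q P M F r θ 2 1)
    ((Mθ.mul ((hasDerivAt_cos (x 2)).mul_const (conf κ (x 1)))).mul
      (((hasDerivAt_sin (x 2)).mul_const (2 - conf κ (x 1))).div_const (x 1))).neg
  have q22 := pd_two_of_two (Φ := fun r θ => stressForm κ T Q P M F r θ 2 2)
    (((Pθ.mul_const (conf κ (x 1) ^ 2)).div_const (x 1 ^ 2)).add
      (Mθ.mul ((((hasDerivAt_sin (x 2)).mul_const (2 - conf κ (x 1))).div_const (x 1)).pow 2)))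
  have q10 := pd_one_of_two (Φ := fun r θ => stressForm κ T Q P M F r θ 1 0)
    (hasDerivAt_const (x 1) 0)
  have q13 := pd_one_of_two (Φ := fun r θ => stressForm κ T Q P M F r θ 1 3)
    (hasDerivAt_const (x 1) 0)
  have q20 := pd_two_of_two (Φ := fun r θ => stressForm κ T Q P M F r θ 2 0)
    (hasDerivAt_const (x 2) 0)
  have q23 := pd_two_of_two (Φ := fun r θ => stressForm κ T Q P M F r θ 2 3)
    (hasDerivAt_const (x 2) 0)
  simp only [covDiv, christoffel_eq_chr κ hx]
  have hF : F (paramS (κ ^ 2) (x 1) (sin (x 2))) = _ := h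
  match n with
  | 0 =>
    simp only [Fin.sum_univ_four, p0, p3, q10, q20]
    simp [chr, stressForm]
  | 1 =>
    simp only [Fin.sum_univ_four, p0, p3, q11, q21]
    simp [chr, stressForm]
    rw [hF]
    generalize paramS (κ ^ 2) (x 1) (sin (x 2)) = S at *
    generalize P S = P, M S = M
    clear q10 q13 q20 q23 q22 q21 q11 q12 p0 p3 Pr Mr Pθ Mθ Sr Sθ
    field_simp
    grind
  | 2 =>
    simp only [Fin.sum_univ_four, p0, p3, q12, q22]
    simp [chr, stressForm]
    rw [hF]
    generalize paramS (κ ^ 2) (x 1) (sin (x 2)) = S at *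
    generalize P S = P, M S = M
    clear q10 q13 q20 q23 q22 q21 q11 q12 p0 p3 Pr Mr Pθ Mθ Sr Sθ
    field_simp
    grind
  | 3 =>
    simp only [Fin.sum_univ_four, p0, p3, q13, q23]
    simp [chr, stressForm]

/-! ### Trace, differentiability and conservation of the distilled tensors -/

/-- The closed form is needed on a neighbourhood, not only at the point, since the divergence
differentiates the components. -/
lemma traceless_and_conserved {κ : ℝ} {T Q P M F : ℝ → ℝ} {x : Fin 4 → ℝ} (hx : x ∈ chart)
    {U : (Fin 4 → ℝ) → Fin 4 → Fin 4 → ℝ}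
    (hU : ∀ᶠ y in 𝓝 x, U y = stressForm κ T Q P M F (y 1) (y 2))
    (hd : ∀ f ∈ [T, Q, P, M, F], DifferentiableAt ℝ f (paramS (κ ^ 2) (x 1) (sin (x 2))))
    (ht : let S := paramS (κ ^ 2) (x 1) (sin (x 2)); T S = 2 * P S + M S * (1 - S) + F S)
    (hc : let S := paramS (κ ^ 2) (x 1) (sin (x 2)); F S = P S + 2 * S * deriv P S + S * M S) :
    tensorTrace (metric κ) U x = 0 ∧ (∀ μ ν, DifferentiableAt ℝ (fun y => U y μ ν) x) ∧
      ∀ ν, covDiv (metric κ) U x ν = 0 := by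
  have hU' (μ ν : Fin 4) : (fun y => U y μ ν) =ᶠ[𝓝 x]
      fun y => stressForm κ T Q P M F (y 1) (y 2) μ ν := hU.mono fun y hy => congrFun₂ hy μ ν
  refine ⟨?_, fun μ ν => ((differentiableAt_stressForm hx hd μ ν).congr_of_eventuallyEq
    (hU' μ ν)), fun ν => ?_⟩
  · rw [← tensorTrace_stressForm (Q := Q) hx ht]
    simp only [tensorTrace, hU.self_of_nhds]
  · rw [← covDiv_stressForm (T := T) (Q := Q) hx (hd P (by simp)).hasDerivAt
      (hd M (by simp)).hasDerivAt hc ν]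
    simp only [covDiv, hU.self_of_nhds, pd_congr (hU' _ _)]

lemma restDistStress_eq (κ : ℝ) {β₀ : ℝ} (hβ₀ : 0 < β₀) {x : Fin 4 → ℝ} (hx : x ∈ chart) :
    let C := π ^ 2 / (90 * β₀ ^ 4) - κ ^ 4 / (1440 * π ^ 2)
    restDistStress κ β₀ x = stressForm κ (fun _ => 3 * C) (fun _ => 0) (fun _ => C) (fun _ => 0)
      (fun _ => C) (x 1) (x 2) := by
  intro C
  obtain ⟨h1, h2, h3⟩ := id hx
  have hs := sin_pos_of_pos_of_lt_pi h2 h3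
  have hc := conf_pos κ (x 1)
  have e : (1 + κ ^ 2 * x 1 ^ 2 / 4) = conf κ (x 1) := rfl
  have hC : π ^ 2 / (90 * β₀ ^ 4) - κ ^ 4 / (1440 * π ^ 2) = C := rfl
  ext μ ν
  rw [restDistStress, hC, metric_inv κ hx]
  simp only [velocity_eq κ 0 hβ₀]
  fin_cases μ <;> fin_cases ν <;>
    simp [stressForm, metricDiag, e, lorentz] <;> field_simp
  norm_num

/-- The transverse pressure of the distilled tensor. -/
noncomputable def pressureFn (ω q b S : ℝ) : ℝ :=
  π ^ 2 / (90 * (1 - S * ω ^ 2) ^ 2 * b ^ 4)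
    + (1 - S) * ω ^ 2 * q / (36 * (1 - S * ω ^ 2) ^ 3 * b ^ 2)
    - (S ^ 2 * ω ^ 8 + (4 * S - 20 * S ^ 2) * ω ^ 6 + 10 * (1 + S + S ^ 2) * ω ^ 4
        + (4 * S - 20) * ω ^ 2 + 1) / (1440 * π ^ 2 * (1 - S * ω ^ 2) ^ 4) * q ^ 2

/-- The pressure anisotropy of the distilled tensor along the vorticity. -/
noncomputable def anisotropyFn (ω q b S : ℝ) : ℝ :=
  -(q * ω ^ 2 / (18 * (1 - S * ω ^ 2) ^ 3 * b ^ 2))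
    - q ^ 2 * ω ^ 2 * (2 - ω ^ 2 - S * (2 * ω ^ 4 - ω ^ 2)) / (72 * π ^ 2 * (1 - S * ω ^ 2) ^ 4)

/-- The heat flow of the distilled tensor. -/
noncomputable def heatFn (ω q b S : ℝ) : ℝ :=
  (π ^ 2 * (1 - ω ^ 2) / (3 * b ^ 2) + (ω ^ 4 - 1) * q / 60) / (6 * π ^ 2 * (1 - S * ω ^ 2))

/-- The `t t` component of the distilled tensor. -/
noncomputable def energyFn (ω q b S : ℝ) : ℝ :=
  (distCoeff π S ω q b .rho + distCoeff π S ω q b .p) / (1 - S * ω ^ 2) - distCoeff π S ω q b .p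
    - 2 * ω ^ 2 * heatFn ω q b S * q * S / (1 - S * ω ^ 2) ^ 3

/-- The `t φ` component of the distilled tensor. -/
noncomputable def momentumFn (κ ω b S : ℝ) : ℝ :=
  κ * ω * ((distCoeff π S ω (κ ^ 2) b .rho + distCoeff π S ω (κ ^ 2) b .p) / (1 - S * ω ^ 2)
    - heatFn ω (κ ^ 2) b S * κ ^ 2 * (1 + S * ω ^ 2) / (1 - S * ω ^ 2) ^ 3)

/-- The azimuthal pressure of the distilled tensor. -/
noncomputable def azimuthalFn (ω q b S : ℝ) : ℝ :=
  (distCoeff π S ω q b .rho + distCoeff π S ω q b .p) * S * ω ^ 2 / (1 - S * ω ^ 2)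
    + distCoeff π S ω q b .p - 2 * ω ^ 2 * heatFn ω q b S * q * S / (1 - S * ω ^ 2) ^ 3

/-! ### Algebraic identities between the component functions. -/

section Components
variable {ω q b S : ℝ}

lemma distCoeff_p_add_A (hb : b ≠ 0) (hS : 1 - S ≠ 0) (hk : 1 - S * ω ^ 2 ≠ 0) :
    distCoeff π S ω q b .p + distCoeff π S ω q b .A * ω ^ 4 * q * S * (1 - S) /
      (1 - S * ω ^ 2) ^ 2 = pressureFn ω q b S := by
  have hπ := pi_pos.ne'
  simp only [distCoeff, pressureFn]
  field_simp
  ring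

/-- In the `r`-`θ` plane the inverse metric is a combination of `A A` and `ω ω`. Eliminating `A A`
moves `𝒜` partly into the pressure, as in the previous lemma, and partly into the coefficient of `ω
ω`. The poles of `W` and `𝒜` at `S = 1` cancel in this combination. -/
lemma distCoeff_W_sub_A (hω : ω ≠ 0) (hb : b ≠ 0) (hS : 1 - S ≠ 0) (hk : 1 - S * ω ^ 2 ≠ 0) :
    distCoeff π S ω q b .W * q * ω ^ 2 / (1 - S * ω ^ 2) ^ 2 -
      distCoeff π S ω q b .A * ω ^ 4 * q * S / (1 - S * ω ^ 2) ^ 2 = anisotropyFn ω q b S := by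
  have hπ := pi_pos.ne'
  simp only [distCoeff, anisotropyFn]
  field_simp
  ring

lemma distCoeff_G_mul (hω : ω ≠ 0) (hS : 1 - S ≠ 0) (hk : 1 - S * ω ^ 2 ≠ 0) :
    distCoeff π S ω q b .G * ω ^ 2 * (1 - S) = heatFn ω q b S := by
  have hπ := pi_pos.ne'
  simp only [distCoeff, heatFn]
  field_simp

/-- This is the trace condition for the distilled coefficients. -/
lemma energyFn_eq (hb : b ≠ 0) (hk : 1 - S * ω ^ 2 ≠ 0) : energyFn ω q b S =
    2 * pressureFn ω q b S + anisotropyFn ω q b S * (1 - S) + azimuthalFn ω q b S := by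
  have hπ := pi_pos.ne'
  simp only [energyFn, azimuthalFn, heatFn, pressureFn, anisotropyFn, distCoeff]
  field_simp
  ring

lemma hasDerivAt_pressureFn (hb : b ≠ 0) (hk : 1 - S * ω ^ 2 ≠ 0) :
    HasDerivAt (pressureFn ω q b)
      (π ^ 2 * ω ^ 2 / (45 * (1 - S * ω ^ 2) ^ 3 * b ^ 4)
        + ω ^ 2 * q * (3 * ω ^ 2 * (1 - S) - (1 - S * ω ^ 2)) / (36 * (1 - S * ω ^ 2) ^ 4 * b ^ 2)
        - ((2 * S * ω ^ 8 + (4 - 40 * S) * ω ^ 6 + 10 * (1 + 2 * S) * ω ^ 4 + 4 * ω ^ 2) *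
            (1 - S * ω ^ 2) + 4 * ω ^ 2 * (S ^ 2 * ω ^ 8 + (4 * S - 20 * S ^ 2) * ω ^ 6
              + 10 * (1 + S + S ^ 2) * ω ^ 4 + (4 * S - 20) * ω ^ 2 + 1)) /
          (1440 * π ^ 2 * (1 - S * ω ^ 2) ^ 5) * q ^ 2) S := by
  have hπ := pi_pos.ne'
  have hS := hasDerivAt_id S
  have hK : HasDerivAt (fun S => 1 - S * ω ^ 2) (-ω ^ 2) S := by
    simpa using (hS.mul_const (ω ^ 2)).const_sub 1
  have h1 := (hasDerivAt_const S (π ^ 2)).div (((hK.pow 2).const_mul 90).mul_const (b ^ 4))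
    (by simp [hk, hb])
  have h2 := (((hS.const_sub 1).mul_const (ω ^ 2)).mul_const q).div
    (((hK.pow 3).const_mul 36).mul_const (b ^ 2)) (by simp [hk, hb])
  have h3 := (((((((hS.pow 2).mul_const (ω ^ 8)).add
    (((hS.const_mul 4).sub ((hS.pow 2).const_mul 20)).mul_const (ω ^ 6))).add
    ((((hS.const_add 1).add (hS.pow 2)).const_mul 10).mul_const (ω ^ 4))).add
    (((hS.const_mul 4).sub_const 20).mul_const (ω ^ 2))).add_const 1).div
    ((hK.pow 4).const_mul (1440 * π ^ 2)) (by simp [hk, hπ])).mul_const (q ^ 2)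
  refine HasDerivAt.congr_deriv (f := pressureFn ω q b) ((h1.add h2).sub h3) ?_
  simp only [Pi.pow_apply, id, Pi.add_apply, Pi.sub_apply]
  generalize 1 - S * ω ^ 2 = k at *
  field_simp
  norm_num
  ring

/-- This is the conservation equation. The thermal `b⁻⁴`, mixed `b⁻²` and vacuum-like contributions
must each satisfy it, which ties together all five distilled coefficients. -/
lemma azimuthalFn_eq (hb : b ≠ 0) (hk : 1 - S * ω ^ 2 ≠ 0) : azimuthalFn ω q b S =
    pressureFn ω q b S + 2 * S * deriv (pressureFn ω q b) S + S * anisotropyFn ω q b S := by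
  have hπ := pi_pos.ne'
  rw [(hasDerivAt_pressureFn hb hk).deriv]
  simp only [azimuthalFn, heatFn, pressureFn, anisotropyFn, distCoeff]
  field_simp
  ring

end Components

lemma distStress_eq (κ : ℝ) {ω β₀ : ℝ} (hω : ω ≠ 0) (hβ₀ : 0 < β₀) {x : Fin 4 → ℝ} (hx : x ∈ chart)
    (hS : paramS (κ ^ 2) (x 1) (sin (x 2)) < 1)
    (hk : 0 < 1 - paramS (κ ^ 2) (x 1) (sin (x 2)) * ω ^ 2) :
    distStress κ ω β₀ x = stressForm κ (energyFn ω (κ ^ 2) β₀) (momentumFn κ ω β₀)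
      (pressureFn ω (κ ^ 2) β₀) (anisotropyFn ω (κ ^ 2) β₀) (azimuthalFn ω (κ ^ 2) β₀)
      (x 1) (x 2) := by
  obtain ⟨h1, h2, h3⟩ := id hx
  have hs := sin_pos_of_pos_of_lt_pi h2 h3
  have hc := conf_pos κ (x 1)
  have e : (1 + κ ^ 2 * x 1 ^ 2 / 4) = conf κ (x 1) := rfl
  have e' : κ ^ 2 * x 1 ^ 2 = 4 * conf κ (x 1) - 4 := by unfold conf; ring
  have hS' : paramS (κ ^ 2) (x 1) (sin (x 2)) * conf κ (x 1) ^ 2 =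
      κ ^ 2 * x 1 ^ 2 * sin (x 2) ^ 2 := by rw [paramS_eq_conf]; field_simp
  have hcos := cos_sq' (x 2)
  have hl := lorentz_sq hk
  have hS₁ := (sub_pos.2 hS).ne'
  have k0 := hk.ne'
  have E₁ := distCoeff_p_add_A (q := κ ^ 2) hβ₀.ne' hS₁ k0
  have E₂ := distCoeff_W_sub_A (q := κ ^ 2) hω hβ₀.ne' hS₁ k0
  have E₃ := distCoeff_G_mul (q := κ ^ 2) (b := β₀) hω hS₁ k0
  ext μ ν
  simp only [distStress, distScalar, velocity_eq κ ω hβ₀, acceleration_eq κ hβ₀ hx hk,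
    vorticity_eq κ hβ₀ hx hk, lVector_eq κ hβ₀ hx hk, metric_inv κ hx, stressForm, energyFn,
    momentumFn, azimuthalFn, ← E₁, ← E₂, ← E₃]
  clear E₁ E₂ E₃
  generalize distCoeff π (paramS (κ ^ 2) (x 1) (sin (x 2))) ω (κ ^ 2) β₀ = d
  generalize d .rho = ρ, d .p = p, d .A = A, d .W = W, d .G = G
  generalize lorentz ω (paramS (κ ^ 2) (x 1) (sin (x 2))) = γ at *
  generalize 1 - paramS (κ ^ 2) (x 1) (sin (x 2)) * ω ^ 2 = k at *
  generalize paramS (κ ^ 2) (x 1) (sin (x 2)) = S at *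
  fin_cases μ <;> fin_cases ν <;> simp [metricDiag, e]
  all_goals
    -- Eliminating `1 - S ω²` in favour of the Lorentz factor removes the square root and makes each
    -- component a rational identity.
    obtain rfl : k = (γ ^ 2)⁻¹ := by rw [hl, inv_inv]
    have hγ : γ ≠ 0 := by rintro rfl; simp at hk
    clear hl k0 hk hβ₀ hx e hS hS₁
    field_simp
    grind

theorem restDistStress_traceless_and_conserved {κ β₀ : ℝ} (hβ₀ : 0 < β₀) {x : Fin 4 → ℝ}
    (hx : x ∈ chart) : tensorTrace (metric κ) (restDistStress κ β₀) x = 0 ∧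
      (∀ μ ν, DifferentiableAt ℝ (fun y => restDistStress κ β₀ y μ ν) x) ∧
      ∀ ν, covDiv (metric κ) (restDistStress κ β₀) x ν = 0 := by
  refine traceless_and_conserved hx ((isOpen_chart.eventually_mem hx).mono fun y hy =>
    restDistStress_eq κ hβ₀ hy) (by simp) ?_ ?_
  · simp only
    ring
  · simp

lemma differentiableAt_components {κ ω b S : ℝ} (hb : b ≠ 0) (hk : 1 - S * ω ^ 2 ≠ 0) :
    ∀ f ∈ [energyFn ω (κ ^ 2) b, momentumFn κ ω b, pressureFn ω (κ ^ 2) b,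
      anisotropyFn ω (κ ^ 2) b, azimuthalFn ω (κ ^ 2) b], DifferentiableAt ℝ f S := by
  have hπ := pi_pos.ne'
  simp only [List.forall_mem_cons, List.not_mem_nil, false_imp_iff, implies_true, and_true]
  refine ⟨?_, ?_, ?_, ?_, ?_⟩
  · unfold energyFn heatFn
    simp only [distCoeff]
    fun_prop (disch := simp [hπ, hb, hk])
  · unfold momentumFn heatFn
    simp only [distCoeff]
    fun_prop (disch := simp [hπ, hb, hk])
  · unfold pressureFn
    fun_prop (disch := simp [hπ, hb, hk])
  · unfold anisotropyFn
    fun_prop (disch := simp [hπ, hb, hk])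
  · unfold azimuthalFn heatFn
    simp only [distCoeff]
    fun_prop (disch := simp [hπ, hb, hk])

theorem distStress_traceless_and_conserved {κ ω β₀ : ℝ} (hω : ω ≠ 0) (hω₁ : |ω| < 1)
    (hβ₀ : 0 < β₀) {x : Fin 4 → ℝ} (hx : x ∈ chart) (hS : paramS (κ ^ 2) (x 1) (sin (x 2)) < 1) :
    tensorTrace (metric κ) (distStress κ ω β₀) x = 0 ∧
      (∀ μ ν, DifferentiableAt ℝ (fun y => distStress κ ω β₀ y μ ν) x) ∧
      ∀ ν, covDiv (metric κ) (distStress κ ω β₀) x ν = 0 := by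
  have hk (y : Fin 4 → ℝ) (hy : paramS (κ ^ 2) (y 1) (sin (y 2)) < 1) :
      0 < 1 - paramS (κ ^ 2) (y 1) (sin (y 2)) * ω ^ 2 := by
    have h₁ : ω ^ 2 < 1 := (sq_lt_one_iff_abs_lt_one ω).2 hω₁
    nlinarith [paramS_nonneg κ (y 1) (sin (y 2)), sq_nonneg ω]
  have hcont : ContinuousAt (fun y : Fin 4 → ℝ => paramS (κ ^ 2) (y 1) (sin (y 2))) x := by
    unfold paramS
    have h₁ : Continuous fun y : Fin 4 → ℝ => κ ^ 2 * y 1 ^ 2 := by fun_prop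
    have h₂ : Continuous fun y : Fin 4 → ℝ => (1 + κ ^ 2 * y 1 ^ 2 / 4) ^ 2 := by fun_prop
    have h₃ : Continuous fun y : Fin 4 → ℝ => sin (y 2) ^ 2 := by fun_prop
    exact ((h₁.div h₂ fun y => by positivity).mul h₃).continuousAt
  -- The condition `S < 1` is open by continuity of `S`, so the closed form persists near `x`.
  have hU : ∀ᶠ y in 𝓝 x, distStress κ ω β₀ y = stressForm κ (energyFn ω (κ ^ 2) β₀)
      (momentumFn κ ω β₀) (pressureFn ω (κ ^ 2) β₀) (anisotropyFn ω (κ ^ 2) β₀)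
      (azimuthalFn ω (κ ^ 2) β₀) (y 1) (y 2) := by
    filter_upwards [isOpen_chart.eventually_mem hx, hcont.eventually_lt_const hS] with y hy hy'
    exact distStress_eq κ hω hβ₀ hy hy' (hk y hy')
  exact traceless_and_conserved hx hU (differentiableAt_components hβ₀.ne' (hk x hS).ne')
    (energyFn_eq hβ₀.ne' (hk x hS).ne') (azimuthalFn_eq hβ₀.ne' (hk x hS).ne')

theorem isDistillate_restStress {β₀ : ℝ} (hβ₀ : 0 < β₀) (r θ : ℝ) (μ ν : Fin 4) :
    IsDistillate Complex.slitPlane 0 (fun z => restStress β₀ r θ (z ^ (1 / 2 : ℂ)) μ ν)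
      (fun z => (π ^ 2 / (90 * β₀ ^ 4) - z ^ 2 / (1440 * π ^ 2)) *
        (-complexMetric z r θ μ ν + 4 * restVelocity μ * restVelocity ν)) := by
  -- The weight is `(4 u u - g) / 3`: the density factors out of the whole tensor because the
  -- pressure is a third of it.
  have h := isDistillate_restDensity hβ₀ (w := fun z => restVelocity μ * restVelocity ν -
    1 / 3 * (complexMetric z r θ μ ν - restVelocity μ * restVelocity ν))
    (analyticAt_const.sub (analyticAt_const.mul
      ((analyticAt_complexMetric r θ μ ν).sub analyticAt_const)))
  convert h using 2 with z z
  · rw [restStress, cpow_half_sq]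
    ring
  · ring

end CEU

theorem mainTheorem4 (β₀ : ℝ) (hβ₀ : 0 < β₀) :
    -- equilibrium at rest
    ((∀ z ∈ Complex.slitPlane, Summable fun n : ℕ =>
        (2 + Complex.cosh ((n + 1) * z ^ (1 / 2 : ℂ) * β₀)) /
          Complex.sinh ((n + 1) * z ^ (1 / 2 : ℂ) * β₀ / 2) ^ 4) ∧
      (IntegrableOn CEU.restIntegrand (Ioi 0) ∧ ∫ x in Ioi (0 : ℝ), CEU.restIntegrand x = 0) ∧
      CEU.IsDistillate Complex.slitPlane 0
        (fun z => CEU.restDensity β₀ (z ^ (1 / 2 : ℂ)))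
        (fun z => π ^ 2 / (30 * β₀ ^ 4) - z ^ 2 / (480 * π ^ 2)) ∧
      (∀ r θ : ℝ, 0 < r → 0 < θ → θ < π → ∀ μ ν : Fin 4,
        CEU.IsDistillate Complex.slitPlane 0
          (fun z => CEU.restStress β₀ r θ (z ^ (1 / 2 : ℂ)) μ ν)
          (fun z => (π ^ 2 / (90 * β₀ ^ 4) - z ^ 2 / (1440 * π ^ 2)) *
            (-CEU.complexMetric z r θ μ ν + 4 * CEU.restVelocity μ * CEU.restVelocity ν))) ∧
      (∀ κ : ℝ, 0 < κ → ∀ x ∈ CEU.chart,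
        CEU.tensorTrace (CEU.metric κ) (CEU.restDistStress κ β₀) x = 0 ∧
        (∀ μ ν : Fin 4, DifferentiableAt ℝ (fun y => CEU.restDistStress κ β₀ y μ ν) x) ∧
        ∀ ν : Fin 4, CEU.covDiv (CEU.metric κ) (CEU.restDistStress κ β₀) x ν = 0)) ∧
    -- rotating equilibrium
    (∀ ω₀ : ℝ, ω₀ ≠ 0 → |ω₀| < 1 →
      (∀ X : CEU.Coeff,
        (∀ S : ℂ, ‖S‖ < 1 → IntegrableOn (CEU.integrand X S ω₀) (Ioi 0)) ∧
        ∀ r θ : ℝ, 0 < r → 0 < θ → θ < π →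
          (∀ z ∈ CEU.domain ω₀ β₀ r θ,
            Summable (CEU.seriesTerm X ω₀ β₀ r θ (z ^ (1 / 2 : ℂ)))) ∧
          CEU.IsDistillate (CEU.domain ω₀ β₀ r θ) 0
            (fun z => CEU.scalarFun X ω₀ β₀ r θ (z ^ (1 / 2 : ℂ)))
            (fun z => CEU.distCoeff (π : ℂ)
              (CEU.paramS z (r : ℂ) (Real.sin θ : ℂ)) ω₀ z β₀ X) ∧
          (∀ δ : ℝ, 0 < δ → δ < π → ∀ N : ℕ,
            (fun z : ℂ => CEU.scalarFun X ω₀ β₀ r θ (z ^ (1 / 2 : ℂ))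
              - CEU.distCoeff (π : ℂ) (CEU.paramS z (r : ℂ) (Real.sin θ : ℂ)) ω₀ z β₀ X
              - CEU.integralTerm X ω₀ β₀ r θ (z ^ (1 / 2 : ℂ)))
            =O[𝓝[CEU.sector 0 (-(π - δ)) (π - δ)] 0] fun z => ‖z‖ ^ N) ∧
          (∀ κ : ℂ, CEU.integralTerm X ω₀ β₀ r θ (-κ) = -CEU.integralTerm X ω₀ β₀ r θ κ) ∧
          CEU.IsDistillate (CEU.domain ω₀ β₀ r θ) 0
            (fun z => CEU.integralTerm X ω₀ β₀ r θ (z ^ (1 / 2 : ℂ))) (fun _ => 0)) ∧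
      (∀ κ : ℝ, 0 < κ → ∀ x ∈ CEU.chart, CEU.paramS (κ ^ 2) (x 1) (sin (x 2)) < 1 →
        CEU.tensorTrace (CEU.metric κ) (CEU.distStress κ ω₀ β₀) x = 0 ∧
        (∀ μ ν : Fin 4, DifferentiableAt ℝ (fun y => CEU.distStress κ ω₀ β₀ y μ ν) x) ∧
        ∀ ν : Fin 4, CEU.covDiv (CEU.metric κ) (CEU.distStress κ ω₀ β₀) x ν = 0)) := by
  open CEU in
  refine ⟨⟨fun z hz => summable_rest hβ₀ hz, ⟨integrableOn_restIntegrand, integral_restIntegrand⟩,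
    by simpa using isDistillate_restDensity hβ₀ (w := fun _ => 1) analyticAt_const,
    fun r θ _ _ _ μ ν => isDistillate_restStress hβ₀ r θ μ ν,
    fun κ _ x hx => restDistStress_traceless_and_conserved hβ₀ hx⟩,
    fun ω₀ h0 hω => ⟨fun X => ⟨fun S hS => integrableOn_integrand X hω hS, fun r θ _ _ _ =>
      ⟨fun z hz => summable_seriesTerm X r θ hω hβ₀ (domain_subset_slitPlane _ _ _ _ hz),
      isDistillate_scalarFun X r θ h0 hω hβ₀,
      fun δ hδ hδπ N => scalarFun_isBigO X r θ hδ hδπ N h0 hω hβ₀,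
      fun κ => integralTerm_neg X r θ κ, isDistillate_integralTerm X r θ h0 hω hβ₀⟩⟩,
    fun κ _ x hx hS => distStress_traceless_and_conserved h0 hω hβ₀ hx hS⟩⟩
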